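/- Let $k$ be a commutative ring with unit, $d\ge 0$, $\mathfrak m=(x_1,\dots,x_d)\subset k[x_1,\dots,x_d]$, $A=k[x_1,\dots,x_d]/\mathfrak m^2$ and $\bar{\mathfrak m}=\mathfrak m/\mathfrak m^2$; tensor products are over $k$. The cyclic homology of $A$ is the homology of the total complex of the first quadrant cyclic (Tsygan) bicomplex with $A^{\otimes (q+1)}$ in column $p\ge 0$ and row $q\ge 0$. Its vertical maps are the Hochschild differential $b=\sum_{i=0}^{q}(-1)^i d_i$ in the even columns and $b'=\sum_{i=0}^{q-1}(-1)^i d_i$ in the odd columns, where $d_i(a_0\otimes\cdots\otimes a_q)=a_0\otimes\cdots\otimes a_ia_{i+1}\otimes\cdots\otimes a_q$ for $i<q$ and $d_q(a_0\otimes\cdots\otimes a_q)=a_qa_0\otimes a_1\otimes\cdots\otimes a_{q-1}$. Its horizontal maps from column $p+1$ to column $p$ are $1-t_q$ for $p$ even and $N_q=1+t_q+\cdots+t_q^{q}$ for $p$ odd, where $t_q(a_0\otimes\cdots\otimes a_q)=(-1)^q\,a_q\otimes a_0\otimes\cdots\otimes a_{q-1}$. All these maps preserve the weight of a tensor monomial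 (a tensor product of factors from $\{1,x_1,\dots,x_d\}$), that is, its number of factors $x_j$. For $w\ge 0$ let $HC^{(w)}_n(A)$ be the $n$-th homology of the total complex of the sub-bicomplex spanned by the tensor monomials of weight $w$. For $w\ge 1$ let $C_w=\langle\alpha:\alpha^w=1\rangle$ be the cyclic group of order $w$, acting $k$-linearly on $\bar{\mathfrak m}^{\otimes w}$ by $$\alpha(y_1\otimes\cdots\otimes y_w)=(-1)^{w-1}\,y_w\otimes y_1\otimes\cdots\otimes y_{w-1},$$ and trivially on $k$. Then, as $k$-modules, $$HC^{(0)}_n(A)\cong\begin{cases}k & n\ge 0 \text{ even},\\ 0&\text{otherwise,}\end{cases}$$ and for every $w\ge 1$ $$HC^{(w)}_n(A)\cong\begin{cases}0 & n\le w-2,\\ \operatorname{Tor}^{k[C_w]}_{n-w+1}(k,\bar{\mathfrak m}^{\otimes w})\cong H_{n-w+1}(C_w;\bar{\mathfrak m}^{\otimes w}) & n\ge w-1.\end{cases}$$ -/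

import Mathlib

universe u

open CategoryTheory

namespace CyclicHomology

noncomputable section

open scoped TensorProduct

section TensorPowers

variable (k : Type u) [CommRing k]

/-- The unsigned rotation `a₀ ⊗ ⋯ ⊗ aₘ₋₁ ↦ aₘ₋₁ ⊗ a₀ ⊗ ⋯ ⊗ aₘ₋₂` of `M^{⊗ m}`. -/
def rot (M : Type u) [AddCommGroup M] [Module k M] (m : ℕ) :
    Module.End k (⨂[k]^m M) :=
  (PiTensorProduct.reindex k (fun _ : Fin m => M) (finRotate m)).toLinearMap

/-- The signed rotation `t_{m-1}` of `M^{⊗ m}`, that is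
`a₀ ⊗ ⋯ ⊗ aₘ₋₁ ↦ (-1)^(m-1) aₘ₋₁ ⊗ a₀ ⊗ ⋯ ⊗ aₘ₋₂` (for `m ≥ 1`). -/
def cyc (M : Type u) [AddCommGroup M] [Module k M] (m : ℕ) :
    Module.End k (⨂[k]^m M) :=
  (-1 : k) ^ (m - 1) • rot k M m

/-- The norm operator `N_{m-1} = 1 + t + ⋯ + t^(m-1)` on `M^{⊗ m}`, where `t = t_{m-1}`. -/
def norm (M : Type u) [AddCommGroup M] [Module k M] (m : ℕ) :
    Module.End k (⨂[k]^m M) :=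
  ∑ i ∈ Finset.range m, cyc k M m ^ i

section

variable {k} {M : Type u} [AddCommGroup M] [Module k M]

theorem rot_tprod (m : ℕ) (a : Fin m → M) :
    rot k M m (PiTensorProduct.tprod k a) =
      PiTensorProduct.tprod k (fun i => a ((finRotate m).symm i)) := by
  simp [rot, PiTensorProduct.reindex_tprod]

theorem rot_pow_tprod (m j : ℕ) (a : Fin m → M) :
    (rot k M m ^ j) (PiTensorProduct.tprod k a) =
      PiTensorProduct.tprod k (fun i => a (((finRotate m).symm ^ j) i)) := by
  induction j generalizing a with
  | zero => simp
  | succ j ih =>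
    rw [pow_succ, Module.End.mul_apply, rot_tprod, ih]
    simp [pow_succ']

theorem finRotate_pow_self (m : ℕ) : finRotate m ^ m = 1 := by
  rcases m with _ | _ | m
  · simp
  · ext i; simp
  · have h := (isCycle_finRotate (n := m)).orderOf
    rw [support_finRotate, Finset.card_univ, Fintype.card_fin] at h
    have h2 := pow_orderOf_eq_one (finRotate (m + 2))
    rwa [h] at h2

theorem rot_pow_self (m : ℕ) : rot k M m ^ m = 1 := by
  apply PiTensorProduct.ext
  ext a
  have h : (finRotate m).symm ^ m = 1 := by
    have := finRotate_pow_self m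
    rw [show (finRotate m).symm = (finRotate m)⁻¹ from rfl, inv_pow, this, inv_one]
  rw [LinearMap.compMultilinearMap_apply, rot_pow_tprod, h]
  rfl

theorem cyc_pow_self (m : ℕ) : cyc k M m ^ m = 1 := by
  have h : ((-1 : k) ^ (m - 1)) ^ m = 1 := by
    rw [← pow_mul]
    apply Even.neg_one_pow
    rcases m with _ | m
    · simp
    · simpa using Nat.even_mul_succ_self m
  rw [cyc, smul_pow, h, rot_pow_self, one_smul]

theorem norm_mul_one_sub (m : ℕ) : norm k M m * (1 - cyc k M m) = 0 := by
  rw [norm, geom_sum_mul_neg, cyc_pow_self, sub_self]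

theorem one_sub_mul_norm (m : ℕ) : (1 - cyc k M m) * norm k M m = 0 := by
  rw [norm, mul_neg_geom_sum, cyc_pow_self, sub_self]

end

/-! ### Hochschild and bar differentials -/

variable (A : Type u) [Ring A] [Algebra k A]

variable {A} in
theorem contract_eq {B : Type*} {n : ℕ} (op : B → B → B) (i : Fin (n + 1)) (a : Fin (n + 2) → B)
    (j : Fin (n + 1)) :
    i.castSucc.contractNth op a j =
      if j = i then op (a i.castSucc) (a i.succ) else a (i.succ.succAbove j) := by
  split_ifs with h
  · subst h
    rw [Fin.contractNth_apply_of_eq _ _ _ _ (by simp)]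
  · rw [Fin.contractNth_apply_of_ne _ _ _ _ (by simpa [Fin.ext_iff] using fun e => h (Fin.ext e.symm))]
    congr 1
    have h' : (j : ℕ) ≠ i := fun e => h (Fin.ext e)
    simp only [Fin.succAbove, Fin.lt_def, Fin.val_castSucc, Fin.val_succ]
    split_ifs <;> first | rfl | omega


variable {k} in
theorem contract_update {n : ℕ} (i : Fin (n + 1)) (a : Fin (n + 2) → A) (j : Fin (n + 2)) :
    ∃ (l : Fin (n + 1)) (φ : A →ₗ[k] A), ∀ x,
      i.castSucc.contractNth (· * ·) (Function.update a j x) =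
        Function.update (i.castSucc.contractNth (· * ·) a) l (φ x) := by
  rcases Fin.eq_self_or_eq_succAbove i.succ j with rfl | ⟨l, rfl⟩
  · refine ⟨i, LinearMap.mulLeft k (a i.castSucc), fun x => ?_⟩
    funext p
    by_cases hp : p = i
    · subst hp
      simp [contract_eq, Function.update_of_ne (Fin.castSucc_lt_succ (i := p)).ne]
    · simp [contract_eq, hp]
  · by_cases hl : l = i
    · subst hl
      have h : l.succ.succAbove l = l.castSucc := by
        simp [Fin.succAbove]
      refine ⟨l, LinearMap.mulRight k (a l.succ), fun x => ?_⟩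
      funext p
      by_cases hp : p = l
      · subst hp
        simp [contract_eq, h, Function.update_of_ne (Fin.castSucc_lt_succ (i := p)).ne']
      · have h2 : l.succ.succAbove p ≠ l.castSucc := by
          rw [← h]
          exact fun e => hp (Fin.succAbove_right_injective e)
        simp [contract_eq, h, hp, Function.update_of_ne h2]
    · have h : i.castSucc ≠ i.succ.succAbove l := by
        intro e
        apply hl
        apply Fin.succAbove_right_injective (p := i.succ)
        rw [← e]
        simp [Fin.succAbove]
      refine ⟨l, LinearMap.id, fun x => ?_⟩
      funext p
      by_cases hp : p = i
      · subst hp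
        simp [contract_eq, Function.update_of_ne h, Function.update_of_ne (Ne.symm hl)]
      · by_cases hpl : p = l
        · subst hpl
          simp [contract_eq, hp]
        · simp [contract_eq, hp, Function.update_of_ne hpl, Function.update_of_ne
            (fun e => hpl (Fin.succAbove_right_injective e) :
              i.succ.succAbove p ≠ i.succ.succAbove l)]

/-- The face map `d_i(a₀ ⊗ ⋯ ⊗ aₙ₊₁) = a₀ ⊗ ⋯ ⊗ aᵢ aᵢ₊₁ ⊗ ⋯ ⊗ aₙ₊₁`, for `0 ≤ i ≤ n`, as a
multilinear map. -/
def faceMultilinear (n : ℕ) (i : Fin (n + 1)) :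
    MultilinearMap k (fun _ : Fin (n + 2) => A) (⨂[k]^(n + 1) A) :=
  MultilinearMap.mk' (fun a => PiTensorProduct.tprod k (i.castSucc.contractNth (· * ·) a))
    (fun a j x y => by
      obtain ⟨l, φ, h⟩ := contract_update (k := k) A i a j
      simp only [h, map_add, MultilinearMap.map_update_add])
    (fun a j c x => by
      obtain ⟨l, φ, h⟩ := contract_update (k := k) A i a j
      simp only [h, map_smul, MultilinearMap.map_update_smul])

/-- The face map `d_i : A^{⊗ n+2} → A^{⊗ n+1}`,
`d_i(a₀ ⊗ ⋯ ⊗ aₙ₊₁) = a₀ ⊗ ⋯ ⊗ aᵢ aᵢ₊₁ ⊗ ⋯ ⊗ aₙ₊₁`, for `0 ≤ i ≤ n`. -/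
def face (n : ℕ) (i : Fin (n + 1)) : ⨂[k]^(n + 2) A →ₗ[k] ⨂[k]^(n + 1) A :=
  PiTensorProduct.lift (faceMultilinear k A n i)

/-- The last face map `d_{n+1} : A^{⊗ n+2} → A^{⊗ n+1}`,
`d_{n+1}(a₀ ⊗ ⋯ ⊗ aₙ₊₁) = aₙ₊₁ a₀ ⊗ a₁ ⊗ ⋯ ⊗ aₙ`. -/
def lastFace (n : ℕ) : ⨂[k]^(n + 2) A →ₗ[k] ⨂[k]^(n + 1) A :=
  face k A n 0 ∘ₗ rot k A (n + 2)

/-- The bar differential `b'_{n+1} = ∑_{i=0}^{n} (-1)^i d_i : A^{⊗ n+2} → A^{⊗ n+1}`. -/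
def barD (n : ℕ) : ⨂[k]^(n + 2) A →ₗ[k] ⨂[k]^(n + 1) A :=
  ∑ i : Fin (n + 1), (-1 : k) ^ (i : ℕ) • face k A n i

/-- The Hochschild differential `b_{n+1} = ∑_{i=0}^{n+1} (-1)^i d_i : A^{⊗ n+2} → A^{⊗ n+1}`. -/
def hochD (n : ℕ) : ⨂[k]^(n + 2) A →ₗ[k] ⨂[k]^(n + 1) A :=
  barD k A n + (-1 : k) ^ (n + 1) • lastFace k A n

section Identities

variable {k A}

theorem face_tprod (n : ℕ) (i : Fin (n + 1)) (a : Fin (n + 2) → A) :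
    face k A n i (PiTensorProduct.tprod k a) =
      PiTensorProduct.tprod k (i.castSucc.contractNth (· * ·) a) :=
  PiTensorProduct.lift.tprod a

theorem rot_tprod_cons {M : Type u} [AddCommGroup M] [Module k M] (m : ℕ) (a : Fin (m + 1) → M) :
    rot k M (m + 1) (PiTensorProduct.tprod k a) =
      PiTensorProduct.tprod k (Fin.cons (a (Fin.last m)) (fun i => a i.castSucc)) := by
  rw [rot_tprod]
  congr 1
  funext i
  refine Fin.cases ?_ (fun i => ?_) i
  · rw [Fin.cons_zero, (Equiv.symm_apply_eq _).2 finRotate_last.symm]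
  · rw [Fin.cons_succ, (Equiv.symm_apply_eq (finRotate (m + 1)) (y := i.castSucc)).2]
    simp

theorem lastFace_tprod (n : ℕ) (a : Fin (n + 2) → A) :
    lastFace k A n (PiTensorProduct.tprod k a) =
      PiTensorProduct.tprod k
        (Fin.cons (a (Fin.last (n + 1)) * a 0) (fun i : Fin n => a i.succ.castSucc)) := by
  rw [lastFace, LinearMap.comp_apply, rot_tprod_cons, face_tprod]
  congr 1
  funext i
  refine Fin.cases ?_ (fun i => ?_) i <;> simp [Fin.contractNth]

theorem face_face (n : ℕ) (i j : Fin (n + 1)) (h : i ≤ j) :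
    face k A n i ∘ₗ face k A (n + 1) j.succ = face k A n j ∘ₗ face k A (n + 1) i.castSucc := by
  apply PiTensorProduct.ext
  ext a
  simp only [LinearMap.compMultilinearMap_apply, LinearMap.comp_apply, face_tprod]
  congr 1
  funext l
  have h' : (i : ℕ) ≤ j := h
  simp only [Fin.contractNth, Fin.val_castSucc, Fin.val_succ]
  split_ifs <;> first | omega | rfl | exact (mul_assoc _ _ _).symm

theorem face_succ_rot (n : ℕ) (i : Fin n) :
    face k A n i.succ ∘ₗ rot k A (n + 2) = rot k A (n + 1) ∘ₗ face k A n i.castSucc := by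
  apply PiTensorProduct.ext
  ext a
  simp only [LinearMap.compMultilinearMap_apply, LinearMap.comp_apply, face_tprod, rot_tprod_cons]
  congr 1
  funext l
  have hi := i.isLt
  refine Fin.cases ?_ (fun l => ?_) l
  · simp only [Fin.contractNth, Fin.val_castSucc, Fin.val_succ, Fin.val_zero, Fin.val_last,
      Fin.cons_zero, Fin.castSucc_zero, Fin.succ_last]
    rw [if_pos (by omega), if_neg (by omega), if_neg (by omega)]
  · simp only [Fin.contractNth, Fin.val_castSucc, Fin.val_succ, Fin.cons_succ,
      ← Fin.succ_castSucc]
    split_ifs <;> first | omega | rfl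

theorem rot_face_last (n : ℕ) :
    rot k A (n + 1) ∘ₗ face k A n (Fin.last n) =
      face k A n 0 ∘ₗ rot k A (n + 2) ∘ₗ rot k A (n + 2) := by
  apply PiTensorProduct.ext
  ext a
  simp only [LinearMap.compMultilinearMap_apply, LinearMap.comp_apply, face_tprod, rot_tprod_cons]
  congr 1
  funext l
  refine Fin.cases ?_ (fun l => ?_) l
  · simp only [Fin.contractNth, Fin.castSucc_zero, Fin.val_zero, lt_irrefl, if_false, if_true,
      Fin.cons_zero, Fin.cons_succ, ← Fin.succ_last]
    simp
  · have hl := l.isLt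
    simp only [Fin.contractNth, Fin.val_castSucc, Fin.val_succ, Fin.cons_succ, Fin.val_last,
      Fin.castSucc_zero, Fin.val_zero, ← Fin.succ_castSucc]
    rw [if_pos (by omega), if_neg (by omega), if_neg (by omega)]

theorem sum_comp' {X Y Z ι : Type*} [AddCommGroup X] [AddCommGroup Y] [AddCommGroup Z]
    [Module k X] [Module k Y] [Module k Z] (s : Finset ι) (g : ι → Y →ₗ[k] Z) (f : X →ₗ[k] Y) :
    (∑ i ∈ s, g i) ∘ₗ f = ∑ i ∈ s, g i ∘ₗ f :=
  map_sum (LinearMap.lcomp k Z f) g s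

theorem comp_sum' {X Y Z ι : Type*} [AddCommGroup X] [AddCommGroup Y] [AddCommGroup Z]
    [Module k X] [Module k Y] [Module k Z] (s : Finset ι) (g : Y →ₗ[k] Z) (f : ι → X →ₗ[k] Y) :
    g ∘ₗ (∑ i ∈ s, f i) = ∑ i ∈ s, g ∘ₗ f i :=
  map_sum (LinearMap.llcomp k X Y Z g) f s

theorem alternating_sum_comp {X Y Z : Type u} [AddCommGroup X] [AddCommGroup Y] [AddCommGroup Z]
    [Module k X] [Module k Y] [Module k Z] (n : ℕ) (f : Fin (n + 2) → X →ₗ[k] Y)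
    (g : Fin (n + 1) → Y →ₗ[k] Z)
    (h : ∀ i j : Fin (n + 1), i ≤ j → g i ∘ₗ f j.succ = g j ∘ₗ f i.castSucc) :
    (∑ i : Fin (n + 1), (-1 : k) ^ (i : ℕ) • g i) ∘ₗ
      (∑ j : Fin (n + 2), (-1 : k) ^ (j : ℕ) • f j) = 0 := by
  have e : (∑ i : Fin (n + 1), (-1 : k) ^ (i : ℕ) • g i) ∘ₗ
      (∑ j : Fin (n + 2), (-1 : k) ^ (j : ℕ) • f j) =
      ∑ p : Fin (n + 1) × Fin (n + 2),
        (-1 : k) ^ ((p.1 : ℕ) + (p.2 : ℕ)) • (g p.1 ∘ₗ f p.2) := by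
    rw [Fintype.sum_prod_type]
    ext x
    simp only [LinearMap.comp_apply, LinearMap.sum_apply, LinearMap.smul_apply, map_sum, map_smul,
      Finset.smul_sum, smul_smul, pow_add]
    rw [Finset.sum_comm]
    refine Finset.sum_congr rfl fun i _ => Finset.sum_congr rfl fun j _ => ?_
    rw [mul_comm]
  rw [e]
  refine Finset.sum_involution
    (fun p _ => if hp : p.2 ≤ p.1.castSucc then (p.2.castPred (by
        intro hh; rw [hh] at hp; exact absurd hp (not_le.2 (Fin.castSucc_lt_last _))), p.1.succ)
      else (p.2.pred (by rintro hh; exact hp (by rw [hh]; exact Fin.zero_le _)), p.1.castSucc))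
    ?_ ?_ ?_ ?_
  · rintro ⟨i, j⟩ -
    dsimp only
    split_ifs with hp
    · have := h (j.castPred (by
        intro hh; rw [hh] at hp; exact absurd hp (not_le.2 (Fin.castSucc_lt_last _)))) i
        (by simpa [Fin.le_def] using hp)
      simp only [Fin.castSucc_castPred] at this
      simp only [this, ← add_smul, Fin.coe_castPred, Fin.val_succ]
      convert zero_smul k _
      ring
    · have := h i (j.pred (by rintro hh; exact hp (by rw [hh]; exact Fin.zero_le _)))
        (by simp only [Fin.le_def, Fin.val_castSucc, Fin.val_pred] at hp ⊢; omega)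
      simp only [Fin.succ_pred] at this
      simp only [this, ← add_smul, Fin.val_pred, Fin.val_castSucc]
      convert zero_smul k _
      obtain ⟨q, hq⟩ : ∃ q, (j : ℕ) = q + 1 :=
        ⟨(j : ℕ) - 1, by simp only [Fin.le_def, Fin.val_castSucc] at hp; omega⟩
      rw [hq, Nat.add_sub_cancel]
      ring
  · rintro ⟨i, j⟩ - - hh
    dsimp only at hh
    split_ifs at hh with hp
    · have h2 := congrArg (fun q => (q.2 : ℕ)) hh
      simp only [Fin.le_def, Fin.val_castSucc, Fin.val_succ] at hp h2
      omega
    · have h2 := congrArg (fun q => (q.2 : ℕ)) hh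
      simp only [Fin.le_def, Fin.val_castSucc] at hp h2
      omega
  · intros; exact Finset.mem_univ _
  · rintro ⟨i, j⟩ -
    dsimp only
    split_ifs with hp hq hq
    · simp only [Fin.le_def, Fin.val_castSucc, Fin.val_succ, Fin.castSucc_castPred] at hp hq
      omega
    · simp
    · simp
    · simp only [Fin.le_def, Fin.val_castSucc, Fin.val_pred] at hp hq
      omega

theorem barD_comp (n : ℕ) : barD k A n ∘ₗ barD k A (n + 1) = 0 :=
  alternating_sum_comp n _ _ (face_face n)

theorem lastFace_face_castSucc (n : ℕ) (i : Fin (n + 1)) :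
    lastFace k A n ∘ₗ face k A (n + 1) i.castSucc = face k A n i ∘ₗ lastFace k A (n + 1) := by
  rw [lastFace, lastFace, LinearMap.comp_assoc, ← face_succ_rot, ← LinearMap.comp_assoc,
    face_face n 0 i (Fin.zero_le _), LinearMap.comp_assoc, Fin.castSucc_zero]

theorem lastFace_face_last (n : ℕ) :
    lastFace k A n ∘ₗ face k A (n + 1) (Fin.last _) = lastFace k A n ∘ₗ lastFace k A (n + 1) := by
  have h := face_succ_rot (k := k) (A := A) (n + 1) 0
  have h2 := face_face (k := k) (A := A) n 0 0 le_rfl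
  rw [Fin.castSucc_zero] at h h2
  calc lastFace k A n ∘ₗ face k A (n + 1) (Fin.last _)
      = (face k A n 0 ∘ₗ face k A (n + 1) 0) ∘ₗ rot k A (n + 3) ∘ₗ rot k A (n + 3) := by
        rw [lastFace, LinearMap.comp_assoc, rot_face_last, LinearMap.comp_assoc]
    _ = face k A n 0 ∘ₗ (face k A (n + 1) (Fin.succ 0) ∘ₗ rot k A (n + 3)) ∘ₗ rot k A (n + 3) := by
        rw [← h2]; rfl
    _ = _ := by rw [h]; rfl

theorem hochD_comp (n : ℕ) : hochD k A n ∘ₗ hochD k A (n + 1) = 0 := by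
  have h1 : lastFace k A n ∘ₗ barD k A (n + 1) =
      barD k A n ∘ₗ lastFace k A (n + 1) +
        (-1 : k) ^ (n + 1) • (lastFace k A n ∘ₗ lastFace k A (n + 1)) := by
    rw [barD, barD, Fin.sum_univ_castSucc, LinearMap.comp_add, LinearMap.comp_smul,
      lastFace_face_last]
    congr 1
    ext x
    simp only [LinearMap.compMultilinearMap_apply, LinearMap.comp_apply, LinearMap.sum_apply,
      LinearMap.smul_apply, map_sum, map_smul, Fin.val_castSucc]
    refine Finset.sum_congr rfl fun i _ => ?_
    rw [← LinearMap.comp_apply, lastFace_face_castSucc, LinearMap.comp_apply]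
  simp only [hochD, LinearMap.comp_add, LinearMap.add_comp, LinearMap.comp_smul,
    LinearMap.smul_comp, barD_comp, h1, smul_add, smul_smul, zero_add]
  rw [pow_succ (-1 : k) (n + 1)]
  module

theorem face_succ_cyc (n : ℕ) (i : Fin n) :
    face k A n i.succ ∘ₗ cyc k A (n + 2) = -(cyc k A (n + 1) ∘ₗ face k A n i.castSucc) := by
  rw [cyc, cyc, LinearMap.comp_smul, face_succ_rot, LinearMap.smul_comp]
  simp only [Nat.add_sub_cancel, show n + 2 - 1 = n + 1 from rfl, pow_succ]
  module

theorem face_zero_cyc (n : ℕ) :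
    face k A n 0 ∘ₗ cyc k A (n + 2) = (-1 : k) ^ (n + 1) • lastFace k A n := by
  rw [cyc, LinearMap.comp_smul, lastFace]
  rfl

theorem lastFace_cyc (n : ℕ) :
    (-1 : k) ^ (n + 1) • (lastFace k A n ∘ₗ cyc k A (n + 2)) =
      (-1 : k) ^ n • (cyc k A (n + 1) ∘ₗ face k A n (Fin.last n)) := by
  rw [cyc, cyc, LinearMap.comp_smul, LinearMap.smul_comp, rot_face_last, lastFace, smul_smul,
    smul_smul, LinearMap.comp_assoc]
  simp [← mul_pow]

theorem hochD_one_sub_cyc (n : ℕ) :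
    hochD k A n ∘ₗ (1 - cyc k A (n + 2)) = (1 - cyc k A (n + 1)) ∘ₗ barD k A n := by
  have h1 : barD k A n ∘ₗ cyc k A (n + 2) = (-1 : k) ^ (n + 1) • lastFace k A n +
      ∑ i : Fin n, (-1 : k) ^ (i : ℕ) • (cyc k A (n + 1) ∘ₗ face k A n i.castSucc) := by
    rw [barD, Fin.sum_univ_succ, LinearMap.add_comp, LinearMap.smul_comp, face_zero_cyc]
    simp only [Fin.val_zero, pow_zero, one_smul, sum_comp', LinearMap.smul_comp,
      face_succ_cyc, Fin.val_succ]
    congr 1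
    refine Finset.sum_congr rfl fun i _ => ?_
    rw [pow_succ]
    module
  have h2 : cyc k A (n + 1) ∘ₗ barD k A n =
      ∑ i : Fin n, (-1 : k) ^ (i : ℕ) • (cyc k A (n + 1) ∘ₗ face k A n i.castSucc) +
        (-1 : k) ^ n • (cyc k A (n + 1) ∘ₗ face k A n (Fin.last n)) := by
    rw [barD, Fin.sum_univ_castSucc, LinearMap.comp_add, LinearMap.comp_smul]
    simp only [comp_sum', LinearMap.comp_smul, Fin.val_castSucc, Fin.val_last]
  rw [LinearMap.comp_sub, LinearMap.sub_comp, hochD, LinearMap.add_comp, h2, ← lastFace_cyc]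
  simp only [Module.End.one_eq_id, LinearMap.comp_id, LinearMap.id_comp, LinearMap.add_comp,
    LinearMap.smul_comp, h1]
  abel

theorem cyc_pow_face (n : ℕ) (i : Fin (n + 1)) :
    (cyc k A (n + 1) ^ (i : ℕ)) ∘ₗ face k A n 0 =
      (-1 : k) ^ (i : ℕ) • (face k A n i ∘ₗ (cyc k A (n + 2) ^ (i : ℕ))) := by
  induction i using Fin.induction with
  | zero => simp; rfl
  | succ i ih =>
    rw [Fin.val_castSucc] at ih
    have h : cyc k A (n + 1) ∘ₗ face k A n i.castSucc =
        -(face k A n i.succ ∘ₗ cyc k A (n + 2)) := by rw [face_succ_cyc, neg_neg]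
    rw [Fin.val_succ, pow_succ', Module.End.mul_eq_comp, LinearMap.comp_assoc, ih,
      LinearMap.comp_smul, ← LinearMap.comp_assoc, h, pow_succ' (cyc k A (n + 2)),
      Module.End.mul_eq_comp, LinearMap.neg_comp, LinearMap.comp_assoc, pow_succ (-1 : k)]
    module

theorem cyc_pow_mul_norm {M : Type u} [AddCommGroup M] [Module k M] (m i : ℕ) :
    cyc k M m ^ i * norm k M m = norm k M m := by
  have h := one_sub_mul_norm (k := k) (M := M) m
  rw [sub_mul, one_mul, sub_eq_zero] at h
  induction i with
  | zero => simp
  | succ i ih => rw [pow_succ, mul_assoc, ← h, ih]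

theorem norm_mul_cyc_pow {M : Type u} [AddCommGroup M] [Module k M] (m i : ℕ) :
    norm k M m * cyc k M m ^ i = norm k M m := by
  have h := norm_mul_one_sub (k := k) (M := M) m
  rw [mul_sub, mul_one, sub_eq_zero] at h
  induction i with
  | zero => simp
  | succ i ih => rw [pow_succ', ← mul_assoc, ← h, ih]

theorem barD_norm (n : ℕ) :
    barD k A n ∘ₗ norm k A (n + 2) = norm k A (n + 1) ∘ₗ hochD k A n := by
  have key : ∀ i : Fin (n + 1), (-1 : k) ^ (i : ℕ) • face k A n i =
      (cyc k A (n + 1) ^ (i : ℕ)) ∘ₗ face k A n 0 ∘ₗ (cyc k A (n + 2) ^ (n + 2 - (i : ℕ))) := by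
    intro i
    have hi := i.isLt
    rw [← LinearMap.comp_assoc, cyc_pow_face, LinearMap.smul_comp, LinearMap.comp_assoc,
      ← Module.End.mul_eq_comp, ← pow_add, show (i : ℕ) + (n + 2 - i) = n + 2 by omega,
      cyc_pow_self]
    rfl
  have e1 : barD k A n ∘ₗ norm k A (n + 2) =
      norm k A (n + 1) ∘ₗ face k A n 0 ∘ₗ norm k A (n + 2) := by
    rw [barD, sum_comp']
    conv_rhs => rw [norm, Finset.sum_range, sum_comp']
    refine Finset.sum_congr rfl fun i _ => ?_
    rw [key, LinearMap.comp_assoc, LinearMap.comp_assoc, ← Module.End.mul_eq_comp (cyc k A (n + 2) ^ _),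
      cyc_pow_mul_norm]
  have e2 : norm k A (n + 1) ∘ₗ hochD k A n =
      norm k A (n + 1) ∘ₗ face k A n 0 ∘ₗ norm k A (n + 2) := by
    have e3 : norm k A (n + 1) ∘ₗ barD k A n = ∑ i : Fin (n + 1),
        norm k A (n + 1) ∘ₗ face k A n 0 ∘ₗ (cyc k A (n + 2) ^ (n + 2 - (i : ℕ))) := by
      rw [barD, comp_sum']
      refine Finset.sum_congr rfl fun i _ => ?_
      rw [key, ← LinearMap.comp_assoc, ← Module.End.mul_eq_comp, norm_mul_cyc_pow]
    rw [hochD, ← face_zero_cyc, LinearMap.comp_add, e3]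
    have e4 : norm k A (n + 2) = (∑ i : Fin (n + 1), cyc k A (n + 2) ^ (n + 2 - (i : ℕ))) +
        cyc k A (n + 2) := by
      rw [← Finset.sum_range (fun i => cyc k A (n + 2) ^ (n + 2 - i))]
      have := Finset.sum_range_reflect (fun i => cyc k A (n + 2) ^ (i + 1)) (n + 2)
      have h2 : ∑ i ∈ Finset.range (n + 2), cyc k A (n + 2) ^ (i + 1) = norm k A (n + 2) := by
        rw [norm, Finset.sum_range_succ, Finset.sum_range_succ', ← Finset.sum_range_succ' (fun i => cyc k A (n + 2) ^ (i + 1)), cyc_pow_self,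
          Finset.sum_range_succ' _ (n + 1), pow_zero]
      rw [← h2, ← this, Finset.sum_range_succ]
      congr 1
      · refine Finset.sum_congr rfl fun i hi => ?_
        rw [Finset.mem_range] at hi
        congr 1
        omega
      · simp
    conv_rhs => rw [e4]
    rw [LinearMap.comp_add, LinearMap.comp_add, comp_sum', comp_sum']
  rw [e1, e2]

end Identities

/-! ### The cyclic bicomplex -/

/-- A family of submodules of the tensor powers `A^{⊗ n+1}` that is stable under all the face maps
and under rotation. -/
structure StableFamily where
  /-- The submodule of `A^{⊗ n+1}`. -/
  sub : ∀ n : ℕ, Submodule k (⨂[k]^(n + 1) A)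
  face_mem : ∀ (n : ℕ) (i : Fin (n + 1)), ∀ z ∈ sub (n + 1), face k A n i z ∈ sub n
  rot_mem : ∀ n : ℕ, ∀ z ∈ sub n, rot k A (n + 1) z ∈ sub n

namespace StableFamily

variable {k A} (F : StableFamily k A)

theorem barD_mem (n : ℕ) (z : ⨂[k]^(n + 2) A) (hz : z ∈ F.sub (n + 1)) :
    barD k A n z ∈ F.sub n := by
  rw [barD, LinearMap.sum_apply]
  exact Submodule.sum_mem _ fun i _ => Submodule.smul_mem _ _ (F.face_mem n i z hz)

theorem hochD_mem (n : ℕ) (z : ⨂[k]^(n + 2) A) (hz : z ∈ F.sub (n + 1)) :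
    hochD k A n z ∈ F.sub n :=
  Submodule.add_mem _ (F.barD_mem n z hz)
    (Submodule.smul_mem _ _ (F.face_mem n 0 _ (F.rot_mem (n + 1) z hz)))

theorem cyc_mem (n : ℕ) (z : ⨂[k]^(n + 1) A) (hz : z ∈ F.sub n) :
    cyc k A (n + 1) z ∈ F.sub n :=
  Submodule.smul_mem _ _ (F.rot_mem n z hz)

theorem norm_mem (n : ℕ) (z : ⨂[k]^(n + 1) A) (hz : z ∈ F.sub n) :
    norm k A (n + 1) z ∈ F.sub n := by
  rw [norm, LinearMap.sum_apply]
  refine Submodule.sum_mem _ fun i _ => ?_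
  clear * - hz
  induction i with
  | zero => simpa using hz
  | succ i ih =>
    rw [pow_succ', Module.End.mul_apply]
    exact F.cyc_mem n _ ih

/-- The vertical differential `F_{q+1} → F_q` of the `p`-th column: `b` if `p` is even, `b'` if `p`
is odd. -/
def vert (p q : ℕ) : F.sub (q + 1) →ₗ[k] F.sub q :=
  if Even p then (hochD k A q).restrict (F.hochD_mem q)
  else (barD k A q).restrict (F.barD_mem q)

/-- The horizontal differential of the `q`-th row from column `p + 1` to column `p`: `1 - t_q` if
`p` is even, `N_q` if `p` is odd. -/
def horiz (p q : ℕ) : F.sub q →ₗ[k] F.sub q :=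
  if Even p then (1 - cyc k A (q + 1)).restrict
    (fun z hz => Submodule.sub_mem _ hz (F.cyc_mem q z hz))
  else (norm k A (q + 1)).restrict (F.norm_mem q)

theorem vert_comp (p q : ℕ) : F.vert p q ∘ₗ F.vert p (q + 1) = 0 := by
  ext z
  unfold vert
  split_ifs
  · exact LinearMap.congr_fun (hochD_comp (k := k) (A := A) q) z.1
  · exact LinearMap.congr_fun (barD_comp (k := k) (A := A) q) z.1

theorem horiz_comp (p q : ℕ) : F.horiz p q ∘ₗ F.horiz (p + 1) q = 0 := by
  ext z
  unfold horiz
  by_cases hp : Even p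
  · rw [if_pos hp, if_neg (by simpa [Nat.even_add_one] using hp)]
    exact LinearMap.congr_fun (one_sub_mul_norm (k := k) (M := A) (q + 1)) z.1
  · rw [if_neg hp, if_pos (by simpa [Nat.even_add_one] using hp)]
    exact LinearMap.congr_fun (norm_mul_one_sub (k := k) (M := A) (q + 1)) z.1

theorem vert_horiz (p q : ℕ) :
    F.vert p q ∘ₗ F.horiz p (q + 1) = F.horiz p q ∘ₗ F.vert (p + 1) q := by
  ext z
  unfold horiz vert
  by_cases hp : Even p
  · have hp' : ¬ Even (p + 1) := by simpa [Nat.even_add_one] using hp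
    simp only [if_pos hp, if_neg hp']
    exact LinearMap.congr_fun (hochD_one_sub_cyc (k := k) (A := A) q) z.1
  · have hp' : Even (p + 1) := by simpa [Nat.even_add_one] using hp
    simp only [if_neg hp, if_pos hp']
    exact LinearMap.congr_fun (barD_norm (k := k) (A := A) q) z.1

/-- The `p`-th column of the cyclic bicomplex. -/
abbrev column (p : ℕ) : ChainComplex (ModuleCat.{u} k) ℕ :=
  ChainComplex.of (fun q => ModuleCat.of k (F.sub q)) (fun q => ModuleCat.ofHom (F.vert p q))
    (fun q => by rw [← ModuleCat.ofHom_comp, vert_comp]; rfl)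

theorem column_d (p q : ℕ) : (F.column p).d (q + 1) q = ModuleCat.ofHom (F.vert p q) :=
  ChainComplex.of_d (fun q => ModuleCat.of k (F.sub q)) (fun q => ModuleCat.ofHom (F.vert p q)) q

/-- The horizontal map from column `p + 1` to column `p`. -/
def columnMap (p : ℕ) : F.column (p + 1) ⟶ F.column p :=
  ChainComplex.ofHom (fun q => ModuleCat.ofHom (F.horiz p q))
    (fun q => by
      rw [column_d, column_d, ← ModuleCat.ofHom_comp, ← ModuleCat.ofHom_comp,
        vert_horiz])

/-- The cyclic (Tsygan) bicomplex of a stable family: the object in position `(p, q)` (column `p`,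
row `q`) is `F_q ⊆ A^{⊗ q+1}`, the columns carry alternately `b` and `b'`, the rows alternately
`1 - t` and `N`. -/
def bicomplex : HomologicalComplex₂ (ModuleCat.{u} k) (ComplexShape.down ℕ) (ComplexShape.down ℕ) :=
  ChainComplex.of F.column F.columnMap (fun p => by
    ext q : 1
    change ModuleCat.ofHom (F.horiz (p + 1) q) ≫ ModuleCat.ofHom (F.horiz p q) = 0
    rw [← ModuleCat.ofHom_comp, horiz_comp]
    rfl)

theorem bicomplex_d (p : ℕ) : F.bicomplex.d (p + 1) p = F.columnMap p :=
  ChainComplex.of_d F.column F.columnMap p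

/-- Cyclic homology of a stable family: the homology of the total complex of its cyclic
bicomplex. -/
def HC (n : ℕ) : ModuleCat.{u} k :=
  (F.bicomplex.total (ComplexShape.down ℕ)).homology n

end StableFamily

end TensorPowers

/-! ### The truncated polynomial algebra and its weight grading -/

section Truncated

variable (k : Type u) [CommRing k] (d : ℕ)

/-- The ideal `𝔪 = (x₁, …, x_d)` of `k[x₁, …, x_d]`. -/
abbrev maxIdeal : Ideal (MvPolynomial (Fin d) k) :=
  MvPolynomial.idealOfVars (Fin d) k

/-- The algebra `A = k[x₁, …, x_d] / 𝔪²`. -/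
abbrev TruncAlg : Type u := MvPolynomial (Fin d) k ⧸ maxIdeal k d ^ 2

/-- The `k`-module `𝔪 / 𝔪²`. -/
abbrev mbar : Type u := (maxIdeal k d).Cotangent

/-- The monomials `1` (for `none`) and `x_j` (for `some j`) of `A`. -/
def mono : Option (Fin d) → TruncAlg k d
  | none => 1
  | some j => Ideal.Quotient.mk _ (MvPolynomial.X j)

variable {d} in
/-- The weight of a tensor monomial: its number of factors `x_j`. -/
def wt {n : ℕ} (f : Fin n → Option (Fin d)) : ℕ :=
  (Finset.univ.filter fun i => (f i).isSome).card

/-- The part of weight `w` in `A^{⊗ n+1}`, spanned by the tensor monomials of weight `w`. -/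
def weightSub (w n : ℕ) : Submodule k (⨂[k]^(n + 1) (TruncAlg k d)) :=
  Submodule.span k
    {z | ∃ f : Fin (n + 1) → Option (Fin d), wt f = w ∧
      z = PiTensorProduct.tprod k (fun i => mono k d (f i))}

theorem wt_eq_sum {n : ℕ} (f : Fin n → Option (Fin d)) :
    wt f = ∑ i, if (f i).isSome then 1 else 0 := by
  rw [wt, Finset.card_filter]

theorem mono_some_mul (a b : Fin d) : mono k d (some a) * mono k d (some b) = 0 := by
  simp only [mono, ← map_mul]
  rw [Ideal.Quotient.eq_zero_iff_mem, pow_two]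
  exact Ideal.mul_mem_mul (Ideal.subset_span ⟨a, rfl⟩) (Ideal.subset_span ⟨b, rfl⟩)

theorem face_mem_weightSub (w n : ℕ) (i : Fin (n + 1)) :
    ∀ z ∈ weightSub k d w (n + 1), face k (TruncAlg k d) n i z ∈ weightSub k d w n := by
  intro z hz
  induction hz using Submodule.span_induction with
  | zero => simp
  | add x y _ _ hx hy => rw [map_add]; exact Submodule.add_mem _ hx hy
  | smul c x _ hx => rw [map_smul]; exact Submodule.smul_mem _ _ hx
  | mem z hz =>
    obtain ⟨f, hf, rfl⟩ := hz
    rw [face_tprod]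
    by_cases hs : (f i.castSucc).isSome ∧ (f i.succ).isSome
    · obtain ⟨a, ha⟩ := Option.isSome_iff_exists.1 hs.1
      obtain ⟨b, hb⟩ := Option.isSome_iff_exists.1 hs.2
      rw [MultilinearMap.map_coord_zero _ i]
      · exact Submodule.zero_mem _
      · rw [contract_eq, if_pos rfl, ha, hb, mono_some_mul]
    · apply Submodule.subset_span
      refine ⟨i.castSucc.contractNth Option.or f, ?_, ?_⟩
      · rw [← hf, wt_eq_sum, wt_eq_sum, Fin.sum_univ_succAbove _ i.succ]
        rw [← Finset.sum_erase_add _ _ (Finset.mem_univ i),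
          ← Finset.sum_erase_add (a := i) Finset.univ
            (fun l => if (f (i.succ.succAbove l)).isSome then 1 else 0) (Finset.mem_univ i)]
        have h1 : i.succ.succAbove i = i.castSucc := by simp [Fin.succAbove]
        have h2 : ∑ x ∈ Finset.univ.erase i,
            (if (i.castSucc.contractNth Option.or f x).isSome then 1 else 0) =
            ∑ x ∈ Finset.univ.erase i, if (f (i.succ.succAbove x)).isSome then 1 else 0 := by
          refine Finset.sum_congr rfl fun x hx => ?_
          rw [contract_eq, if_neg (Finset.ne_of_mem_erase hx)]
        rw [h2, contract_eq, if_pos rfl, h1]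
        rcases ha : f i.castSucc with _ | a <;> rcases hb : f i.succ with _ | b
        · simp
        · simp; omega
        · simp
        · simp [ha, hb] at hs
      · congr 1
        funext l
        rw [contract_eq, contract_eq]
        split_ifs with hl
        · rcases ha : f i.castSucc with _ | a <;> rcases hb : f i.succ with _ | b
          · simp [mono]
          · simp [mono]
          · simp [mono]
          · simp [ha, hb] at hs
        · rfl

theorem rot_mem_weightSub (w n : ℕ) :
    ∀ z ∈ weightSub k d w n, rot k (TruncAlg k d) (n + 1) z ∈ weightSub k d w n := by
  intro z hz
  induction hz using Submodule.span_induction with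
  | zero => simp
  | add x y _ _ hx hy => rw [map_add]; exact Submodule.add_mem _ hx hy
  | smul c x _ hx => rw [map_smul]; exact Submodule.smul_mem _ _ hx
  | mem z hz =>
    obtain ⟨f, hf, rfl⟩ := hz
    rw [rot_tprod]
    apply Submodule.subset_span
    refine ⟨fun i => f ((finRotate (n + 1)).symm i), ?_, rfl⟩
    rw [← hf, wt_eq_sum, wt_eq_sum]
    exact Equiv.sum_comp (finRotate (n + 1)).symm (fun i => if (f i).isSome then 1 else 0)

/-- The family of the parts of weight `w` in the tensor powers of `A`. -/
def weightFamily (w : ℕ) : StableFamily k (TruncAlg k d) where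
  sub := weightSub k d w
  face_mem := face_mem_weightSub k d w
  rot_mem := rot_mem_weightSub k d w

/-- `HC_n^{(w)}(A)`: the total homology of the part of weight `w` of the cyclic bicomplex
of `A = k[x₁, …, x_d] / 𝔪²`. -/
def weightHC (w n : ℕ) : ModuleCat.{u} k :=
  (weightFamily k d w).HC n

/-! ### The cyclic group action on tensor powers of `𝔪 / 𝔪²` -/

/-- The cyclic group `C_w` of order `w` (for `w ≥ 1`), in the universe of `k`, with generator
`α = ⟨ofAdd 1⟩`. -/
abbrev Cyc (w : ℕ) : Type u := ULift.{u} (Multiplicative (ZMod w))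

/-- The representation of `C_w` on `(𝔪 / 𝔪²)^{⊗ w}` in which the generator acts as the signed
rotation `t_{w-1}`. -/
def cycRep (w : ℕ) [NeZero w] : Representation k (Cyc.{u} w) (⨂[k]^w (mbar k d)) where
  toFun g := cyc k (mbar k d) w ^ (g.down.toAdd).val
  map_one' := by
    simp
  map_mul' g h := by
    rw [ULift.mul_down, toAdd_mul, ZMod.val_add, ← pow_add]
    exact (pow_eq_pow_mod _ (cyc_pow_self w)).symm

/-- The generator of `C_w` acts as the signed rotation (for `w = 1` both are the identity). -/
theorem cycRep_generator (w : ℕ) [NeZero w] :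
    cycRep k d w ⟨Multiplicative.ofAdd 1⟩ = cyc k (mbar k d) w := by
  change cyc k (mbar k d) w ^ (1 : ZMod w).val = _
  rw [ZMod.val_one_eq_one_mod, ← pow_eq_pow_mod 1 (cyc_pow_self w), pow_one]

/-- `(𝔪 / 𝔪²)^{⊗ w}` as an object of the category of `k`-linear representations of `C_w`. -/
abbrev mbarRep (w : ℕ) [NeZero w] : Rep.{u} k (Cyc.{u} w) :=
  Rep.of (cycRep k d w)

/-- `Tor_n^{k[C_w]}(k, (𝔪 / 𝔪²)^{⊗ w})`, where `C_w` acts trivially on `k`: the `n`-th left derived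
functor of `- ⊗_{k[C_w]} (𝔪 / 𝔪²)^{⊗ w}` on modules over the commutative ring `k[C_w]`, at `k`,
regarded as a `k`-module. -/
def torCyc (w : ℕ) [NeZero w] (n : ℕ) : ModuleCat.{u} k :=
  (ModuleCat.restrictScalars (algebraMap k (MonoidAlgebra k (Cyc.{u} w)))).obj
    (((Tor' (ModuleCat.{u} (MonoidAlgebra k (Cyc.{u} w))) n).obj
      (Rep.toModuleMonoidAlgebra.obj (Rep.trivial k (Cyc.{u} w) k))).obj
        (Rep.toModuleMonoidAlgebra.obj (mbarRep k d w)))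

end Truncated

end

end CyclicHomology

namespace CyclicHomology

noncomputable section

/-! ### Words in the letters `1` and `x_j` -/

section Words

variable (k : Type*) [CommRing k] {X : Type*}

/-! The algebra $A$ has the basis $1,x_1,\dots,x_d$ with $x_ix_j=0$, so $A^{\otimes n}$ is free on
the words of length $n$ in these letters. A face map either absorbs a unit into a neighbouring
letter or gives zero. Through the embedding `theta`, all operators of the bicomplex become
operators, mostly recursive, on one free module of words of arbitrary length.

Columns. Prepending a unit contracts every odd column (`bar_cons_none`). In the even columns
`htpyWord` is a homotopy for $b$ between the identity and the projection `nondegWord` to words with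
no unit past the first position (`hoch_htpy_add`), that is, to the normalized Hochschild complex. In
weight $w$ such a word consists of $w$ variables, or of a unit followed by $w$ variables. An even
column thus shrinks to two copies of $\bar{\mathfrak m}^{\otimes w}$, in rows $w-1$ and $w$, and
$b(1\otimes y)=(1-t)y$ (`hoch_none_cons`).

Assembly for $w=v+1$. In total degree $v+m$ one copy of $\bar{\mathfrak m}^{\otimes w}$ survives,
and the differentials between these copies are alternately $1-t$ and $N$. Concretely, row $v$ is the
lowest nonzero row of the bicomplex. It is the periodic complex of $C_w$ acting on $\bar{\mathfrak
m}^{\otimes w}$, included by `toTot`. A chain map `retr` retracts the total complex to it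
(`retr_totD`, `retr_toTot`). The kernel of `retr` is acyclic: if $H$ is the sum of the signed column
homotopies, $D$ the total differential and $z$ a cycle in the kernel, then $z-DHz$ is again a cycle
in the kernel and ends one column further left (`exists_totD_eq`).

In weight $0$ only the one-letter word $1$ survives, in row $0$ of each even column, and all induced
differentials vanish; `totCoeff` reads off its coefficient.

Finally, both Tor and group homology are computed from the periodic free resolution of $k$ over
$k[C_w]$ (`tor_iso`, `groupHomology_iso`). This gives the differentials $\alpha-1$ and $N$, with the
same kernels and images as $1-t$ and $N$. -/

/-- Words in the letters `none` (the unit) and `some j` (the variables). -/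
abbrev Word (X : Type*) := List (Option X)

/-- The free module on all words. -/
abbrev WordMod (k : Type*) [CommRing k] (X : Type*) := Word X →₀ k

/-- A word as a basis vector. -/
def wd (l : Word X) : WordMod k X := Finsupp.single l 1

/-- The linear extension of a map defined on words. -/
def wlin {M : Type*} [AddCommGroup M] [Module k M] (f : Word X → M) : WordMod k X →ₗ[k] M :=
  Finsupp.linearCombination k f

variable {k}

@[simp]
theorem wlin_wd {M : Type*} [AddCommGroup M] [Module k M] (f : Word X → M) (l : Word X) :
    wlin k f (wd k l) = f l := by
  simp [wlin, wd]

theorem wlin_ext {M : Type*} [AddCommGroup M] [Module k M] {f g : WordMod k X →ₗ[k] M}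
    (h : ∀ l, f (wd k l) = g (wd k l)) : f = g := by
  apply Finsupp.lhom_ext'
  intro l
  ext
  exact h l

theorem wlin_congr {M : Type*} [AddCommGroup M] [Module k M] {f g : WordMod k X →ₗ[k] M}
    (h : ∀ l, f (wd k l) = g (wd k l)) (v : WordMod k X) : f v = g v := by
  rw [wlin_ext h]

variable (k)

/-- Prepending a letter. -/
def consL (a : Option X) : WordMod k X →ₗ[k] WordMod k X :=
  wlin k fun l => wd k (a :: l)

/-- Appending a letter. -/
def snocL (a : Option X) : WordMod k X →ₗ[k] WordMod k X :=
  wlin k fun l => wd k (l ++ [a])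

/-- The product of a letter with the first letter of a word (zero on the empty word). -/
def mulWord : Option X → Word X → WordMod k X
  | _, [] => 0
  | none, b :: u => wd k (b :: u)
  | some x, none :: u => wd k (some x :: u)
  | some _, some _ :: _ => 0

/-- The bar differential on words. -/
def barWord : Word X → WordMod k X
  | [] => 0
  | a :: u => mulWord k a u - consL k a (barWord u)

/-- Doubles the first letter, if the word starts with a run of units of odd length. -/
def doubleWord : Word X → WordMod k X
  | [] => 0
  | none :: u => wd k (none :: none :: u) - consL k none (doubleWord u)
  | some _ :: _ => 0

/-- Doubles the first unit letter of a word, with a sign, if it starts a run of units of odd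
length. -/
def tailHtpyWord : Word X → WordMod k X
  | [] => 0
  | none :: u => doubleWord k (none :: u)
  | some x :: u => - consL k (some x) (tailHtpyWord u)

/-- The homotopy for the Hochschild differential on words. -/
def htpyWord : Word X → WordMod k X
  | [] => 0
  | a :: u => consL k a (tailHtpyWord k u)

/-- The product of the first two letters. -/
def headMulWord : Word X → WordMod k X
  | [] => 0
  | a :: u => mulWord k a u

/-- The last letter is moved to the front. -/
def rotWord (l : Word X) : Word X := l.getLast?.toList ++ l.dropLast

/-- The Hochschild differential `b` on words. -/
def hochWord (l : Word X) : WordMod k X :=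
  barWord k l + (-1 : k) ^ (l.length - 1) • headMulWord k (rotWord l)

open Classical in
/-- The projection to words without unit letter outside the first position. -/
def nondegWord : Word X → WordMod k X
  | [] => wd k []
  | a :: u => if none ∈ u then 0 else wd k (a :: u)

variable {k}

@[simp] theorem consL_wd (a : Option X) (l : Word X) : consL k a (wd k l) = wd k (a :: l) := by
  simp [consL]

@[simp] theorem snocL_wd (a : Option X) (l : Word X) : snocL k a (wd k l) = wd k (l ++ [a]) := by
  simp [snocL]

@[simp] theorem rotWord_nil : rotWord ([] : Word X) = [] := rfl

@[simp] theorem rotWord_singleton (c : Option X) : rotWord [c] = [c] := rfl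

@[simp] theorem rotWord_append (l : Word X) (c : Option X) : rotWord (l ++ [c]) = c :: l := by
  simp [rotWord]

theorem rotWord_cons_append (a : Option X) (l : Word X) (c : Option X) :
    rotWord (a :: (l ++ [c])) = c :: a :: l := rotWord_append (a :: l) c

theorem mulWord_none_cons (b : Option X) (u : Word X) : mulWord k none (b :: u) = wd k (b :: u) :=
  rfl

@[simp] theorem mulWord_nil (a : Option X) : mulWord k a [] = 0 := by
  cases a <;> rfl

theorem mulWord_none (a : Option X) (u : Word X) : mulWord k a (none :: u) = wd k (a :: u) := by
  cases a <;> rfl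

theorem mulWord_some (x y : X) (u : Word X) : mulWord k (some x) (some y :: u) = 0 := rfl

/-! ### Recursions of the word operators along the first letter -/

theorem bar_cons (a : Option X) (v : WordMod k X) :
    wlin k (barWord k) (consL k a v) =
      wlin k (mulWord k a) v - consL k a (wlin k (barWord k) v) :=
  wlin_congr (f := wlin k (barWord k) ∘ₗ consL k a)
    (g := wlin k (mulWord k a) - consL k a ∘ₗ wlin k (barWord k))
    (fun l => by simp [barWord]) v

theorem mulWord_none_consL (a : Option X) (v : WordMod k X) :
    wlin k (mulWord k a) (consL k none v) = consL k a v :=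
  wlin_congr (f := wlin k (mulWord k a) ∘ₗ consL k none) (g := consL k a)
    (fun l => by simp [mulWord_none]) v

theorem mulWord_none_left_consL (b : Option X) (v : WordMod k X) :
    wlin k (mulWord k none) (consL k b v) = consL k b v :=
  wlin_congr (f := wlin k (mulWord k none) ∘ₗ consL k b) (g := consL k b)
    (fun l => by simp [mulWord_none_cons]) v

theorem mulWord_some_consL (x y : X) (v : WordMod k X) :
    wlin k (mulWord k (some x)) (consL k (some y) v) = 0 :=
  wlin_congr (f := wlin k (mulWord k (some x)) ∘ₗ consL k (some y)) (g := 0)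
    (fun l => by simp [mulWord_some]) v

theorem double_cons_some (x : X) (v : WordMod k X) :
    wlin k (doubleWord k) (consL k (some x) v) = 0 :=
  wlin_congr (f := wlin k (doubleWord k) ∘ₗ consL k (some x)) (g := 0)
    (fun l => by simp [doubleWord]) v

theorem double_cons_none (v : WordMod k X) :
    wlin k (doubleWord k) (consL k none v) =
      consL k none (consL k none v) - consL k none (wlin k (doubleWord k) v) :=
  wlin_congr (f := wlin k (doubleWord k) ∘ₗ consL k none)
    (g := consL k none ∘ₗ consL k none - consL k none ∘ₗ wlin k (doubleWord k))
    (fun l => by simp [doubleWord]) v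

theorem tailHtpy_cons_some (x : X) (v : WordMod k X) :
    wlin k (tailHtpyWord k) (consL k (some x) v) =
      - consL k (some x) (wlin k (tailHtpyWord k) v) :=
  wlin_congr (f := wlin k (tailHtpyWord k) ∘ₗ consL k (some x))
    (g := - consL k (some x) ∘ₗ wlin k (tailHtpyWord k))
    (fun l => by simp [tailHtpyWord]) v

theorem tailHtpy_cons_none (v : WordMod k X) :
    wlin k (tailHtpyWord k) (consL k none v) = wlin k (doubleWord k) (consL k none v) :=
  wlin_congr (f := wlin k (tailHtpyWord k) ∘ₗ consL k none)
    (g := wlin k (doubleWord k) ∘ₗ consL k none)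
    (fun l => by simp [tailHtpyWord]) v

theorem htpy_cons (a : Option X) (v : WordMod k X) :
    wlin k (htpyWord k) (consL k a v) = consL k a (wlin k (tailHtpyWord k) v) :=
  wlin_congr (f := wlin k (htpyWord k) ∘ₗ consL k a)
    (g := consL k a ∘ₗ wlin k (tailHtpyWord k))
    (fun l => by simp [htpyWord]) v

/-- In $b'(1\cdot v)$ the first face returns $v$ and the others add up to $-1\cdot b'(v)$. The empty
word is excluded because a letter times the empty word is zero. -/
theorem bar_cons_none (v : WordMod k X) (hv : v [] = 0) :
    wlin k (barWord k) (consL k none v) + consL k none (wlin k (barWord k) v) = v := by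
  have h : wlin k (mulWord k none) v = v - v [] • wd k [] :=
    wlin_congr (f := wlin k (mulWord k none))
      (g := LinearMap.id - (Finsupp.lapply []).smulRight (wd k []))
      (fun l => by
        rcases l with _ | ⟨a, l⟩ <;> rw [wlin_wd] <;> simp [mulWord_none_cons, wd]) v
  rw [bar_cons, h, hv]
  simp

-- A run of $r$ initial units yields $r$ equal faces of alternating sign if a variable follows, but
-- only $r-1$ if the word ends there. Doubling is nonzero for odd $r$ only. So it anticommutes with
-- $b'$ in the first case and contracts the words of units in the second.
open Classical in
theorem bar_double_add (u : Word X) (hu : u ≠ []) :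
    wlin k (barWord k) (doubleWord k u) + wlin k (doubleWord k) (barWord k u) =
      if ∀ a ∈ u, a = none then wd k u else 0 := by
  induction u with
  | nil => exact absurd rfl hu
  | cons a u ih =>
    rcases a with _ | x
    · have e1 : doubleWord k (none :: u) = consL k none (consL k none (wd k u) - doubleWord k u) := by
        simp [doubleWord]
      have e2 : wlin k (mulWord k none) (consL k none (wd k u) - doubleWord k u) =
          consL k none (wd k u) - doubleWord k u := by
        rw [map_sub, mulWord_none_left_consL]
        congr 1
        rcases u with _ | ⟨_ | y, u⟩ <;>
          simp [doubleWord, mulWord_none_cons, mulWord_none_left_consL]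
      rcases eq_or_ne u [] with rfl | hne
      · simp [doubleWord, barWord, mulWord_none_cons]
      · have e3 : mulWord k none u = wd k u := by
          obtain ⟨b, u, rfl⟩ := List.exists_cons_of_ne_nil hne
          rfl
        have ih' := congrArg (consL k none) (ih hne)
        rw [map_add] at ih'
        rw [e1, bar_cons, e2, map_sub, bar_cons, wlin_wd, wlin_wd, barWord, e3, map_sub (wlin k _),
          double_cons_none, wlin_wd]
        simp only [map_sub]
        rw [← sub_eq_zero]
        trans (consL k none (wlin k (barWord k) (doubleWord k u)) +
          consL k none (wlin k (doubleWord k) (barWord k u))) -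
            (if ∀ a ∈ none :: u, a = none then wd k (none :: u) else 0)
        · abel
        · rw [ih', sub_eq_zero]
          simp [apply_ite (consL k none)]
    · rw [doubleWord, map_zero, zero_add, barWord, map_sub, double_cons_some, sub_zero]
      rw [if_neg (by simp)]
      rcases u with _ | ⟨_ | y, u⟩ <;> simp [mulWord_none, mulWord_some, doubleWord]

-- After a leading unit the homotopy is the doubling, so this is `bar_double_add` up to one face:
-- the face removing the leading unit leaves $u$, to which `tailHtpyWord` applies instead of
-- `doubleWord`.
open Classical in
theorem bar_tailHtpy_add_none (u : Word X) :
    wlin k (barWord k) (tailHtpyWord k (none :: u)) +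
        wlin k (tailHtpyWord k) (barWord k (none :: u)) =
      tailHtpyWord k u - doubleWord k u +
        if ∀ a ∈ u, a = none then wd k (none :: u) else 0 := by
  rcases eq_or_ne u [] with rfl | hne
  · simp [tailHtpyWord, doubleWord, barWord, mulWord_none_cons]
  · have h := bar_double_add (k := k) (none :: u) (by simp)
    have e3 : mulWord k none u = wd k u := by
      obtain ⟨b, u, rfl⟩ := List.exists_cons_of_ne_nil hne
      rfl
    rw [barWord, e3, map_sub, wlin_wd] at h
    rw [tailHtpyWord, barWord, e3, map_sub, wlin_wd, tailHtpy_cons_none]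
    simp only [List.mem_cons, forall_eq_or_imp, true_and] at h
    rw [← h]
    abel

/-- Words of the form `x_{j_1} ⋯ x_{j_r} 1 ⋯ 1`. -/
def varsThenUnits : Word X → Prop
  | [] => True
  | none :: u => ∀ a ∈ u, a = none
  | some _ :: u => varsThenUnits u

-- The homotopy and $b'$ both pass the leading variable with a sign, which leaves the face joining
-- $x$ to $u$. That face cancels the extra terms of `bar_tailHtpy_add_none`. Words whose units all
-- stand at the end contribute zero instead of minus the identity; the last face makes up for them
-- in `lastMul_tailHtpy_add`.
open Classical in
theorem bar_tailHtpy_add_some (x : X) (u : Word X) :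
    wlin k (barWord k) (tailHtpyWord k (some x :: u)) +
        wlin k (tailHtpyWord k) (barWord k (some x :: u)) =
      (if varsThenUnits u ∧ none ∈ u then wd k (some x :: u) else 0) -
        if none ∈ u then wd k (some x :: u) else 0 := by
  have key (x : X) (u : Word X) : wlin k (barWord k) (tailHtpyWord k (some x :: u)) +
      wlin k (tailHtpyWord k) (barWord k (some x :: u)) =
      consL k (some x) (wlin k (barWord k) (tailHtpyWord k u) +
        wlin k (tailHtpyWord k) (barWord k u)) -
      wlin k (mulWord k (some x)) (tailHtpyWord k u) +
      wlin k (tailHtpyWord k) (mulWord k (some x) u) := by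
    rw [tailHtpyWord, map_neg, bar_cons, barWord, map_sub, tailHtpy_cons_some, map_add]
    abel
  rw [key]
  induction u generalizing x with
  | nil => simp [tailHtpyWord, barWord]
  | cons a u ih =>
    rcases a with _ | y
    · rw [bar_tailHtpy_add_none, mulWord_none, wlin_wd]
      simp only [tailHtpyWord, doubleWord, map_sub, map_add, mulWord_none_consL,
        varsThenUnits, List.mem_cons, true_or, and_true, if_true, apply_ite (consL k (some x)),
        consL_wd, map_zero]
      rw [← consL_wd (k := k) none, mulWord_none_consL, consL_wd]
      abel
    · rw [key, ih, mulWord_some, tailHtpyWord, map_neg, mulWord_some_consL]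
      simp [varsThenUnits, apply_ite (consL k (some x))]

/-! The last face -/

variable (k) in
/-- The signed last face of `a :: u`, as a function of `u`. -/
def lastMulWord (a : Option X) (u : Word X) : WordMod k X :=
  (-1 : k) ^ u.length • headMulWord k (rotWord (a :: u))

variable (k) in
/-- The sign given by the parity of the length. -/
def lengthSign : WordMod k X →ₗ[k] WordMod k X :=
  wlin k fun l => (-1 : k) ^ l.length • wd k l

theorem hoch_cons (a : Option X) (v : WordMod k X) :
    wlin k (hochWord k) (consL k a v) =
      wlin k (mulWord k a) v - consL k a (wlin k (barWord k) v) + wlin k (lastMulWord k a) v :=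
  wlin_congr (f := wlin k (hochWord k) ∘ₗ consL k a)
    (g := wlin k (mulWord k a) - consL k a ∘ₗ wlin k (barWord k) + wlin k (lastMulWord k a))
    (fun l => by simp [hochWord, barWord, lastMulWord]) v

/-- The appended letter $c$ is the one moved to the front and multiplied onto $a$; the minus sign
accounts for the additional letter in the length. -/
theorem lastMul_snoc (a c : Option X) (v : WordMod k X) :
    wlin k (lastMulWord k a) (snocL k c v) =
      - wlin k (mulWord k c) (consL k a (lengthSign k v)) :=
  wlin_congr (f := wlin k (lastMulWord k a) ∘ₗ snocL k c)
    (g := - wlin k (mulWord k c) ∘ₗ consL k a ∘ₗ lengthSign k)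
    (fun l => by
      simp [lastMulWord, rotWord_cons_append, headMulWord, lengthSign, pow_succ]) v

theorem lengthSign_consL (a : Option X) (v : WordMod k X) :
    lengthSign k (consL k a v) = - consL k a (lengthSign k v) :=
  wlin_congr (f := lengthSign k ∘ₗ consL k a) (g := - consL k a ∘ₗ lengthSign k)
    (fun l => by simp [lengthSign, pow_succ]) v

theorem lengthSign_wd (l : Word X) : lengthSign k (wd k l) = (-1 : k) ^ l.length • wd k l := by
  simp [lengthSign]

theorem lengthSign_double (u : Word X) :
    lengthSign k (doubleWord k u) = - (-1 : k) ^ u.length • doubleWord k u := by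
  induction u with
  | nil => simp [doubleWord]
  | cons a u ih =>
    rcases a with _ | x
    · rw [doubleWord, map_sub, lengthSign_consL, ih, lengthSign_wd]
      simp only [List.length_cons, pow_succ, map_smul]
      module
    · simp [doubleWord]

theorem lengthSign_tailHtpy (u : Word X) :
    lengthSign k (tailHtpyWord k u) = - (-1 : k) ^ u.length • tailHtpyWord k u := by
  induction u with
  | nil => simp [tailHtpyWord]
  | cons a u ih =>
    rcases a with _ | x
    · rw [tailHtpyWord, lengthSign_double]
    · rw [tailHtpyWord, map_neg, lengthSign_consL, ih]
      simp only [List.length_cons, pow_succ, map_smul]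
      module

theorem snocL_consL (a c : Option X) (v : WordMod k X) :
    snocL k c (consL k a v) = consL k a (snocL k c v) :=
  wlin_congr (f := snocL k c ∘ₗ consL k a) (g := consL k a ∘ₗ snocL k c)
    (fun l => by simp) v

-- The appended letter matters only if it is a unit prolonging a run that fills the whole word. The
-- parity of the run then changes, so exactly one of the two doublings is nonzero, and $(-1)^{|u|}$
-- records which.
open Classical in
theorem double_snoc (u : Word X) (c : Option X) :
    doubleWord k (u ++ [c]) = snocL k c (doubleWord k u) +
      if (∀ a ∈ u, a = none) ∧ c = none then (-1 : k) ^ u.length • wd k (u ++ [none, none])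
        else 0 := by
  induction u with
  | nil => cases c <;> simp [doubleWord]
  | cons a u ih =>
    rcases a with _ | x
    · rw [List.cons_append, doubleWord, ih, doubleWord, map_sub, snocL_consL, map_add]
      simp only [List.mem_cons, forall_eq_or_imp, true_and, snocL_wd, List.cons_append,
        List.length_cons, pow_succ]
      split_ifs
      · rw [map_smul, consL_wd]
        module
      · simp
    · simp [doubleWord]

-- Each leading variable changes the sign of the homotopy and that of $(-1)^{|u|}$, so the claim
-- reduces to `double_snoc` for the remaining word.
open Classical in
theorem tailHtpy_snoc (u : Word X) (c : Option X) :
    tailHtpyWord k (u ++ [c]) = snocL k c (tailHtpyWord k u) +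
      if varsThenUnits u ∧ c = none then (-1 : k) ^ u.length • wd k (u ++ [none, none])
        else 0 := by
  induction u with
  | nil => cases c <;> simp [tailHtpyWord, doubleWord, varsThenUnits]
  | cons a u ih =>
    rcases a with _ | x
    · rw [List.cons_append, tailHtpyWord, tailHtpyWord, ← List.cons_append, double_snoc]
      simp only [varsThenUnits, List.mem_cons, forall_eq_or_imp, true_and]
      congr
    · rw [List.cons_append, tailHtpyWord, ih, tailHtpyWord, map_neg, snocL_consL, map_add]
      simp only [varsThenUnits, List.length_cons, pow_succ, List.cons_append]
      split_ifs
      · rw [map_smul, consL_wd]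
        module
      · simp

theorem varsThenUnits_snoc (u : Word X) (c : Option X) :
    varsThenUnits (u ++ [c]) ∧ none ∈ u ++ [c] ↔ varsThenUnits u ∧ c = none := by
  induction u with
  | nil => cases c <;> simp [varsThenUnits]
  | cons a u ih =>
    rcases a with _ | x
    · simp only [List.cons_append, varsThenUnits, List.mem_cons, true_or, and_true,
        List.mem_append, List.not_mem_nil, or_false]
      constructor
      · intro h
        exact ⟨fun a ha => h a (Or.inl ha), h c (Or.inr rfl)⟩
      · rintro ⟨h, rfl⟩ a (ha | rfl)
        · exact h a ha
        · rfl
    · simpa [varsThenUnits] using ih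

/-- The homotopy never acts on the first letter, and multiplication by $c$ changes only that letter
or gives zero. -/
theorem htpy_mulWord (c a : Option X) (v : WordMod k X) :
    wlin k (htpyWord k) (wlin k (mulWord k c) (consL k a v)) =
      wlin k (mulWord k c) (consL k a (wlin k (tailHtpyWord k) v)) := by
  rcases c with _ | x
  · rw [mulWord_none_left_consL, htpy_cons, mulWord_none_left_consL]
  · rcases a with _ | y
    · rw [mulWord_none_consL, htpy_cons, mulWord_none_consL]
    · rw [mulWord_some_consL, mulWord_some_consL, map_zero]

-- The last face involves only the two ends of the word, so it anticommutes with the homotopy up to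
-- the correction term of `tailHtpy_snoc`. That term ends in two units, of which the last face
-- absorbs one.
open Classical in
theorem lastMul_tailHtpy_add (a : Option X) (u : Word X) :
    wlin k (lastMulWord k a) (tailHtpyWord k u) + wlin k (htpyWord k) (lastMulWord k a u) =
      if varsThenUnits u ∧ none ∈ u then wd k (a :: u) else 0 := by
  rcases List.eq_nil_or_concat u with rfl | ⟨u, c, rfl⟩
  · simp [tailHtpyWord, lastMulWord, headMulWord]
  · rw [List.concat_eq_append]
    have e1 : lastMulWord k a (u ++ [c]) =
        - wlin k (mulWord k c) (consL k a (lengthSign k (wd k u))) := by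
      rw [← lastMul_snoc, snocL_wd, wlin_wd]
    rw [tailHtpy_snoc, map_add, lastMul_snoc, e1, map_neg, htpy_mulWord, lengthSign_wd,
      lengthSign_tailHtpy]
    simp only [varsThenUnits_snoc, map_smul, map_neg, wlin_wd, neg_smul, neg_neg]
    -- The regular terms cancel because the homotopy lengthens a word by one letter, which reverses
    -- the sign of the last face.
    rw [add_right_comm, add_neg_cancel, zero_add]
    split_ifs with h
    · rw [map_smul, wlin_wd]
      obtain ⟨-, rfl⟩ := h
      rw [show u ++ [none, none] = (u ++ [none]) ++ [none] by simp, lastMulWord,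
        rotWord_cons_append, headMulWord, mulWord_none_cons, smul_smul, ← pow_add]
      simp [← two_mul, Nat.even_add]
    · simp

/-- All faces but the last give the desired right-hand side minus the words whose tail consists of
variables followed by at least one unit; the last face restores precisely these. -/
theorem hoch_htpy_add_wd (l : Word X) :
    wlin k (hochWord k) (htpyWord k l) + wlin k (htpyWord k) (hochWord k l) =
      wd k l - nondegWord k l := by
  classical
  rcases l with _ | ⟨a, u⟩
  · simp [hochWord, htpyWord, nondegWord, barWord, headMulWord]
  · have e : hochWord k (a :: u) = mulWord k a u - consL k a (barWord k u) +
        lastMulWord k a u := by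
      simp [hochWord, barWord, lastMulWord]
    have h := lastMul_tailHtpy_add (k := k) a u
    rw [htpyWord, hoch_cons, e, map_add, map_sub, htpy_cons, nondegWord]
    have h2 : wlin k (mulWord k a) (tailHtpyWord k u) +
        wlin k (htpyWord k) (mulWord k a u) -
        consL k a (wlin k (barWord k) (tailHtpyWord k u) +
          wlin k (tailHtpyWord k) (barWord k u)) =
        wd k (a :: u) - (if none ∈ u then 0 else wd k (a :: u)) -
          if varsThenUnits u ∧ none ∈ u then wd k (a :: u) else 0 := by
      rcases u with _ | ⟨_ | y, u⟩
      · simp [tailHtpyWord, barWord]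
      · rw [bar_tailHtpy_add_none, mulWord_none, wlin_wd, htpyWord, tailHtpyWord, doubleWord,
          map_sub, ← consL_wd (k := k) none, mulWord_none_consL, mulWord_none_consL, map_add,
          map_sub]
        simp only [consL_wd, varsThenUnits, List.mem_cons, true_or, and_true, if_true,
          apply_ite (consL k a), map_zero]
        abel
      · rw [bar_tailHtpy_add_some, tailHtpyWord, map_neg, ← consL_wd (k := k) (some y)]
        have e3 : wlin k (htpyWord k) (mulWord k a (some y :: u)) =
            wlin k (mulWord k a) (consL k (some y) (tailHtpyWord k u)) := by
          have := htpy_mulWord (k := k) a (some y) (wd k u)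
          simpa using this
        rw [e3, neg_add_cancel, zero_sub]
        simp only [varsThenUnits, List.mem_cons, reduceCtorEq, false_or, map_sub,
          apply_ite (consL k a), map_zero, consL_wd]
        split_ifs <;> simp
    calc _ = (wlin k (mulWord k a) (tailHtpyWord k u) + wlin k (htpyWord k) (mulWord k a u) -
          consL k a (wlin k (barWord k) (tailHtpyWord k u) +
            wlin k (tailHtpyWord k) (barWord k u))) +
          (wlin k (lastMulWord k a) (tailHtpyWord k u) +
            wlin k (htpyWord k) (lastMulWord k a u)) := by
          rw [map_add]
          abel
      _ = _ := by rw [h2, h, sub_add_cancel]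

theorem hoch_htpy_add (v : WordMod k X) :
    wlin k (hochWord k) (wlin k (htpyWord k) v) + wlin k (htpyWord k) (wlin k (hochWord k) v) =
      v - wlin k (nondegWord k) v :=
  wlin_congr (f := wlin k (hochWord k) ∘ₗ wlin k (htpyWord k) +
      wlin k (htpyWord k) ∘ₗ wlin k (hochWord k))
    (g := LinearMap.id - wlin k (nondegWord k))
    (fun l => by simpa using hoch_htpy_add_wd l) v

end Words

end

end CyclicHomology

namespace CyclicHomology

noncomputable section

open scoped TensorProduct

/-! ### The monomial basis of the tensor powers -/

section Bases

variable (k : Type u) [CommRing k] (d : ℕ)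

/-- The exponent of the monomial `1` or `x_j`. -/
def expo : Option (Fin d) → Fin d →₀ ℕ
  | none => 0
  | some j => Finsupp.single j 1

theorem expo_injective : Function.Injective (expo d) := by
  rintro (_ | i) (_ | j) h
  · rfl
  · simp [expo, eq_comm] at h
  · simp [expo] at h
  · simpa [expo, Finsupp.single_left_inj] using h

theorem mk_monomial_expo (a : Option (Fin d)) (c : k) :
    Ideal.Quotient.mk (maxIdeal k d ^ 2) (MvPolynomial.monomial (expo d a) c) =
      c • mono k d a := by
  have h : MvPolynomial.monomial (expo d a) c =
      c • (MvPolynomial.monomial (expo d a) 1 : MvPolynomial (Fin d) k) := by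
    simp [MvPolynomial.smul_monomial]
  rw [h]
  change Ideal.Quotient.mkₐ k _ _ = _
  rw [map_smul]
  congr 1
  rcases a with _ | j
  · exact map_one _
  · rfl

/-- Membership in $\mathfrak m^2$ means that the coefficients in degrees below two vanish, and the
exponents of those degrees are $0$ and the unit vectors. -/
theorem mem_maxIdeal_sq_iff (p : MvPolynomial (Fin d) k) :
    p ∈ maxIdeal k d ^ 2 ↔ ∀ a, p.coeff (expo d a) = 0 := by
  rw [MvPolynomial.mem_pow_idealOfVars_iff']
  constructor
  · intro h a
    apply h
    cases a <;> simp [expo]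
  · intro h x hx
    have : x = 0 ∨ ∃ j, x = Finsupp.single j 1 := by
      by_cases h0 : x = 0
      · exact Or.inl h0
      · obtain ⟨j, hj⟩ := Finsupp.ne_iff.1 h0
        have hle : Finsupp.single j 1 ≤ x := by
          simpa using Nat.one_le_iff_ne_zero.2 hj
        obtain ⟨y, rfl⟩ := le_iff_exists_add.1 hle
        have hy : y.degree = 0 := by
          rw [map_add, Finsupp.degree_single] at hx
          omega
        rw [Finsupp.degree_eq_zero_iff] at hy
        exact Or.inr ⟨j, by rw [hy, add_zero]⟩
    rcases this with rfl | ⟨j, rfl⟩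
    · exact h none
    · exact h (some j)

theorem coeff_expo_sum (c : Option (Fin d) → k) (a : Option (Fin d)) :
    (∑ b, MvPolynomial.monomial (expo d b) (c b)).coeff (expo d a) = c a := by
  classical
  rw [MvPolynomial.coeff_sum]
  simp [MvPolynomial.coeff_monomial, (expo_injective d).eq_iff]

theorem linearIndependent_mono : LinearIndependent k (mono k d) := by
  rw [Fintype.linearIndependent_iff]
  intro c hc a
  have h : ∑ b, MvPolynomial.monomial (expo d b) (c b) ∈ maxIdeal k d ^ 2 := by
    rw [← Ideal.Quotient.eq_zero_iff_mem, map_sum]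
    simpa only [mk_monomial_expo] using hc
  rw [mem_maxIdeal_sq_iff] at h
  have := h a
  rwa [coeff_expo_sum] at this

theorem mk_eq_sum (p : MvPolynomial (Fin d) k) :
    Ideal.Quotient.mk (maxIdeal k d ^ 2) p = ∑ a, p.coeff (expo d a) • mono k d a := by
  simp only [← mk_monomial_expo]
  rw [← map_sum, Ideal.Quotient.eq, mem_maxIdeal_sq_iff]
  intro a
  rw [MvPolynomial.coeff_sub, coeff_expo_sum, sub_self]

/-- The basis `1, x_1, …, x_d` of the truncated polynomial algebra. -/
def monoBasis : Module.Basis (Option (Fin d)) k (TruncAlg k d) :=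
  Module.Basis.mk (linearIndependent_mono k d) (by
    rintro x -
    obtain ⟨p, rfl⟩ := Ideal.Quotient.mk_surjective x
    rw [mk_eq_sum]
    exact Submodule.sum_mem _ fun a _ => Submodule.smul_mem _ _ (Submodule.subset_span ⟨a, rfl⟩))

@[simp]
theorem monoBasis_apply (a : Option (Fin d)) : monoBasis k d a = mono k d a := by
  simp [monoBasis]

/-- The class of `x_j` in `𝔪 / 𝔪²`. -/
def mvar (j : Fin d) : mbar k d :=
  (maxIdeal k d).toCotangent ⟨MvPolynomial.X j, Ideal.subset_span ⟨j, rfl⟩⟩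

/-- The inclusion `𝔪 / 𝔪² → A`. -/
def mbarIncl : mbar k d →ₗ[k] TruncAlg k d :=
  (maxIdeal k d).cotangentToQuotientSquare.restrictScalars k

theorem mbarIncl_injective : Function.Injective (mbarIncl k d) :=
  (maxIdeal k d).cotangentToQuotientSquare_injective

theorem mbarIncl_mvar (j : Fin d) : mbarIncl k d (mvar k d j) = mono k d (some j) :=
  Ideal.toCotangent_to_quotient_square _ _

/-- The basis `x_1, …, x_d` of `𝔪 / 𝔪²`. -/
def mvarBasis : Module.Basis (Fin d) k (mbar k d) :=
  Module.Basis.mk (v := mvar k d)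
    (LinearIndependent.of_comp (mbarIncl k d) (by
      have h : mbarIncl k d ∘ mvar k d = mono k d ∘ some := by
        funext j
        exact mbarIncl_mvar k d j
      rw [h]
      exact (linearIndependent_mono k d).comp _ (Option.some_injective _)))
    (by
      rintro x -
      obtain ⟨p, rfl⟩ := Ideal.toCotangent_surjective _ x
      -- An element of $\mathfrak m$ has no constant term, so modulo $\mathfrak m^2$ only the
      -- coefficients of the variables remain.
      have h0 : (p : MvPolynomial (Fin d) k).coeff (expo d none) = 0 := by
        have : (p : MvPolynomial (Fin d) k) ∈ maxIdeal k d ^ 1 := (pow_one (maxIdeal k d)).symm ▸ p.2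
        exact (MvPolynomial.mem_pow_idealOfVars_iff' 1 _).1 this _ (by simp [expo])
      have h : (maxIdeal k d).toCotangent p =
          ∑ j, (p : MvPolynomial (Fin d) k).coeff (expo d (some j)) • mvar k d j := by
        apply mbarIncl_injective
        rw [map_sum]
        simp only [map_smul, mbarIncl_mvar]
        refine (Ideal.toCotangent_to_quotient_square _ _).trans ((mk_eq_sum k d p).trans ?_)
        rw [ Fintype.sum_option, h0, zero_smul, zero_add]
      rw [h]
      exact Submodule.sum_mem _ fun a _ =>
        Submodule.smul_mem _ _ (Submodule.subset_span ⟨a, rfl⟩))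

@[simp]
theorem mvarBasis_apply (j : Fin d) : mvarBasis k d j = mvar k d j := by
  simp [mvarBasis]

/-! ### Translation of tensors and their operators into words -/

/-- The linear embedding of `A^{⊗ n}` in the free module on all words. -/
def theta (n : ℕ) : ⨂[k]^n (TruncAlg k d) →ₗ[k] WordMod k (Fin d) :=
  Finsupp.lmapDomain k k List.ofFn ∘ₗ
    (Basis.piTensorProduct fun _ : Fin n => monoBasis k d).repr.toLinearMap

theorem theta_injective (n : ℕ) : Function.Injective (theta k d n) := by
  rw [theta, LinearMap.coe_comp]
  exact (Finsupp.mapDomain_injective List.ofFn_injective).comp (LinearEquiv.injective _)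

/-- The linear embedding of `(𝔪 / 𝔪²)^{⊗ n}` in the free module on all words. -/
def thetaBar (n : ℕ) : ⨂[k]^n (mbar k d) →ₗ[k] WordMod k (Fin d) :=
  Finsupp.lmapDomain k k (fun f => List.ofFn (fun i => some (f i))) ∘ₗ
    (Basis.piTensorProduct fun _ : Fin n => mvarBasis k d).repr.toLinearMap

theorem thetaBar_injective (n : ℕ) : Function.Injective (thetaBar k d n) := by
  rw [thetaBar, LinearMap.coe_comp]
  refine (Finsupp.mapDomain_injective ?_).comp (LinearEquiv.injective _)
  intro f g h
  have := List.ofFn_injective h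
  funext i
  exact Option.some_injective _ (congrFun this i)

variable {d}

theorem theta_mono {n : ℕ} (f : Fin n → Option (Fin d)) :
    theta k d n (PiTensorProduct.tprod k fun i => mono k d (f i)) = wd k (List.ofFn f) := by
  have h : (PiTensorProduct.tprod k fun i => mono k d (f i)) =
      Basis.piTensorProduct (fun _ : Fin n => monoBasis k d) f := by
    simp
  rw [h, theta, LinearMap.comp_apply, LinearEquiv.coe_coe, Module.Basis.repr_self]
  simp [wd]

theorem thetaBar_mvar {n : ℕ} (f : Fin n → Fin d) :
    thetaBar k d n (PiTensorProduct.tprod k fun i => mvar k d (f i)) =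
      wd k (List.ofFn fun i => some (f i)) := by
  have h : (PiTensorProduct.tprod k fun i => mvar k d (f i)) =
      Basis.piTensorProduct (fun _ : Fin n => mvarBasis k d) f := by
    simp
  rw [h, thetaBar, LinearMap.comp_apply, LinearEquiv.coe_coe, Module.Basis.repr_self]
  simp [wd]

variable {k}

theorem tensor_ext {n : ℕ} {M : Type*} [AddCommGroup M] [Module k M]
    {f g : ⨂[k]^n (TruncAlg k d) →ₗ[k] M}
    (h : ∀ a : Fin n → Option (Fin d), f (PiTensorProduct.tprod k fun i => mono k d (a i)) =
      g (PiTensorProduct.tprod k fun i => mono k d (a i))) : f = g :=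
  (Basis.piTensorProduct fun _ : Fin n => monoBasis k d).ext fun a => by simpa using h a

theorem tensorBar_ext {n : ℕ} {M : Type*} [AddCommGroup M] [Module k M]
    {f g : ⨂[k]^n (mbar k d) →ₗ[k] M}
    (h : ∀ a : Fin n → Fin d, f (PiTensorProduct.tprod k fun i => mvar k d (a i)) =
      g (PiTensorProduct.tprod k fun i => mvar k d (a i))) : f = g :=
  (Basis.piTensorProduct fun _ : Fin n => mvarBasis k d).ext fun a => by simpa using h a

/-- Both sides are multilinear in the tail, so basis tails suffice for the proof. An arbitrary tail
is needed in `theta_barD_mono`, where it contains a product of two letters. -/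
theorem theta_cons {n : ℕ} (a : Option (Fin d)) (g : Fin n → TruncAlg k d) :
    theta k d (n + 1) (PiTensorProduct.tprod k
        (Fin.cons (mono k d a) g : Fin (n + 1) → TruncAlg k d)) =
      consL k a (theta k d n (PiTensorProduct.tprod k g)) := by
  have h : ((theta k d (n + 1)).compMultilinearMap
      (PiTensorProduct.tprod k)).curryLeft (mono k d a) =
      (consL k a ∘ₗ theta k d n).compMultilinearMap (PiTensorProduct.tprod k) := by
    refine Module.Basis.ext_multilinear (fun _ => monoBasis k d) fun f => ?_
    simp only [monoBasis_apply, MultilinearMap.curryLeft_apply,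
      LinearMap.compMultilinearMap_apply, LinearMap.comp_apply]
    rw [theta_mono, consL_wd]
    have : (Fin.cons (mono k d a) fun i => mono k d (f i) : Fin (n + 1) → TruncAlg k d) =
        fun i => mono k d ((Fin.cons a f : Fin (n + 1) → Option (Fin d)) i) := by
      funext i
      refine Fin.cases ?_ (fun i => ?_) i <;> simp
    rw [this, theta_mono, List.ofFn_succ]
    simp
  exact congrArg (fun m => m g) h

theorem face_zero_tprod {n : ℕ} (f : Fin (n + 2) → Option (Fin d)) :
    theta k d (n + 1) (face k (TruncAlg k d) n 0
        (PiTensorProduct.tprod k fun i => mono k d (f i))) =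
      headMulWord k (List.ofFn f) := by
  have e : (Fin.contractNth (0 : Fin (n + 1)).castSucc (· * ·) fun i => mono k d (f i)) =
      (Fin.cons (mono k d (f 0) * mono k d (f 1)) fun i => mono k d (f i.succ.succ) :
        Fin (n + 1) → TruncAlg k d) := by
    funext l
    refine Fin.cases ?_ (fun l => ?_) l <;> simp [Fin.contractNth]
  rw [face_tprod, e, List.ofFn_succ, List.ofFn_succ, headMulWord]
  have hw (a : Option (Fin d)) : theta k d (n + 1) (PiTensorProduct.tprod k
      (Fin.cons (mono k d a) fun i => mono k d (f i.succ.succ) : Fin (n + 1) → TruncAlg k d)) =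
      wd k (a :: List.ofFn fun i => f i.succ.succ) := by
    rw [theta_cons, theta_mono, consL_wd]
  have h1 : (0 : Fin (n + 1)).succ = 1 := rfl
  rw [h1]
  rcases ha : f 0 with _ | x
  · rw [mulWord_none_cons, ← hw]
    simp [mono]
  · rcases hb : f 1 with _ | y
    · rw [mulWord_none, ← hw]
      simp [mono]
    · rw [mulWord_some, mono_some_mul, MultilinearMap.map_coord_zero _ 0, map_zero]
      simp

theorem theta_headMul (n : ℕ) (z : ⨂[k]^(n + 2) (TruncAlg k d)) :
    theta k d (n + 1) (face k (TruncAlg k d) n 0 z) =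
      wlin k (headMulWord k) (theta k d (n + 2) z) := by
  have h : theta k d (n + 1) ∘ₗ face k (TruncAlg k d) n 0 =
      wlin k (headMulWord k) ∘ₗ theta k d (n + 2) := by
    apply tensor_ext
    intro f
    rw [LinearMap.comp_apply, LinearMap.comp_apply, face_zero_tprod, theta_mono, wlin_wd]
  exact LinearMap.congr_fun h z

/-- Since $d_{i+1}(a\otimes u)=a\otimes d_i(u)$, the sum over the faces after the first is
$-a\otimes b'(u)$, which is the recursion defining `barWord`. -/
theorem theta_barD_mono {n : ℕ} (f : Fin (n + 2) → Option (Fin d)) :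
    theta k d (n + 1) (barD k (TruncAlg k d) n
        (PiTensorProduct.tprod k fun i => mono k d (f i))) = barWord k (List.ofFn f) := by
  induction n with
  | zero =>
    have h : barD k (TruncAlg k d) 0 = face k (TruncAlg k d) 0 0 := by simp [barD]
    rw [h, face_zero_tprod]
    simp [headMulWord, barWord]
  | succ n ih =>
    have hs (i : Fin (n + 1)) : theta k d (n + 2) (face k (TruncAlg k d) (n + 1) i.succ
        (PiTensorProduct.tprod k fun i => mono k d (f i))) =
        consL k (f 0) (theta k d (n + 1) (face k (TruncAlg k d) n i
          (PiTensorProduct.tprod k fun i => mono k d (f i.succ)))) := by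
      rw [face_tprod, face_tprod, ← theta_cons]
      congr 2
      funext l
      refine Fin.cases ?_ (fun l => ?_) l
      · simp [Fin.contractNth]
      · simp only [Fin.contractNth, Fin.val_castSucc, Fin.val_succ, Fin.cons_succ,
          ← Fin.succ_castSucc]
        split_ifs <;> first | omega | rfl
    rw [List.ofFn_succ, barWord, ← ih, barD, Fin.sum_univ_succ, LinearMap.add_apply, map_add,
      sub_eq_add_neg]
    congr 1
    · simp only [Fin.val_zero, pow_zero, one_smul]
      rw [face_zero_tprod, List.ofFn_succ, headMulWord]
    · rw [barD]
      simp only [LinearMap.sum_apply, map_sum, LinearMap.smul_apply, map_smul, Fin.val_succ]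
      rw [← Finset.sum_neg_distrib]
      refine Finset.sum_congr rfl fun i _ => ?_
      rw [hs, pow_succ, mul_neg, mul_one, neg_smul]

theorem theta_barD (n : ℕ) (z : ⨂[k]^(n + 2) (TruncAlg k d)) :
    theta k d (n + 1) (barD k (TruncAlg k d) n z) =
      wlin k (barWord k) (theta k d (n + 2) z) := by
  have h : theta k d (n + 1) ∘ₗ barD k (TruncAlg k d) n =
      wlin k (barWord k) ∘ₗ theta k d (n + 2) := by
    apply tensor_ext
    intro f
    rw [LinearMap.comp_apply, LinearMap.comp_apply, theta_barD_mono, theta_mono, wlin_wd]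
  exact LinearMap.congr_fun h z

theorem ofFn_rotate {Y : Type*} (n : ℕ) (f : Fin (n + 1) → Option Y) :
    rotWord (List.ofFn f) =
      List.ofFn (Fin.cons (f (Fin.last n)) fun i => f i.castSucc : Fin (n + 1) → Option Y) := by
  rw [List.ofFn_succ', List.concat_eq_append, rotWord_append, List.ofFn_succ]
  simp

theorem theta_rot (n : ℕ) (z : ⨂[k]^(n + 1) (TruncAlg k d)) :
    theta k d (n + 1) (rot k (TruncAlg k d) (n + 1) z) =
      wlin k (fun l => wd k (rotWord l)) (theta k d (n + 1) z) := by
  have h : theta k d (n + 1) ∘ₗ rot k (TruncAlg k d) (n + 1) =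
      wlin k (fun l => wd k (rotWord l)) ∘ₗ theta k d (n + 1) := by
    apply tensor_ext
    intro f
    rw [LinearMap.comp_apply, LinearMap.comp_apply, theta_mono, wlin_wd, rot_tprod_cons,
      ofFn_rotate, theta_cons, theta_mono, consL_wd, List.ofFn_succ]
    simp
  exact LinearMap.congr_fun h z

theorem thetaBar_rot (n : ℕ) (z : ⨂[k]^(n + 1) (mbar k d)) :
    thetaBar k d (n + 1) (rot k (mbar k d) (n + 1) z) =
      wlin k (fun l => wd k (rotWord l)) (thetaBar k d (n + 1) z) := by
  have h : thetaBar k d (n + 1) ∘ₗ rot k (mbar k d) (n + 1) =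
      wlin k (fun l => wd k (rotWord l)) ∘ₗ thetaBar k d (n + 1) := by
    apply tensorBar_ext
    intro f
    have e : (Fin.cons (mvar k d (f (Fin.last n))) fun i => mvar k d (f i.castSucc) :
        Fin (n + 1) → mbar k d) =
        fun i => mvar k d ((Fin.cons (f (Fin.last n)) fun i => f i.castSucc :
          Fin (n + 1) → Fin d) i) := by
      funext i
      refine Fin.cases ?_ (fun i => ?_) i <;> simp
    rw [LinearMap.comp_apply, LinearMap.comp_apply, thetaBar_mvar, wlin_wd, rot_tprod_cons, e,
      thetaBar_mvar, ofFn_rotate, List.ofFn_succ, List.ofFn_succ]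
    simp
  exact LinearMap.congr_fun h z

/-! #### Words of given length and weight -/

/-- The weight of a word. -/
def wtWord {X : Type*} (l : Word X) : ℕ := l.countP Option.isSome

variable (k) in
/-- The span of the words of weight `w` and length `n`. -/
def wordSub (X : Type*) (w n : ℕ) : Submodule k (WordMod k X) :=
  Finsupp.supported k k {l : Word X | l.length = n ∧ wtWord l = w}

theorem wordSub_eq_span (X : Type*) (w n : ℕ) : wordSub k X w n =
    Submodule.span k (wd k '' {l : Word X | l.length = n ∧ wtWord l = w}) :=
  Finsupp.supported_eq_span_single k _

theorem wd_mem_wordSub {X : Type*} {w n : ℕ} {l : Word X} (hn : l.length = n)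
    (hw : wtWord l = w) : wd k l ∈ wordSub k X w n :=
  Finsupp.single_mem_supported k 1 ⟨hn, hw⟩

theorem mem_of_mem_wordSub {X M : Type*} [AddCommGroup M] [Module k M] {w n : ℕ}
    (φ : WordMod k X →ₗ[k] M) (S : Submodule k M)
    (h : ∀ l : Word X, l.length = n → wtWord l = w → φ (wd k l) ∈ S) {v : WordMod k X}
    (hv : v ∈ wordSub k X w n) : φ v ∈ S := by
  have h2 : wordSub k X w n ≤ S.comap φ := by
    rw [wordSub_eq_span, Submodule.span_le]
    rintro _ ⟨l, ⟨h1, h2⟩, rfl⟩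
    exact h l h1 h2
  exact h2 hv

theorem eq_of_mem_wordSub {X M : Type*} [AddCommGroup M] [Module k M] {w n : ℕ}
    (φ ψ : WordMod k X →ₗ[k] M)
    (h : ∀ l : Word X, l.length = n → wtWord l = w → φ (wd k l) = ψ (wd k l)) {v : WordMod k X}
    (hv : v ∈ wordSub k X w n) : φ v = ψ v := by
  have := mem_of_mem_wordSub (φ - ψ) ⊥ (fun l h1 h2 => by simp [h l h1 h2]) hv
  simpa [sub_eq_zero] using this

theorem wtWord_ofFn {n : ℕ} (f : Fin n → Option (Fin d)) : wtWord (List.ofFn f) = wt f := by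
  rw [wtWord, wt_eq_sum]
  induction n with
  | zero => simp
  | succ n ih =>
    rw [List.ofFn_succ, List.countP_cons, ih, Fin.sum_univ_succ, add_comm]

theorem map_theta_weightSub (w q : ℕ) :
    (weightSub k d w q).map (theta k d (q + 1)) = wordSub k (Fin d) w (q + 1) := by
  rw [weightSub, Submodule.map_span, wordSub_eq_span]
  congr 1
  ext v
  constructor
  · rintro ⟨_, ⟨f, hf, rfl⟩, rfl⟩
    exact ⟨List.ofFn f, ⟨by simp, by rw [wtWord_ofFn, hf]⟩, (theta_mono k f).symm⟩
  · rintro ⟨l, ⟨h1, h2⟩, rfl⟩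
    subst h2
    obtain ⟨f, rfl⟩ : ∃ f : Fin (q + 1) → Option (Fin d), l = List.ofFn f := by
      refine ⟨fun i => l.get (i.cast h1.symm), ?_⟩
      exact List.ext_get (by simp [h1]) fun n h h' => by simp [-List.ofFn_succ]
    exact ⟨_, ⟨f, (wtWord_ofFn f).symm, rfl⟩, theta_mono k f⟩

variable (k d) in
/-- The part of weight `w` of `A^{⊗ q+1}` as a module of words. -/
def thetaEquiv (w q : ℕ) : weightSub k d w q ≃ₗ[k] wordSub k (Fin d) w (q + 1) :=
  (Submodule.equivMapOfInjective _ (theta_injective k d (q + 1)) _).trans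
    (LinearEquiv.ofEq _ _ (map_theta_weightSub w q))

@[simp]
theorem coe_thetaEquiv (w q : ℕ) (z : weightSub k d w q) :
    (thetaEquiv k d w q z : WordMod k (Fin d)) = theta k d (q + 1) z := rfl

/-- An operator on words that maps weight `w`, length `q + 1` to weight `w`, length `q' + 1`, as
an operator on tensors. -/
def liftOp {w q q' : ℕ} (φ : WordMod k (Fin d) →ₗ[k] WordMod k (Fin d))
    (h : ∀ v ∈ wordSub k (Fin d) w (q + 1), φ v ∈ wordSub k (Fin d) w (q' + 1)) :
    weightSub k d w q →ₗ[k] weightSub k d w q' :=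
  (thetaEquiv k d w q').symm.toLinearMap ∘ₗ φ.restrict h ∘ₗ (thetaEquiv k d w q).toLinearMap

theorem theta_liftOp {w q q' : ℕ} (φ : WordMod k (Fin d) →ₗ[k] WordMod k (Fin d))
    (h : ∀ v ∈ wordSub k (Fin d) w (q + 1), φ v ∈ wordSub k (Fin d) w (q' + 1))
    (z : weightSub k d w q) :
    theta k d (q' + 1) (liftOp φ h z) = φ (theta k d (q + 1) z) := by
  rw [← coe_thetaEquiv]
  simp [liftOp, LinearMap.restrict_apply]

end Bases

end

end CyclicHomology

namespace CyclicHomology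

noncomputable section

open scoped TensorProduct

/-! ### Homology as a subquotient -/

section Subquotient

variable {k : Type u} [CommRing k]

/-- The quotient of `Z` by `Z ∩ B`. -/
abbrev Subquotient {M : Type*} [AddCommGroup M] [Module k M] (Z B : Submodule k M) : Type _ :=
  Z ⧸ B.comap Z.subtype

/-- At $n=0$ the truncated index $n-1$ is $0$. Both `next 0 = 0` and the vanishing of `K.d 0 0` then
make the kernel the whole module, as it should be. -/
theorem homology_iso_subquotient (K : ChainComplex (ModuleCat.{u} k) ℕ) (n : ℕ)
    {Z B : Submodule k (K.X n)} (hZ : LinearMap.ker (K.d n (n - 1)).hom = Z)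
    (hB : LinearMap.range (K.d (n + 1) n).hom = B) :
    Nonempty (K.homology n ≅ ModuleCat.of k (Subquotient Z B)) := by
  subst hZ hB
  have hp : (ComplexShape.down ℕ).prev n = n + 1 := by simp
  have hn : (ComplexShape.down ℕ).next n = n - 1 := by rcases n with _ | n <;> simp
  refine ⟨(K.homologyIsoSc' (n + 1) n (n - 1) hp hn) ≪≫
    (K.sc' (n + 1) n (n - 1)).moduleCatHomologyIso ≪≫
    (Submodule.quotEquivOfEq _ _ ?_).toModuleIso⟩
  ext x
  constructor
  · rintro ⟨y, rfl⟩
    exact ⟨y, rfl⟩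
  · rintro ⟨y, hy⟩
    exact ⟨y, Subtype.ext hy⟩

/-- An elementwise criterion that needs no inverse map: `hZ` and one direction of `hB` let $\varphi$
descend, the other direction gives injectivity and `hs` surjectivity. -/
theorem subquotient_equiv {M M' : Type*} [AddCommGroup M] [Module k M] [AddCommGroup M']
    [Module k M'] {Z B : Submodule k M} {Z' B' : Submodule k M'} (φ : M →ₗ[k] M')
    (hZ : ∀ z ∈ Z, φ z ∈ Z') (hB : ∀ z ∈ Z, φ z ∈ B' ↔ z ∈ B)
    (hs : ∀ z' ∈ Z', ∃ z ∈ Z, z' - φ z ∈ B') :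
    Nonempty (Subquotient Z B ≃ₗ[k] Subquotient Z' B') := by
  let ψ : Subquotient Z B →ₗ[k] Subquotient Z' B' :=
    Submodule.mapQ _ _ (φ.restrict hZ) fun z hz => (hB z z.2).2 hz
  refine ⟨LinearEquiv.ofBijective ψ ⟨?_, ?_⟩⟩
  · rw [← LinearMap.ker_eq_bot, LinearMap.ker_eq_bot']
    intro x hx
    obtain ⟨z, rfl⟩ := Submodule.Quotient.mk_surjective _ x
    rw [Submodule.Quotient.mk_eq_zero]
    exact (hB z z.2).1 ((Submodule.Quotient.mk_eq_zero (B'.comap Z'.subtype)).1 hx)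
  · intro x
    obtain ⟨z', rfl⟩ := Submodule.Quotient.mk_surjective _ x
    obtain ⟨z, hz, h⟩ := hs z' z'.2
    refine ⟨Submodule.Quotient.mk ⟨z, hz⟩, ?_⟩
    exact ((Submodule.Quotient.eq (B'.comap Z'.subtype)).2 h).symm

end Subquotient

namespace StableFamily

/-! ### The total complex of a stable family in terms of elements -/

variable {k : Type u} [CommRing k] {A : Type u} [Ring A] [Algebra k A] (F : StableFamily k A)

/-- The total complex. -/
abbrev tot : ChainComplex (ModuleCat.{u} k) ℕ := F.bicomplex.total (ComplexShape.down ℕ)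

/-- The inclusion of the summand in column `p` and row `q`. -/
def incl (p q n : ℕ) (h : p + q = n) : F.sub q →ₗ[k] F.tot.X n :=
  ModuleCat.Hom.hom (F.bicomplex.ιTotal (ComplexShape.down ℕ) p q n h :
    ModuleCat.of k (F.sub q) ⟶ F.tot.X n)

/-- The differential of the total complex. -/
def totD (n : ℕ) : F.tot.X (n + 1) →ₗ[k] F.tot.X n := (F.tot.d (n + 1) n).hom

/-- Linear maps from the total complex. -/
def desc {n : ℕ} {M : Type u} [AddCommGroup M] [Module k M]
    (f : ∀ p q, p + q = n → F.sub q →ₗ[k] M) : F.tot.X n →ₗ[k] M :=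
  ModuleCat.Hom.hom (F.bicomplex.totalDesc (A := ModuleCat.of k M)
    fun p q h => (ModuleCat.ofHom (f p q h) : ModuleCat.of k (F.sub q) ⟶ ModuleCat.of k M))

variable {F}

@[simp]
theorem desc_incl {n : ℕ} {M : Type u} [AddCommGroup M] [Module k M]
    (f : ∀ p q, p + q = n → F.sub q →ₗ[k] M) (p q : ℕ) (h : p + q = n) (x : F.sub q) :
    F.desc f (F.incl p q n h x) = f p q h x := by
  have := F.bicomplex.ι_totalDesc (c₁₂ := ComplexShape.down ℕ) (A := ModuleCat.of k M)
    (fun p q h => (ModuleCat.ofHom (f p q h) : ModuleCat.of k (F.sub q) ⟶ ModuleCat.of k M)) p q h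
  exact congrArg (fun φ => ModuleCat.Hom.hom φ x) this

theorem tot_ext {n : ℕ} {M : Type u} [AddCommGroup M] [Module k M]
    {f g : F.tot.X n →ₗ[k] M}
    (h : ∀ p q (hn : p + q = n) x, f (F.incl p q n hn x) = g (F.incl p q n hn x)) : f = g := by
  have : ModuleCat.ofHom f = ModuleCat.ofHom g := by
    apply HomologicalComplex₂.total.hom_ext
    intro p q hn
    apply ModuleCat.hom_ext
    apply LinearMap.ext
    intro x
    exact h p q hn x
  exact congrArg ModuleCat.Hom.hom this

theorem D₁_incl_zero (n q : ℕ) (h : 0 + q = n + 1) (x : F.sub q) :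
    (F.bicomplex.D₁ (ComplexShape.down ℕ) (n + 1) n).hom (F.incl 0 q (n + 1) h x) = 0 := by
  have := F.bicomplex.ι_D₁ (ComplexShape.down ℕ) (n + 1) n 0 q h
  rw [F.bicomplex.d₁_eq_zero _ _ _ _ (by simp)] at this
  exact congrArg (fun φ => ModuleCat.Hom.hom φ x) this

theorem D₁_incl_succ (n p q : ℕ) (h : p + 1 + q = n + 1) (x : F.sub q) :
    (F.bicomplex.D₁ (ComplexShape.down ℕ) (n + 1) n).hom (F.incl (p + 1) q (n + 1) h x) =
      F.incl p q n (by omega) (F.horiz p q x) := by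
  have := F.bicomplex.ι_D₁ (ComplexShape.down ℕ) (n + 1) n (p + 1) q h
  have hn : p + q = n := by omega
  rw [F.bicomplex.d₁_eq (i₁' := p) _ (by simp) q n hn, bicomplex_d] at this
  refine (congrArg (fun φ => ModuleCat.Hom.hom φ x) this).trans ?_
  exact one_smul ℤ _

theorem D₂_incl_zero (n p : ℕ) (h : p + 0 = n + 1) (x : F.sub 0) :
    (F.bicomplex.D₂ (ComplexShape.down ℕ) (n + 1) n).hom (F.incl p 0 (n + 1) h x) = 0 := by
  have := F.bicomplex.ι_D₂ (ComplexShape.down ℕ) (n + 1) n p 0 h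
  rw [F.bicomplex.d₂_eq_zero _ _ _ _ (by simp)] at this
  exact congrArg (fun φ => ModuleCat.Hom.hom φ x) this

theorem D₂_incl_succ (n p q : ℕ) (h : p + (q + 1) = n + 1) (x : F.sub (q + 1)) :
    (F.bicomplex.D₂ (ComplexShape.down ℕ) (n + 1) n).hom (F.incl p (q + 1) (n + 1) h x) =
      (-1 : k) ^ p • F.incl p q n (by omega) (F.vert p q x) := by
  have := F.bicomplex.ι_D₂ (ComplexShape.down ℕ) (n + 1) n p (q + 1) h
  have hn : p + q = n := by omega
  rw [F.bicomplex.d₂_eq _ _ (i₂' := q) (by simp) n hn] at this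
  have hd : (F.bicomplex.X p).d (q + 1) q = ModuleCat.ofHom (F.vert p q) := F.column_d p q
  rw [hd] at this
  refine (congrArg (fun φ => ModuleCat.Hom.hom φ x) this).trans ?_
  -- The sign of the total complex is a unit of $\mathbb Z$; it is matched with $(-1)^p$ in $k$
  -- through the parity of $p$.
  have hε : ComplexShape.ε₂ (ComplexShape.down ℕ) (ComplexShape.down ℕ)
    (ComplexShape.down ℕ) (p, q + 1) = (-1) ^ p := rfl
  rw [hε]
  rcases Nat.even_or_odd p with hp | hp
  · rw [hp.neg_one_pow, hp.neg_one_pow, one_smul, one_smul]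
    rfl
  · rw [hp.neg_one_pow, hp.neg_one_pow, neg_one_smul, Units.neg_smul, one_smul]
    rfl

/-- The horizontal part of the differential. -/
def horizPart : ∀ (p q n : ℕ), p + q = n + 1 → F.sub q →ₗ[k] F.tot.X n
  | 0, _, _, _ => 0
  | p + 1, q, n, _ => F.incl p q n (by omega) ∘ₗ F.horiz p q

/-- The vertical part of the differential, up to sign. -/
def vertPart : ∀ (p q n : ℕ), p + q = n + 1 → F.sub q →ₗ[k] F.tot.X n
  | _, 0, _, _ => 0
  | p, q + 1, n, _ => F.incl p q n (by omega) ∘ₗ F.vert p q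

/-- As `horizPart` vanishes on column $0$ and `vertPart` on row $0$, one formula also covers the
edges of the quadrant. -/
theorem totD_incl (n p q : ℕ) (h : p + q = n + 1) (x : F.sub q) :
    F.totD n (F.incl p q (n + 1) h x) =
      horizPart p q n h x + (-1 : k) ^ p • vertPart p q n h x := by
  have e : F.totD n (F.incl p q (n + 1) h x) =
    (F.bicomplex.D₁ (ComplexShape.down ℕ) (n + 1) n).hom (F.incl p q (n + 1) h x) +
    (F.bicomplex.D₂ (ComplexShape.down ℕ) (n + 1) n).hom (F.incl p q (n + 1) h x) := rfl
  rw [e]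
  congr 1
  · rcases p with _ | p
    · exact D₁_incl_zero n q h x
    · exact D₁_incl_succ n p q h x
  · rcases q with _ | q
    · rw [D₂_incl_zero n p h x, vertPart, LinearMap.zero_apply, smul_zero]
    · exact D₂_incl_succ n p q h x

theorem totD_totD (n : ℕ) (z : F.tot.X (n + 2)) : F.totD n (F.totD (n + 1) z) = 0 :=
  congrArg (fun φ => ModuleCat.Hom.hom φ z) (F.tot.d_comp_d (n + 2) (n + 1) n)

/-! ### Filtration of the total complex by columns -/

/-- The part of the total complex in columns less than `p`. -/
def fil (F : StableFamily k A) (n p : ℕ) : Submodule k (F.tot.X n) :=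
  ⨆ i : {i : ℕ × ℕ // i.1 + i.2 = n ∧ i.1 < p}, LinearMap.range (F.incl i.1.1 i.1.2 n i.2.1)

theorem incl_mem_fil {n p p' q : ℕ} (h : p' + q = n) (hp : p' < p) (x : F.sub q) :
    F.incl p' q n h x ∈ F.fil n p :=
  Submodule.mem_iSup_of_mem (⟨(p', q), h, hp⟩ : {i : ℕ × ℕ // i.1 + i.2 = n ∧ i.1 < p})
    ⟨x, rfl⟩

theorem fil_le {n p : ℕ} {S : Submodule k (F.tot.X n)}
    (h : ∀ p' q (hn : p' + q = n), p' < p → ∀ x, F.incl p' q n hn x ∈ S) : F.fil n p ≤ S := by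
  refine iSup_le ?_
  rintro ⟨⟨p', q⟩, hn, hp⟩ _ ⟨x, rfl⟩
  exact h p' q hn hp x

theorem fil_mono {n p p' : ℕ} (h : p ≤ p') : F.fil n p ≤ F.fil n p' :=
  fil_le fun _ _ hn hp x => incl_mem_fil hn (hp.trans_le h) x

theorem fil_zero (n : ℕ) : F.fil n 0 = ⊥ :=
  le_bot_iff.1 (fil_le fun _ _ _ hp => absurd hp (Nat.not_lt_zero _))

theorem fil_top (n : ℕ) : F.fil n (n + 1) = ⊤ := by
  rw [← Submodule.ker_mkQ (F.fil n (n + 1)), LinearMap.ker_eq_top]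
  apply tot_ext
  intro p q hn x
  rw [LinearMap.zero_apply, Submodule.mkQ_apply, Submodule.Quotient.mk_eq_zero]
  exact incl_mem_fil hn (by omega) x

/-- In degree $n$ column $p$ contributes the single row $q=n-p$, so the leading term is one element
$x$. -/
theorem exists_of_mem_fil_succ {n p q : ℕ} (hn : p + q = n) {z : F.tot.X n}
    (hz : z ∈ F.fil n (p + 1)) : ∃ x y, y ∈ F.fil n p ∧ z = F.incl p q n hn x + y := by
  have : F.fil n (p + 1) ≤ LinearMap.range (F.incl p q n hn) ⊔ F.fil n p := by
    refine fil_le fun p' q' hn' hp x => ?_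
    rcases Nat.lt_succ_iff_lt_or_eq.1 hp with h | rfl
    · exact Submodule.mem_sup_right (incl_mem_fil hn' h x)
    · obtain rfl : q = q' := by omega
      exact Submodule.mem_sup_left ⟨x, rfl⟩
  obtain ⟨_, ⟨x, rfl⟩, y, hy, rfl⟩ := Submodule.mem_sup.1 (this hz)
  exact ⟨x, y, hy, rfl⟩

theorem fil_succ_le {n p : ℕ} (h : n < p) : F.fil n (p + 1) ≤ F.fil n p :=
  fil_le fun _ _ hn _ x => incl_mem_fil hn (by omega) x

/-! ### From column homotopies to the total complex -/

/-- Homotopies `h` in the columns of the bicomplex between the identity and maps `π`. -/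
structure ColumnHomotopy (F : StableFamily k A) where
  /-- The homotopies, depending on the column. -/
  h : ∀ _ q : ℕ, F.sub q →ₗ[k] F.sub (q + 1)
  /-- The maps homotopic to the identity, depending on the column. -/
  π : ∀ _ q : ℕ, F.sub q →ₗ[k] F.sub q
  zero : ∀ (p : ℕ) (x : F.sub 0), F.vert p 0 (h p 0 x) = x - π p 0 x
  succ : ∀ (p q : ℕ) (x : F.sub (q + 1)),
    F.vert p (q + 1) (h p (q + 1) x) + h p q (F.vert p q x) = x - π p (q + 1) x

namespace ColumnHomotopy

variable (H : F.ColumnHomotopy)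

/-- The homotopy on the total complex. -/
def total (n : ℕ) : F.tot.X n →ₗ[k] F.tot.X (n + 1) :=
  F.desc fun p q hn => (-1 : k) ^ p • F.incl p (q + 1) (n + 1) (by omega) ∘ₗ H.h p q

theorem total_incl (n p q : ℕ) (hn : p + q = n) (x : F.sub q) :
    H.total n (F.incl p q n hn x) =
      (-1 : k) ^ p • F.incl p (q + 1) (n + 1) (by omega) (H.h p q x) := by
  rw [total, desc_incl]
  rfl

theorem total_mem_fil {n p : ℕ} {z : F.tot.X n} (hz : z ∈ F.fil n p) :
    H.total n z ∈ F.fil (n + 1) p := by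
  have : F.fil n p ≤ (F.fil (n + 1) p).comap (H.total n) := by
    refine fil_le fun p' q' hn' hp x => ?_
    rw [Submodule.mem_comap, total_incl]
    exact Submodule.smul_mem _ _ (incl_mem_fil _ hp _)
  exact this hz

/-- The composite of the homotopy with the differential going into degree `n`. -/
def prevTotal : ∀ n : ℕ, F.tot.X n →ₗ[k] F.tot.X n
  | 0 => 0
  | n + 1 => H.total n ∘ₗ F.totD n

theorem horizPart_mem_fil (p q n : ℕ) (h : p + q = n + 1) (x : F.sub q) :
    horizPart p q n h x ∈ F.fil n p := by
  rcases p with _ | p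
  · exact Submodule.zero_mem _
  · exact incl_mem_fil _ (Nat.lt_succ_self p) _

/-- The sign $(-1)^p$ of the homotopy cancels that of the vertical differential, so the vertical
parts reproduce the identity $x-\pi x$ in column $p$. The horizontal parts of both composites lie in
columns to the left. -/
theorem incl_sub_mem_fil (n p q : ℕ) (hn : p + q = n) (x : F.sub q) :
    F.incl p q n hn x - F.totD n (H.total n (F.incl p q n hn x)) -
      H.prevTotal n (F.incl p q n hn x) - F.incl p q n hn (H.π p q x) ∈ F.fil n p := by
  have sq : (-1 : k) ^ p * (-1) ^ p = 1 := by rw [← mul_pow]; simp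
  rw [total_incl, map_smul, totD_incl, smul_add, smul_smul, sq, one_smul]
  have h1 := horizPart_mem_fil p (q + 1) n (by omega) (H.h p q x)
  rcases q with _ | q
  -- No vertical differential leaves row $0$, so only a horizontal contribution appears here.
  · have h2 : H.prevTotal n (F.incl p 0 n hn x) ∈ F.fil n p := by
      rcases n with _ | n
      · exact Submodule.zero_mem _
      · rw [prevTotal, LinearMap.comp_apply, totD_incl]
        simp only [vertPart, LinearMap.zero_apply, smul_zero, add_zero]
        exact H.total_mem_fil (horizPart_mem_fil _ _ _ _ _)
    have h3 : vertPart p 1 n (by omega) (H.h p 0 x) =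
        F.incl p 0 n hn x - F.incl p 0 n hn (H.π p 0 x) := by
      rw [← map_sub, ← H.zero]
      rfl
    rw [h3]
    convert Submodule.neg_mem _ (Submodule.add_mem _ (Submodule.smul_mem _ ((-1 : k) ^ p) h1) h2)
      using 1
    abel
  · obtain ⟨n, rfl⟩ : ∃ n', n = n' + 1 := ⟨p + q, by omega⟩
    have h3 : vertPart p (q + 2) (n + 1) (by omega) (H.h p (q + 1) x) +
        F.incl p (q + 1) (n + 1) hn (H.h p q (F.vert p q x)) =
        F.incl p (q + 1) (n + 1) hn x - F.incl p (q + 1) (n + 1) hn (H.π p (q + 1) x) := by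
      rw [← map_sub, ← H.succ, map_add]
      rfl
    have h4 : H.total n (vertPart p (q + 1) n hn x) =
        (-1 : k) ^ p • F.incl p (q + 1) (n + 1) hn (H.h p q (F.vert p q x)) := by
      rw [vertPart, LinearMap.comp_apply, total_incl]
    have h2 := H.total_mem_fil (horizPart_mem_fil p (q + 1) n hn x)
    rw [prevTotal, LinearMap.comp_apply, totD_incl, map_add, map_smul, h4, smul_smul, sq,
      one_smul]
    convert Submodule.neg_mem _ (Submodule.add_mem _ (Submodule.smul_mem _ ((-1 : k) ^ p) h1) h2)
      using 1
    rw [← sub_eq_zero] at h3 ⊢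
    rw [← neg_eq_zero, ← h3]
    abel

theorem sub_mem_fil {n p : ℕ} {z : F.tot.X n} (hz : z ∈ F.fil n p) :
    z - F.totD n (H.total n z) - H.prevTotal n z ∈ F.fil n p := by
  have : F.fil n p ≤ (F.fil n p).comap
      (LinearMap.id - F.totD n ∘ₗ H.total n - H.prevTotal n) := by
    refine fil_le fun p' q hn hp x => ?_
    have h := fil_mono hp.le (H.incl_sub_mem_fil n p' q hn x)
    exact (Submodule.sub_mem_iff_left _ (incl_mem_fil hn hp _)).1 h
  exact this hz

/-- If $\pi$ kills the leading term, that term disappears modulo lower columns, while the remainder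
stays in the filtration by `sub_mem_fil`. -/
theorem sub_mem_fil_of_mem_succ {n p : ℕ} {z : F.tot.X n} (hz : z ∈ F.fil n (p + 1))
    (hπ : ∀ q (hn : p + q = n) (x : F.sub q), z - F.incl p q n hn x ∈ F.fil n p → H.π p q x = 0) :
    z - F.totD n (H.total n z) - H.prevTotal n z ∈ F.fil n p := by
  by_cases hp : p ≤ n
  · obtain ⟨q, hn⟩ := Nat.exists_eq_add_of_le hp
    obtain ⟨x, y, hy, rfl⟩ := exists_of_mem_fil_succ hn.symm hz
    have h0 := hπ q hn.symm x (by simpa using hy)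
    have h1 := H.incl_sub_mem_fil n p q hn.symm x
    rw [h0, map_zero, sub_zero] at h1
    convert Submodule.add_mem _ h1 (H.sub_mem_fil hy) using 1
    simp only [map_add]
    abel
  · exact H.sub_mem_fil (fil_succ_le (not_le.1 hp) hz)

end ColumnHomotopy

/-- The cycles in the total complex. -/
def totCycles (F : StableFamily k A) : ∀ n : ℕ, Submodule k (F.tot.X n)
  | 0 => ⊤
  | n + 1 => LinearMap.ker (F.totD n)

theorem totD_mem_totCycles (n : ℕ) (z : F.tot.X (n + 1)) : F.totD n z ∈ F.totCycles n := by
  rcases n with _ | n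
  · exact Submodule.mem_top
  · exact totD_totD n z

namespace ColumnHomotopy

variable (H : F.ColumnHomotopy)

theorem prevTotal_eq_zero {n : ℕ} {z : F.tot.X n} (hz : z ∈ F.totCycles n) :
    H.prevTotal n z = 0 := by
  rcases n with _ | n
  · rfl
  · rw [prevTotal, LinearMap.comp_apply, show F.totD n z = 0 from hz, map_zero]

/-- A criterion for cycles to be boundaries: `S` should contain certain boundaries and
no elements with leading term in the image of the projections. -/
theorem exists_totD_eq {n : ℕ} (S : Submodule k (F.tot.X n))
    (hS : ∀ y, F.totD n (H.total n y) ∈ S)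
    (hπ : ∀ z ∈ S, ∀ p q (hn : p + q = n) (x : F.sub q),
      z - F.incl p q n hn x ∈ F.fil n p → H.π p q x = 0)
    {p : ℕ} {z : F.tot.X n} (hzS : z ∈ S) (hzc : z ∈ F.totCycles n) (hz : z ∈ F.fil n p) :
    ∃ y ∈ F.fil (n + 1) p, F.totD n y = z := by
  induction p generalizing z with
  | zero =>
    rw [fil_zero, Submodule.mem_bot] at hz
    exact ⟨0, Submodule.zero_mem _, by rw [map_zero, hz]⟩
  | succ p ih =>
    -- Passing from $z$ to $z-DHz$ preserves membership in $S$ and being a cycle, and removes column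
    -- $p$.
    have h := H.sub_mem_fil_of_mem_succ hz (hπ z hzS p)
    rw [H.prevTotal_eq_zero hzc, sub_zero] at h
    obtain ⟨y, hy, e⟩ := ih (Submodule.sub_mem _ hzS (hS z))
      (Submodule.sub_mem _ hzc (totD_mem_totCycles _ _)) h
    refine ⟨y + H.total n z, Submodule.add_mem _ (fil_mono (Nat.le_succ p) hy)
      (H.total_mem_fil hz), ?_⟩
    rw [map_add, e, sub_add_cancel]

end ColumnHomotopy

theorem HC_iso (n : ℕ) : Nonempty (F.HC n ≅ ModuleCat.of k
    (Subquotient (F.totCycles n) (LinearMap.range (F.totD n)))) := by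
  refine homology_iso_subquotient F.tot n ?_ rfl
  rcases n with _ | n
  · rw [F.tot.shape _ _ (by simp)]
    exact LinearMap.ker_zero
  · rfl

end StableFamily

end

end CyclicHomology

namespace CyclicHomology

noncomputable section

open scoped TensorProduct

/-! ### Weights of words, and the retraction to words without units -/

section Retraction

variable {k : Type*} [CommRing k] {X : Type*}

theorem wtWord_le_length (l : Word X) : wtWord l ≤ l.length := List.countP_le_length

@[simp] theorem wtWord_none_cons (l : Word X) : wtWord (none :: l) = wtWord l := by
  simp [wtWord]

@[simp] theorem wtWord_some_cons (x : X) (l : Word X) : wtWord (some x :: l) = wtWord l + 1 := by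
  simp [wtWord]

theorem none_mem_iff (l : Word X) : none ∈ l ↔ wtWord l ≠ l.length := by
  induction l with
  | nil => simp [wtWord]
  | cons a l ih =>
    rcases a with _ | x
    · have := wtWord_le_length l
      simp
      omega
    · simp [ih]

theorem consL_none_mem {w n : ℕ} {v : WordMod k X} (hv : v ∈ wordSub k X w n) :
    consL k none v ∈ wordSub k X w (n + 1) :=
  mem_of_mem_wordSub _ _ (fun l h1 h2 => by
    rw [consL_wd]
    exact wd_mem_wordSub (by simp [h1]) (by simp [h2])) hv

theorem consL_some_mem (x : X) {w n : ℕ} {v : WordMod k X} (hv : v ∈ wordSub k X w n) :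
    consL k (some x) v ∈ wordSub k X (w + 1) (n + 1) :=
  mem_of_mem_wordSub _ _ (fun l h1 h2 => by
    rw [consL_wd]
    exact wd_mem_wordSub (by simp [h1]) (by simp [h2])) hv

theorem doubleWord_mem (l : Word X) : doubleWord k l ∈ wordSub k X (wtWord l) (l.length + 1) := by
  induction l with
  | nil => exact Submodule.zero_mem _
  | cons a l ih =>
    rcases a with _ | x
    · exact Submodule.sub_mem _ (wd_mem_wordSub (by simp) (by simp))
        (by simpa using consL_none_mem ih)
    · exact Submodule.zero_mem _

theorem tailHtpyWord_mem (l : Word X) :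
    tailHtpyWord k l ∈ wordSub k X (wtWord l) (l.length + 1) := by
  induction l with
  | nil => exact Submodule.zero_mem _
  | cons a l ih =>
    rcases a with _ | x
    · exact doubleWord_mem _
    · exact Submodule.neg_mem _ (by simpa using consL_some_mem x ih)

theorem htpy_mem {w n : ℕ} {v : WordMod k X} (hv : v ∈ wordSub k X w n) :
    wlin k (htpyWord k) v ∈ wordSub k X w (n + 1) :=
  mem_of_mem_wordSub _ _ (fun l h1 h2 => by
    subst h1 h2
    rw [wlin_wd]
    rcases l with _ | ⟨_ | x, l⟩
    · exact Submodule.zero_mem _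
    · rw [htpyWord]
      simpa using consL_none_mem (tailHtpyWord_mem l)
    · rw [htpyWord]
      simpa using consL_some_mem x (tailHtpyWord_mem l)) hv

theorem nondeg_mem {w n : ℕ} {v : WordMod k X} (hv : v ∈ wordSub k X w n) :
    wlin k (nondegWord k) v ∈ wordSub k X w n :=
  mem_of_mem_wordSub _ _ (fun l h1 h2 => by
    classical
    rw [wlin_wd]
    rcases l with _ | ⟨a, l⟩
    · exact wd_mem_wordSub h1 h2
    · rw [nondegWord]
      split_ifs
      · exact Submodule.zero_mem _
      · exact wd_mem_wordSub h1 h2) hv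

theorem apply_nil_eq_zero {w n : ℕ} {v : WordMod k X} (hv : v ∈ wordSub k X w (n + 1)) :
    v [] = 0 := by
  have := eq_of_mem_wordSub (Finsupp.lapply []) 0 (fun l h1 _ => by
    rw [Finsupp.lapply_apply, wd, Finsupp.single_apply, if_neg]
    · rfl
    · rintro rfl
      simp at h1) hv
  simpa using this

/-! ### Projections to variable words, and their behaviour under rotation and the differentials -/

open Classical in
variable (k) in
/-- The projection to words without units. -/
def varWord (l : Word X) : WordMod k X := if none ∈ l then 0 else wd k l

variable (k) in
/-- Words consisting of a unit followed by variables, with the unit removed. -/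
def stripWord : Word X → WordMod k X
  | none :: l => varWord k l
  | _ => 0

variable (k) in
/-- The signed rotation of words. -/
def cycL : WordMod k X →ₗ[k] WordMod k X :=
  wlin k fun l => (-1 : k) ^ (l.length - 1) • wd k (rotWord l)

theorem cycL_wd (l : Word X) :
    cycL k (wd k l) = (-1 : k) ^ (l.length - 1) • wd k (rotWord l) := by
  simp [cycL]

theorem mem_rotWord (a : Option X) (l : Word X) : a ∈ rotWord l ↔ a ∈ l := by
  rcases List.eq_nil_or_concat l with rfl | ⟨u, c, rfl⟩
  · simp
  · simp [or_comm]

theorem var_cycL (v : WordMod k X) :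
    wlin k (varWord k) (cycL k v) = cycL k (wlin k (varWord k) v) :=
  wlin_congr (f := wlin k (varWord k) ∘ₗ cycL k) (g := cycL k ∘ₗ wlin k (varWord k))
    (fun l => by
      classical
      rw [LinearMap.comp_apply, LinearMap.comp_apply, cycL_wd, map_smul, wlin_wd, wlin_wd, varWord,
        varWord]
      simp only [mem_rotWord]
      split_ifs
      · simp
      · rw [cycL_wd]) v

theorem var_consL_none (v : WordMod k X) : wlin k (varWord k) (consL k none v) = 0 :=
  wlin_congr (f := wlin k (varWord k) ∘ₗ consL k none) (g := 0)
    (fun l => by simp [varWord]) v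

theorem var_consL_some (x : X) (v : WordMod k X) :
    wlin k (varWord k) (consL k (some x) v) = consL k (some x) (wlin k (varWord k) v) :=
  wlin_congr (f := wlin k (varWord k) ∘ₗ consL k (some x))
    (g := consL k (some x) ∘ₗ wlin k (varWord k))
    (fun l => by
      classical
      simp [varWord, apply_ite (consL k (some x))]) v

/-- A word of variables appears in $b'(l)$ only if $l$ has exactly one unit. An inner unit is
absorbed by two adjacent faces of opposite sign, which cancel. A unit at the front or at the end is
absorbed by one face, giving the two terms on the right. -/
theorem var_bar_wd (l : Word X) : wlin k (varWord k) (barWord k l) =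
    stripWord k l - (-1 : k) ^ (l.length - 1) • stripWord k (rotWord l) := by
  classical
  induction l with
  | nil => simp [barWord, stripWord]
  | cons a l ih =>
    rcases List.eq_nil_or_concat l with rfl | ⟨u, c, rfl⟩
    · simp [barWord]
    · rw [List.concat_eq_append] at *
      rw [rotWord_append] at ih
      rw [barWord, map_sub, rotWord_cons_append]
      rcases a with _ | x
      · have e : mulWord k none (u ++ [c]) = wd k (u ++ [c]) := by
          rcases u with _ | ⟨b, u⟩ <;> rfl
        rw [var_consL_none, e, wlin_wd]
        rcases c with _ | c <;> simp [stripWord, varWord]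
      · rw [var_consL_some, ih]
        have e : wlin k (varWord k) (mulWord k (some x) (u ++ [c])) =
            consL k (some x) (stripWord k (u ++ [c])) := by
          rcases h : u ++ [c] with _ | ⟨_ | y, u⟩
          · simp [stripWord]
          · simp [mulWord_none, stripWord, varWord, apply_ite (consL k (some x))]
          · simp [mulWord_some, stripWord]
        have e2 : consL k (some x) (stripWord k (c :: u)) = stripWord k (c :: some x :: u) := by
          rcases c with _ | c <;> simp [stripWord, varWord, apply_ite (consL k (some x))]
        rw [e, map_sub, map_smul, e2]
        simp only [stripWord, List.length_append, List.length_cons, List.length_nil,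
          Nat.add_sub_cancel, zero_add, pow_succ]
        module

theorem var_bar (v : WordMod k X) : wlin k (varWord k) (wlin k (barWord k) v) =
    wlin k (stripWord k) (v - cycL k v) := by
  rw [map_sub]
  exact wlin_congr (f := wlin k (varWord k) ∘ₗ wlin k (barWord k))
    (g := wlin k (stripWord k) - wlin k (stripWord k) ∘ₗ cycL k)
    (fun l => by
      rw [LinearMap.comp_apply, wlin_wd, var_bar_wd]
      simp [cycL_wd]) v

/-- The retraction on the odd columns is compatible with the differentials. -/
theorem retract_odd (v : WordMod k X) :
    wlin k (varWord k) (v - cycL k v) + wlin k (stripWord k) (v - cycL k v) -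
      wlin k (varWord k) (wlin k (barWord k) v) =
    wlin k (varWord k) v - cycL k (wlin k (varWord k) v) := by
  rw [var_bar, add_sub_cancel_right, map_sub, var_cycL]

/-- Writing $\pi$ for the projection, $bh+hb=1-\pi$ and $b^2=0$ give $b\pi=b-bhb=\pi b$. The
relation $b^2=0$ is assumed on the two vectors concerned; for words coming from tensors it is
supplied by `hoch_hoch`. -/
theorem nondeg_hoch {v : WordMod k X}
    (h1 : wlin k (hochWord k) (wlin k (hochWord k) (wlin k (htpyWord k) v)) = 0)
    (h2 : wlin k (hochWord k) (wlin k (hochWord k) v) = 0) :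
    wlin k (nondegWord k) (wlin k (hochWord k) v) =
      wlin k (hochWord k) (wlin k (nondegWord k) v) := by
  have e1 := hoch_htpy_add (wlin k (hochWord k) v)
  have e2 := congrArg (wlin k (hochWord k)) (hoch_htpy_add v)
  rw [map_add, map_sub, h1, zero_add] at e2
  rw [h2, map_zero, add_zero, e2] at e1
  exact (sub_right_injective e1).symm

theorem bar_of_forall_some (l : Word X) (h : none ∉ l) : barWord k l = 0 := by
  induction l with
  | nil => rfl
  | cons a l ih =>
    rw [barWord, ih fun h' => h (List.mem_cons_of_mem _ h'), map_zero, sub_zero]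
    rcases a with _ | x
    · simp at h
    · rcases l with _ | ⟨_ | y, l⟩
      · rfl
      · simp at h
      · rfl

theorem headMul_of_forall_some (l : Word X) (h : none ∉ l) : headMulWord k l = 0 := by
  rcases l with _ | ⟨_ | x, _ | ⟨_ | y, l⟩⟩
  · rfl
  · simp at h
  · simp at h
  · simp at h
  · rfl
  · simp at h
  · rfl

theorem hoch_of_forall_some (l : Word X) (h : none ∉ l) : hochWord k l = 0 := by
  rw [hochWord, bar_of_forall_some l h, headMul_of_forall_some _ (by rwa [mem_rotWord]), smul_zero,
    add_zero]

/-- Only the two faces touching the unit can be nonzero. They give $y$ and $-ty$, which is how $1-t$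
enters as a vertical differential. -/
theorem hoch_none_cons (l : Word X) (h : none ∉ l) :
    hochWord k (none :: l) = wd k l - cycL k (wd k l) := by
  rw [hochWord, barWord, bar_of_forall_some l h, map_zero, sub_zero, cycL_wd]
  rcases List.eq_nil_or_concat l with rfl | ⟨u, c, rfl⟩
  · simp [headMulWord]
  · rw [List.concat_eq_append, rotWord_cons_append, rotWord_append, headMulWord, mulWord_none]
    have e : mulWord k none (u ++ [c]) = wd k (u ++ [c]) := by
      rcases u with _ | ⟨b, u⟩ <;> rfl
    rw [e]
    simp only [List.length_append, List.length_cons, List.length_nil,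
      Nat.add_sub_cancel, zero_add, pow_succ]
    module

/-- A word with a unit past the first position is killed by `varWord` and by `stripWord` as well. -/
theorem retract_nondeg (v : WordMod k X) :
    wlin k (varWord k) (wlin k (nondegWord k) v) +
      wlin k (stripWord k) (wlin k (nondegWord k) v) =
    wlin k (varWord k) v + wlin k (stripWord k) v :=
  wlin_congr (f := (wlin k (varWord k) + wlin k (stripWord k)) ∘ₗ wlin k (nondegWord k))
    (g := wlin k (varWord k) + wlin k (stripWord k))
    (fun l => by
      classical
      rcases l with _ | ⟨_ | x, l⟩
      · simp [nondegWord]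
      · by_cases h : none ∈ l <;> simp [nondegWord, h, varWord, stripWord]
      · by_cases h : none ∈ l <;> simp [nondegWord, h, varWord, stripWord]) v

/-- The retraction on the even columns is compatible with the differentials. -/
theorem retract_even {v : WordMod k X}
    (h1 : wlin k (hochWord k) (wlin k (hochWord k) (wlin k (htpyWord k) v)) = 0)
    (h2 : wlin k (hochWord k) (wlin k (hochWord k) v) = 0) :
    wlin k (varWord k) (wlin k (hochWord k) v) + wlin k (stripWord k) (wlin k (hochWord k) v) =
      wlin k (stripWord k) v - cycL k (wlin k (stripWord k) v) := by
  rw [← retract_nondeg, nondeg_hoch h1 h2]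
  refine wlin_congr (f := (wlin k (varWord k) + wlin k (stripWord k)) ∘ₗ wlin k (hochWord k) ∘ₗ
    wlin k (nondegWord k))
    (g := wlin k (stripWord k) - cycL k ∘ₗ wlin k (stripWord k)) (fun l => ?_) v
  classical
  rcases l with _ | ⟨_ | x, l⟩
  · simp [nondegWord, stripWord, hochWord, barWord, headMulWord]
  · by_cases h : none ∈ l
    · simp [nondegWord, h, stripWord, varWord]
    · have e1 : wlin k (stripWord k) (cycL k (wd k l)) = 0 := by
        rw [cycL_wd, map_smul, wlin_wd]
        have : none ∉ rotWord l := by rwa [mem_rotWord]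
        rcases hr : rotWord l with _ | ⟨_ | y, u⟩
        · simp [stripWord]
        · simp [hr] at this
        · simp [stripWord]
      have e2 : wlin k (stripWord k) (wd k l) = 0 := by
        rcases l with _ | ⟨_ | y, u⟩
        · simp [stripWord]
        · simp at h
        · simp [stripWord]
      simp [nondegWord, h, stripWord, varWord, hoch_none_cons l h, var_cycL, e1, e2]
  · by_cases h : none ∈ l
    · simp [nondegWord, h, stripWord]
    · have h' : none ∉ some x :: l := by simp [h]
      simp [nondegWord, h, stripWord, hoch_of_forall_some _ h']

/-! The retraction on words of fixed weight and length -/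

variable {w n : ℕ} {v : WordMod k X}

theorem var_of_mem (hv : v ∈ wordSub k X w w) : wlin k (varWord k) v = v :=
  eq_of_mem_wordSub _ LinearMap.id (fun l h1 h2 => by
    have h : none ∉ l := by
      rw [none_mem_iff, h1, h2]
      simp
    simp [varWord, h]) hv

theorem var_eq_zero (hn : n ≠ w) (hv : v ∈ wordSub k X w n) : wlin k (varWord k) v = 0 :=
  eq_of_mem_wordSub _ 0 (fun l h1 h2 => by
    have h : none ∈ l := by
      rw [none_mem_iff, h1, h2]
      exact hn.symm
    simp [varWord, h]) hv

theorem strip_eq_zero (hn : n ≠ w + 1) (hv : v ∈ wordSub k X w n) :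
    wlin k (stripWord k) v = 0 :=
  eq_of_mem_wordSub _ 0 (fun l h1 h2 => by
    rcases l with _ | ⟨_ | x, l⟩
    · simp [stripWord]
    · have h : none ∈ l := by
        rw [none_mem_iff]
        simp at h1 h2
        omega
      simp [stripWord, varWord, h]
    · simp [stripWord]) hv

/-- Without units past the first position, the length of a word is its weight or its weight plus
one. -/
theorem nondeg_eq_zero (hn : n ≠ w) (hn' : n ≠ w + 1) (hv : v ∈ wordSub k X w n) :
    wlin k (nondegWord k) v = 0 :=
  eq_of_mem_wordSub _ 0 (fun l h1 h2 => by
    classical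
    rcases l with _ | ⟨_ | x, l⟩
    · simp [wtWord] at h1 h2
      omega
    · have h : none ∈ l := by
        rw [none_mem_iff]
        simp at h1 h2
        omega
      simp [nondegWord, h]
    · have h : none ∈ l := by
        rw [none_mem_iff]
        simp at h1 h2
        omega
      simp [nondegWord, h]) hv

theorem nondeg_eq_consL_strip (hv : v ∈ wordSub k X w (w + 1)) :
    wlin k (nondegWord k) v = consL k none (wlin k (stripWord k) v) :=
  eq_of_mem_wordSub _ (consL k none ∘ₗ wlin k (stripWord k)) (fun l h1 h2 => by
    classical
    rcases l with _ | ⟨_ | x, l⟩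
    · simp at h1
    · by_cases h : none ∈ l <;> simp [nondegWord, h, stripWord, varWord]
    · have h : none ∈ l := by
        rw [none_mem_iff]
        simp at h1 h2
        omega
      simp [nondegWord, h, stripWord]) hv

theorem strip_mem (hv : v ∈ wordSub k X w (n + 1)) :
    wlin k (stripWord k) v ∈ wordSub k X w n :=
  mem_of_mem_wordSub _ _ (fun l h1 h2 => by
    classical
    rw [wlin_wd]
    rcases l with _ | ⟨_ | x, l⟩
    · exact Submodule.zero_mem _
    · rw [stripWord, varWord]
      split_ifs
      · exact Submodule.zero_mem _
      · exact wd_mem_wordSub (by simpa using h1) (by simpa using h2)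
    · exact Submodule.zero_mem _) hv

theorem eq_zero_of_mem_of_lt (hn : n < w) (hv : v ∈ wordSub k X w n) : v = 0 :=
  eq_of_mem_wordSub LinearMap.id 0 (fun l h1 h2 => by
    have := wtWord_le_length l
    omega) hv

end Retraction

end

end CyclicHomology

namespace CyclicHomology

noncomputable section

open scoped TensorProduct

/-! ### The cyclic bicomplex in terms of words -/

section WeightFamily

variable {k : Type u} [CommRing k] {d : ℕ}

theorem theta_hochD (n : ℕ) (z : ⨂[k]^(n + 2) (TruncAlg k d)) :
    theta k d (n + 1) (hochD k (TruncAlg k d) n z) =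
      wlin k (hochWord k) (theta k d (n + 2) z) := by
  have h : theta k d (n + 1) ∘ₗ hochD k (TruncAlg k d) n =
      wlin k (hochWord k) ∘ₗ theta k d (n + 2) := by
    apply tensor_ext
    intro f
    simp only [LinearMap.comp_apply]
    rw [hochD, LinearMap.add_apply, map_add, LinearMap.smul_apply, map_smul, theta_barD, lastFace,
      LinearMap.comp_apply, theta_headMul, theta_rot, theta_mono, wlin_wd, wlin_wd, wlin_wd,
      wlin_wd, hochWord, List.length_ofFn]
    rfl
  exact LinearMap.congr_fun h z

theorem theta_cyc (n : ℕ) (z : ⨂[k]^(n + 1) (TruncAlg k d)) :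
    theta k d (n + 1) (cyc k (TruncAlg k d) (n + 1) z) = cycL k (theta k d (n + 1) z) := by
  have h : theta k d (n + 1) ∘ₗ cyc k (TruncAlg k d) (n + 1) = cycL k ∘ₗ theta k d (n + 1) := by
    apply tensor_ext
    intro f
    simp only [LinearMap.comp_apply]
    rw [cyc, LinearMap.smul_apply, map_smul, theta_rot, theta_mono, wlin_wd, cycL_wd,
      List.length_ofFn]
  exact LinearMap.congr_fun h z

theorem thetaBar_cyc (n : ℕ) (z : ⨂[k]^(n + 1) (mbar k d)) :
    thetaBar k d (n + 1) (cyc k (mbar k d) (n + 1) z) = cycL k (thetaBar k d (n + 1) z) := by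
  have h : thetaBar k d (n + 1) ∘ₗ cyc k (mbar k d) (n + 1) = cycL k ∘ₗ thetaBar k d (n + 1) := by
    apply tensorBar_ext
    intro f
    simp only [LinearMap.comp_apply]
    rw [cyc, LinearMap.smul_apply, map_smul, thetaBar_rot, thetaBar_mvar, wlin_wd, cycL_wd,
      List.length_ofFn]
  exact LinearMap.congr_fun h z

variable (k) in
/-- The norm operator on words of length `m`. -/
def normL (X : Type*) (m : ℕ) : WordMod k X →ₗ[k] WordMod k X :=
  ∑ i ∈ Finset.range m, cycL k ^ i

theorem map_geom_sum {M N : Type*} [AddCommGroup M] [Module k M] [AddCommGroup N] [Module k N]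
    (φ : M →ₗ[k] N) (s : Module.End k M) (t : Module.End k N) (h : ∀ z, φ (s z) = t (φ z))
    (m : ℕ) (z : M) :
    φ ((∑ i ∈ Finset.range m, s ^ i) z) = (∑ i ∈ Finset.range m, t ^ i) (φ z) := by
  have hp : ∀ i z, φ ((s ^ i) z) = (t ^ i) (φ z) := by
    intro i
    induction i with
    | zero => intro z; rfl
    | succ i ih => intro z; rw [pow_succ, pow_succ, Module.End.mul_apply, Module.End.mul_apply, ih, h]
  rw [LinearMap.sum_apply, LinearMap.sum_apply, map_sum]
  exact Finset.sum_congr rfl fun i _ => hp i z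

theorem theta_norm (n : ℕ) (z : ⨂[k]^(n + 1) (TruncAlg k d)) :
    theta k d (n + 1) (norm k (TruncAlg k d) (n + 1) z) =
      normL k (Fin d) (n + 1) (theta k d (n + 1) z) :=
  map_geom_sum _ _ _ (theta_cyc n) _ z

theorem thetaBar_norm (n : ℕ) (z : ⨂[k]^(n + 1) (mbar k d)) :
    thetaBar k d (n + 1) (norm k (mbar k d) (n + 1) z) =
      normL k (Fin d) (n + 1) (thetaBar k d (n + 1) z) :=
  map_geom_sum _ _ _ (thetaBar_cyc n) _ z

theorem var_normL {X : Type*} (m : ℕ) (v : WordMod k X) :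
    wlin k (varWord k) (normL k X m v) = normL k X m (wlin k (varWord k) v) :=
  map_geom_sum _ _ _ var_cycL _ v

variable {w : ℕ}

/-! ### The bicomplex operators acting on words -/

/-- An element of the family as a combination of words. -/
def wordOf (w q : ℕ) : (weightFamily k d w).sub q →ₗ[k] WordMod k (Fin d) :=
  theta k d (q + 1) ∘ₗ Submodule.subtype _

theorem wordOf_injective (w q : ℕ) : Function.Injective (wordOf (k := k) (d := d) w q) :=
  (theta_injective k d (q + 1)).comp Subtype.val_injective

theorem wordOf_mem (q : ℕ) (x : (weightFamily k d w).sub q) :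
    wordOf w q x ∈ wordSub k (Fin d) w (q + 1) :=
  (thetaEquiv k d w q x).2

theorem wordOf_vert_even {p : ℕ} (hp : Even p) (q : ℕ) (x : (weightFamily k d w).sub (q + 1)) :
    wordOf w q ((weightFamily k d w).vert p q x) = wlin k (hochWord k) (wordOf w (q + 1) x) := by
  rw [StableFamily.vert, if_pos hp]
  exact theta_hochD q x.1

theorem wordOf_vert_odd {p : ℕ} (hp : ¬ Even p) (q : ℕ) (x : (weightFamily k d w).sub (q + 1)) :
    wordOf w q ((weightFamily k d w).vert p q x) = wlin k (barWord k) (wordOf w (q + 1) x) := by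
  rw [StableFamily.vert, if_neg hp]
  exact theta_barD q x.1

theorem wordOf_horiz_even {p : ℕ} (hp : Even p) (q : ℕ) (x : (weightFamily k d w).sub q) :
    wordOf w q ((weightFamily k d w).horiz p q x) = wordOf w q x - cycL k (wordOf w q x) := by
  rw [StableFamily.horiz, if_pos hp]
  refine (map_sub (theta k d (q + 1)) _ _).trans ?_
  rw [theta_cyc]
  rfl

theorem wordOf_horiz_odd {p : ℕ} (hp : ¬ Even p) (q : ℕ) (x : (weightFamily k d w).sub q) :
    wordOf w q ((weightFamily k d w).horiz p q x) = normL k (Fin d) (q + 1) (wordOf w q x) := by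
  rw [StableFamily.horiz, if_neg hp]
  exact theta_norm q x.1

theorem hoch_eq_zero_of_mem {X : Type*} {v : WordMod k X} (hv : v ∈ wordSub k X w 1) :
    wlin k (hochWord k) v = 0 :=
  eq_of_mem_wordSub _ 0 (fun l h1 _ => by
    obtain ⟨a, rfl⟩ := List.length_eq_one_iff.1 h1
    simp [hochWord, barWord, headMulWord]) hv

theorem bar_eq_zero_of_mem {X : Type*} {v : WordMod k X} (hv : v ∈ wordSub k X w 1) :
    wlin k (barWord k) v = 0 :=
  eq_of_mem_wordSub _ 0 (fun l h1 _ => by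
    obtain ⟨a, rfl⟩ := List.length_eq_one_iff.1 h1
    simp [barWord]) hv

/-- The homotopy of the even columns. -/
def evenHtpy (w q : ℕ) : (weightFamily k d w).sub q →ₗ[k] (weightFamily k d w).sub (q + 1) :=
  liftOp (wlin k (htpyWord k)) fun _ hv => htpy_mem hv

/-- The homotopy of the odd columns. -/
def oddHtpy (w q : ℕ) : (weightFamily k d w).sub q →ₗ[k] (weightFamily k d w).sub (q + 1) :=
  liftOp (consL k none) fun _ hv => consL_none_mem hv

/-- The projection to the nondegenerate words. -/
def nondegProj (w q : ℕ) : (weightFamily k d w).sub q →ₗ[k] (weightFamily k d w).sub q :=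
  liftOp (wlin k (nondegWord k)) fun _ hv => nondeg_mem hv

theorem wordOf_evenHtpy (q : ℕ) (x : (weightFamily k d w).sub q) :
    wordOf w (q + 1) (evenHtpy w q x) = wlin k (htpyWord k) (wordOf w q x) :=
  theta_liftOp _ _ x

theorem wordOf_oddHtpy (q : ℕ) (x : (weightFamily k d w).sub q) :
    wordOf w (q + 1) (oddHtpy w q x) = consL k none (wordOf w q x) :=
  theta_liftOp _ _ x

theorem wordOf_nondegProj (q : ℕ) (x : (weightFamily k d w).sub q) :
    wordOf w q (nondegProj w q x) = wlin k (nondegWord k) (wordOf w q x) :=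
  theta_liftOp _ _ x

variable (k d) in
/-- The homotopies of the columns of the bicomplex. -/
def colHtpy (w : ℕ) : (weightFamily k d w).ColumnHomotopy where
  h p q := if Even p then evenHtpy w q else oddHtpy w q
  π p q := if Even p then nondegProj w q else 0
  zero p x := by
    apply wordOf_injective
    split_ifs with hp
    · have h := hoch_htpy_add (wordOf w 0 x)
      rw [hoch_eq_zero_of_mem (wordOf_mem 0 x), map_zero, add_zero] at h
      rw [wordOf_vert_even hp, wordOf_evenHtpy, map_sub, wordOf_nondegProj, h]
    · have h := bar_cons_none (wordOf w 0 x) (apply_nil_eq_zero (wordOf_mem 0 x))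
      rw [bar_eq_zero_of_mem (wordOf_mem 0 x), map_zero, add_zero] at h
      rw [wordOf_vert_odd hp, wordOf_oddHtpy, h, LinearMap.zero_apply, sub_zero]
  succ p q x := by
    apply wordOf_injective
    split_ifs with hp
    · rw [map_add, map_sub, wordOf_vert_even hp, wordOf_evenHtpy, wordOf_evenHtpy,
        wordOf_vert_even hp, wordOf_nondegProj, hoch_htpy_add]
    · rw [map_add, wordOf_vert_odd hp, wordOf_oddHtpy, wordOf_oddHtpy,
        wordOf_vert_odd hp, LinearMap.zero_apply, sub_zero,
        bar_cons_none _ (apply_nil_eq_zero (wordOf_mem _ x))]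

theorem colHtpy_π_even {p : ℕ} (hp : Even p) (q : ℕ) (x : (weightFamily k d w).sub q) :
    (colHtpy k d w).π p q x = 0 ↔ wlin k (nondegWord k) (wordOf w q x) = 0 := by
  have e : (colHtpy k d w).π p q x = nondegProj w q x := by
    simp [colHtpy, hp]
  rw [e, ← wordOf_nondegProj, map_eq_zero_iff _ (wordOf_injective w q)]

theorem colHtpy_π_odd {p : ℕ} (hp : ¬ Even p) (q : ℕ) (x : (weightFamily k d w).sub q) :
    (colHtpy k d w).π p q x = 0 := by
  simp [colHtpy, hp]

/-- Inherited from the tensor complex. In rows $0$ and $1$ one of the two applications is to a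
combination of one-letter words, on which `hochWord` vanishes. -/
theorem hoch_hoch (q : ℕ) (x : (weightFamily k d w).sub q) :
    wlin k (hochWord k) (wlin k (hochWord k) (wordOf w q x)) = 0 := by
  rcases q with _ | _ | q
  · rw [hoch_eq_zero_of_mem (wordOf_mem 0 x), map_zero]
  · rw [← wordOf_vert_even (p := 0) (by simp), hoch_eq_zero_of_mem (wordOf_mem 0 _)]
  · rw [← wordOf_vert_even (p := 0) (by simp), ← wordOf_vert_even (p := 0) (by simp)]
    have := LinearMap.congr_fun ((weightFamily k d w).vert_comp 0 q) x
    rw [LinearMap.comp_apply] at this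
    rw [this]
    exact map_zero _

theorem retract_even_wordOf (q : ℕ) (x : (weightFamily k d w).sub q) :
    wlin k (varWord k) (wlin k (hochWord k) (wordOf w q x)) +
        wlin k (stripWord k) (wlin k (hochWord k) (wordOf w q x)) =
      wlin k (stripWord k) (wordOf w q x) - cycL k (wlin k (stripWord k) (wordOf w q x)) := by
  refine retract_even ?_ (hoch_hoch q x)
  rw [← wordOf_evenHtpy]
  exact hoch_hoch _ _

end WeightFamily

end

end CyclicHomology

namespace CyclicHomology

noncomputable section

open scoped TensorProduct

/-! ### The homotopies annihilate the nondegenerate part -/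

section Nondegenerate

variable {k : Type*} [CommRing k] {X : Type*}

theorem nondeg_consL (a : Option X) (v : WordMod k X) :
    wlin k (nondegWord k) (consL k a v) = consL k a (wlin k (varWord k) v) :=
  wlin_congr (f := wlin k (nondegWord k) ∘ₗ consL k a) (g := consL k a ∘ₗ wlin k (varWord k))
    (fun l => by
      classical
      simp only [LinearMap.comp_apply, consL_wd, wlin_wd, nondegWord, varWord]
      split_ifs <;> simp) v

/-- Every word produced by the homotopy contains a doubled unit. -/
theorem var_tailHtpyWord (l : Word X) : wlin k (varWord k) (tailHtpyWord k l) = 0 := by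
  induction l with
  | nil => simp [tailHtpyWord]
  | cons a l ih =>
    rcases a with _ | x
    · rw [tailHtpyWord, doubleWord, map_sub, var_consL_none, sub_zero, ← consL_wd, var_consL_none]
    · rw [tailHtpyWord, map_neg, var_consL_some, ih, map_zero, neg_zero]

theorem nondeg_htpy (v : WordMod k X) :
    wlin k (nondegWord k) (wlin k (htpyWord k) v) = 0 :=
  wlin_congr (f := wlin k (nondegWord k) ∘ₗ wlin k (htpyWord k)) (g := 0)
    (fun l => by
      rcases l with _ | ⟨a, l⟩
      · simp [htpyWord]
      · rw [LinearMap.comp_apply, wlin_wd, htpyWord, nondeg_consL, var_tailHtpyWord, map_zero]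
        rfl) v

/-- This side condition makes the total homotopy land in the kernel of `retr`, see `retr_total`. -/
theorem retract_htpy (v : WordMod k X) :
    wlin k (varWord k) (wlin k (htpyWord k) v) + wlin k (stripWord k) (wlin k (htpyWord k) v) =
      0 := by
  rw [← retract_nondeg, nondeg_htpy, map_zero, map_zero, add_zero]

end Nondegenerate

/-! ### Positive weight -/

section PositiveWeight

variable {k : Type u} [CommRing k] {d : ℕ} {w : ℕ}

open StableFamily

/-- The retraction of the total complex to words of variables. -/
def retr (w n : ℕ) : (weightFamily k d w).tot.X n →ₗ[k] WordMod k (Fin d) :=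
  (weightFamily k d w).desc fun p q _ =>
    (if Even p then wlin k (varWord k) + wlin k (stripWord k) else wlin k (varWord k)) ∘ₗ
      wordOf w q

theorem retr_incl_even {p : ℕ} (hp : Even p) (q n : ℕ) (h : p + q = n)
    (x : (weightFamily k d w).sub q) :
    retr w n ((weightFamily k d w).incl p q n h x) =
      wlin k (varWord k) (wordOf w q x) + wlin k (stripWord k) (wordOf w q x) := by
  rw [retr, desc_incl, if_pos hp]
  rfl

theorem retr_incl_odd {p : ℕ} (hp : ¬ Even p) (q n : ℕ) (h : p + q = n)
    (x : (weightFamily k d w).sub q) :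
    retr w n ((weightFamily k d w).incl p q n h x) = wlin k (varWord k) (wordOf w q x) := by
  rw [retr, desc_incl, if_neg hp]
  rfl

theorem retr_vertPart_even {p : ℕ} (hp : Even p) (q n : ℕ) (h : p + q = n + 1)
    (x : (weightFamily k d w).sub q) :
    retr w n (vertPart p q n h x) =
      wlin k (stripWord k) (wordOf w q x) - cycL k (wlin k (stripWord k) (wordOf w q x)) := by
  rw [← retract_even_wordOf]
  rcases q with _ | q
  · simp [vertPart, hoch_eq_zero_of_mem (wordOf_mem 0 x)]
  · rw [vertPart, LinearMap.comp_apply, retr_incl_even hp, wordOf_vert_even hp]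

theorem retr_vertPart_odd {p : ℕ} (hp : ¬ Even p) (q n : ℕ) (h : p + q = n + 1)
    (x : (weightFamily k d w).sub q) :
    retr w n (vertPart p q n h x) = wlin k (varWord k) (wlin k (barWord k) (wordOf w q x)) := by
  rcases q with _ | q
  · simp [vertPart, bar_eq_zero_of_mem (wordOf_mem 0 x)]
  · rw [vertPart, LinearMap.comp_apply, retr_incl_odd hp, wordOf_vert_odd hp]

theorem retr_totD_zero (q n : ℕ) (h : 0 + q = n + 1) (x : (weightFamily k d w).sub q) :
    retr w n ((weightFamily k d w).totD n ((weightFamily k d w).incl 0 q (n + 1) h x)) =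
      wlin k (stripWord k) (wordOf w q x) - cycL k (wlin k (stripWord k) (wordOf w q x)) := by
  rw [totD_incl, map_add, map_smul, retr_vertPart_even (by simp), horizPart]
  simp

theorem retr_totD_odd {p : ℕ} (hp : Even p) (q n : ℕ) (h : p + 1 + q = n + 1)
    (x : (weightFamily k d w).sub q) :
    retr w n ((weightFamily k d w).totD n ((weightFamily k d w).incl (p + 1) q (n + 1) h x)) =
      wlin k (varWord k) (wordOf w q x) - cycL k (wlin k (varWord k) (wordOf w q x)) := by
  rw [totD_incl, map_add, map_smul, retr_vertPart_odd (by simpa [Nat.even_add_one] using hp),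
    horizPart, LinearMap.comp_apply, retr_incl_even hp, wordOf_horiz_even hp,
    hp.add_one.neg_one_pow, neg_one_smul, ← sub_eq_add_neg, retract_odd]

theorem retr_totD_even {p : ℕ} (hp : ¬ Even p) (q n : ℕ) (h : p + 1 + q = n + 1)
    (x : (weightFamily k d w).sub q) :
    retr w n ((weightFamily k d w).totD n ((weightFamily k d w).incl (p + 1) q (n + 1) h x)) =
      normL k (Fin d) (q + 1) (wlin k (varWord k) (wordOf w q x)) +
        (wlin k (stripWord k) (wordOf w q x) -
          cycL k (wlin k (stripWord k) (wordOf w q x))) := by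
  have hp' : Even (p + 1) := by rwa [Nat.even_add_one]
  rw [totD_incl, map_add, map_smul, retr_vertPart_even hp',
    horizPart, LinearMap.comp_apply, retr_incl_odd hp, wordOf_horiz_odd hp,
    hp'.neg_one_pow, one_smul, var_normL]

variable (k) in
/-- The differentials of the periodic complex of words. -/
def perWord (X : Type*) (w m : ℕ) : WordMod k X →ₗ[k] WordMod k X :=
  if Even m then LinearMap.id - cycL k else normL k X w

/-- For reasons of length `varWord` sees only row $v$ and `stripWord` only row $v+1$. So in degree
$v+m$ the retraction sees column $m$ and, for odd $m$, also column $m-1$. Column by column, the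
claim is `retract_even`, `retract_odd` or the compatibility of `varWord` with the norm. -/
theorem retr_totD (v m : ℕ) (z : (weightFamily k d (v + 1)).tot.X (v + m + 1)) :
    retr (v + 1) (v + m) ((weightFamily k d (v + 1)).totD (v + m) z) =
      perWord k (Fin d) (v + 1) m (retr (v + 1) (v + m + 1) z) := by
  have h : retr (v + 1) (v + m) ∘ₗ (weightFamily k d (v + 1)).totD (v + m) =
      perWord k (Fin d) (v + 1) m ∘ₗ retr (v + 1) (v + m + 1) := by
    apply tot_ext
    intro p q hn x
    have hx := wordOf_mem q x
    have hv : q ≠ v → wlin k (varWord k) (wordOf (v + 1) q x) = 0 := fun h =>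
      var_eq_zero (by omega) hx
    have hs : q ≠ v + 1 → wlin k (stripWord k) (wordOf (v + 1) q x) = 0 := fun h =>
      strip_eq_zero (by omega) hx
    rw [LinearMap.comp_apply, LinearMap.comp_apply]
    rcases p with _ | p
    · rw [retr_totD_zero, retr_incl_even (by simp), hv (by omega), zero_add]
      by_cases hq : q = v + 1
      · obtain rfl : m = 0 := by omega
        simp [perWord]
      · simp [hs hq]
    · by_cases hp : Even p
      · rw [retr_totD_odd hp, retr_incl_odd (by simpa [Nat.even_add_one] using hp)]
        by_cases hq : q = v
        · obtain rfl : m = p := by omega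
          simp [perWord, hp]
        · simp [hv hq]
      · rw [retr_totD_even hp, retr_incl_even (by simpa [Nat.even_add_one] using hp)]
        by_cases hq : q = v
        · obtain rfl : m = p := by omega
          subst hq
          rw [hs (by omega)]
          simp [perWord, hp]
        · rw [hv hq]
          by_cases hq' : q = v + 1
          · obtain rfl : m = p + 1 := by omega
            simp [perWord, Nat.even_add_one, hp]
          · simp [hs hq']
  exact LinearMap.congr_fun h z

theorem retr_total (n : ℕ) (z : (weightFamily k d w).tot.X n) :
    retr w (n + 1) ((colHtpy k d w).total n z) = 0 := by
  have h : retr w (n + 1) ∘ₗ (colHtpy k d w).total n = 0 := by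
    apply tot_ext
    intro p q hn x
    rw [LinearMap.comp_apply, ColumnHomotopy.total_incl, map_smul, LinearMap.zero_apply]
    by_cases hp : Even p
    · have e : (colHtpy k d w).h p q = evenHtpy w q := by simp [colHtpy, hp]
      rw [retr_incl_even hp, e, wordOf_evenHtpy, retract_htpy, smul_zero]
    · have e : (colHtpy k d w).h p q = oddHtpy w q := by simp [colHtpy, hp]
      rw [retr_incl_odd hp, e, wordOf_oddHtpy, var_consL_none, smul_zero]
  exact LinearMap.congr_fun h z

theorem retr_mem (v n : ℕ) (z : (weightFamily k d (v + 1)).tot.X n) :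
    retr (v + 1) n z ∈ wordSub k (Fin d) (v + 1) (v + 1) := by
  have h : Submodule.mkQ (wordSub k (Fin d) (v + 1) (v + 1)) ∘ₗ retr (v + 1) n = 0 := by
    apply tot_ext
    intro p q hn x
    rw [LinearMap.comp_apply, LinearMap.zero_apply, Submodule.mkQ_apply,
      Submodule.Quotient.mk_eq_zero]
    have hx := wordOf_mem q x
    have hv : wlin k (varWord k) (wordOf (v + 1) q x) ∈ wordSub k (Fin d) (v + 1) (v + 1) := by
      by_cases hq : q = v
      · subst hq
        rwa [var_of_mem hx]
      · rw [var_eq_zero (by omega) hx]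
        exact Submodule.zero_mem _
    have hs : wlin k (stripWord k) (wordOf (v + 1) q x) ∈ wordSub k (Fin d) (v + 1) (v + 1) := by
      by_cases hq : q = v + 1
      · subst hq
        exact strip_mem hx
      · rw [strip_eq_zero (by omega) hx]
        exact Submodule.zero_mem _
    by_cases hp : Even p
    · rw [retr_incl_even hp]
      exact Submodule.add_mem _ hv hs
    · rwa [retr_incl_odd hp]
  rw [← Submodule.Quotient.mk_eq_zero]
  exact LinearMap.congr_fun h z

/-- Moving left raises the row. Odd columns left of $p$ have rows at least $v+1$, out of reach of
`varWord`. Even ones are two or more steps away, in rows at least $v+2$, out of reach of `stripWord`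
too. -/
theorem retr_of_mem_fil {v p q n : ℕ} (hp : Even p) (hn : p + q = n) (hq : v ≤ q)
    {z : (weightFamily k d (v + 1)).tot.X n} (hz : z ∈ (weightFamily k d (v + 1)).fil n p) :
    retr (v + 1) n z = 0 := by
  have : (weightFamily k d (v + 1)).fil n p ≤ LinearMap.ker (retr (v + 1) n) := by
    refine fil_le fun p' q' hn' hp' x => ?_
    have hx := wordOf_mem q' x
    rw [LinearMap.mem_ker]
    by_cases he : Even p'
    · have : p' + 1 ≠ p := by
        rintro rfl
        rw [Nat.even_add_one] at hp
        exact hp he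
      rw [retr_incl_even he, var_eq_zero (by omega) hx, strip_eq_zero (by omega) hx, add_zero]
    · rw [retr_incl_odd he, var_eq_zero (by omega) hx]
  exact this hz

/-- In an even column with $q\ge v$, `retr` sees only the leading term, so the components of $x$
under `varWord` and `stripWord` vanish, and these determine its nondegenerate part. For $q<v$ there
are no nondegenerate words. -/
theorem π_eq_zero_of_retr_eq_zero {v n : ℕ} {z : (weightFamily k d (v + 1)).tot.X n}
    (hz : retr (v + 1) n z = 0) (p q : ℕ) (hn : p + q = n) (x : (weightFamily k d (v + 1)).sub q)
    (h : z - (weightFamily k d (v + 1)).incl p q n hn x ∈ (weightFamily k d (v + 1)).fil n p) :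
    (colHtpy k d (v + 1)).π p q x = 0 := by
  by_cases hp : Even p
  · rw [colHtpy_π_even hp]
    have hx := wordOf_mem q x
    by_cases hq : v ≤ q
    · have h0 := retr_of_mem_fil hp hn hq h
      rw [map_sub, hz, zero_sub, neg_eq_zero, retr_incl_even hp] at h0
      obtain rfl | hq' := eq_or_lt_of_le hq
      · rw [strip_eq_zero (by omega) hx, add_zero, var_of_mem hx] at h0
        rw [h0, map_zero]
      · rw [var_eq_zero (by omega) hx, zero_add] at h0
        by_cases hq2 : q = v + 1
        · subst hq2
          rw [nondeg_eq_consL_strip hx, h0, map_zero]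
        · exact nondeg_eq_zero (by omega) (by omega) hx
    · exact nondeg_eq_zero (by omega) (by omega) hx
  · exact colHtpy_π_odd hp q x

/-- The kernel of `retr` satisfies the criterion `exists_totD_eq`: it contains each $DHy$, since
`retr` commutes with the differentials and kills $Hy$. -/
theorem exists_totD_eq_of_retr_eq_zero {v m : ℕ} {z : (weightFamily k d (v + 1)).tot.X (v + m)}
    (hz : retr (v + 1) (v + m) z = 0) (hc : z ∈ (weightFamily k d (v + 1)).totCycles (v + m)) :
    ∃ y, (weightFamily k d (v + 1)).totD (v + m) y = z := by
  obtain ⟨y, -, hy⟩ := (colHtpy k d (v + 1)).exists_totD_eq (LinearMap.ker (retr (v + 1) (v + m)))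
    (fun y => by rw [LinearMap.mem_ker, retr_totD, retr_total, map_zero])
    (fun z hz p q hn x h => π_eq_zero_of_retr_eq_zero hz p q hn x h) (p := v + m + 1) hz hc
    (by rw [fil_top]; trivial)
  exact ⟨y, hy⟩

/-! #### Comparison with the periodic complex of tensors -/

theorem thetaBar_mem (n : ℕ) (y : ⨂[k]^n (mbar k d)) :
    thetaBar k d n y ∈ wordSub k (Fin d) n n := by
  have h : Submodule.mkQ (wordSub k (Fin d) n n) ∘ₗ thetaBar k d n = 0 := by
    apply tensorBar_ext
    intro f
    rw [LinearMap.comp_apply, LinearMap.zero_apply, Submodule.mkQ_apply,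
      Submodule.Quotient.mk_eq_zero, thetaBar_mvar]
    refine wd_mem_wordSub (by simp) ?_
    rw [wtWord_ofFn]
    simp [wt]
  rw [← Submodule.Quotient.mk_eq_zero]
  exact LinearMap.congr_fun h y

theorem exists_thetaBar_eq {n : ℕ} {v : WordMod k (Fin d)} (hv : v ∈ wordSub k (Fin d) n n) :
    ∃ y, thetaBar k d n y = v := by
  refine mem_of_mem_wordSub LinearMap.id (LinearMap.range (thetaBar k d n)) (fun l h1 h2 => ?_) hv
  have h : none ∉ l := by
    rw [none_mem_iff, h1, h2]
    simp
  have hs (i : Fin l.length) : ∃ x, l.get i = some x :=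
    Option.ne_none_iff_exists'.1 fun e => h (e ▸ List.get_mem l i)
  choose f hf using hs
  subst h1
  refine ⟨PiTensorProduct.tprod k fun i => mvar k d (f i), ?_⟩
  rw [thetaBar_mvar, LinearMap.id_apply]
  simp only [← hf]
  rw [List.ofFn_get]

variable (k d) in
/-- The inclusion of `(𝔪 / 𝔪²)^{⊗ v+1}` in the part of weight `v + 1` of `A^{⊗ v+1}`. -/
def ofBar (v : ℕ) : ⨂[k]^(v + 1) (mbar k d) →ₗ[k] (weightFamily k d (v + 1)).sub v :=
  (thetaEquiv k d (v + 1) v).symm.toLinearMap ∘ₗ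
    (thetaBar k d (v + 1)).codRestrict _ (thetaBar_mem (v + 1))

theorem wordOf_ofBar (v : ℕ) (y : ⨂[k]^(v + 1) (mbar k d)) :
    wordOf (v + 1) v (ofBar k d v y) = thetaBar k d (v + 1) y := by
  have := coe_thetaEquiv (v + 1) v (ofBar k d v y)
  exact this.symm.trans (congrArg Subtype.val ((thetaEquiv k d (v + 1) v).apply_symm_apply _))

/-- The differentials of the periodic complex computing the homology of a cyclic group. -/
def perD (k : Type u) [CommRing k] (M : Type u) [AddCommGroup M] [Module k M] (w m : ℕ) :
    Module.End k (⨂[k]^w M) :=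
  if Even m then 1 - cyc k M w else norm k M w

theorem thetaBar_perD (v m : ℕ) (y : ⨂[k]^(v + 1) (mbar k d)) :
    thetaBar k d (v + 1) (perD k (mbar k d) (v + 1) m y) =
      perWord k (Fin d) (v + 1) m (thetaBar k d (v + 1) y) := by
  rw [perD, perWord]
  split_ifs
  · rw [LinearMap.sub_apply, LinearMap.sub_apply, map_sub, thetaBar_cyc]
    rfl
  · exact thetaBar_norm v y

theorem horiz_ofBar (v m : ℕ) (y : ⨂[k]^(v + 1) (mbar k d)) :
    (weightFamily k d (v + 1)).horiz m v (ofBar k d v y) =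
      ofBar k d v (perD k (mbar k d) (v + 1) m y) := by
  apply wordOf_injective
  rw [wordOf_ofBar, thetaBar_perD, perWord]
  split_ifs with hm
  · rw [wordOf_horiz_even hm, wordOf_ofBar]
    rfl
  · rw [wordOf_horiz_odd hm, wordOf_ofBar]

theorem eq_zero_of_lt {q : ℕ} (h : q + 1 < w) (x : (weightFamily k d w).sub q) : x = 0 := by
  apply wordOf_injective
  rw [map_zero]
  exact eq_zero_of_mem_of_lt h (wordOf_mem q x)

/-- Row $v$ is the lowest row that can be nonzero in weight $v+1$, since shorter words have smaller
weight. -/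
theorem vertPart_eq_zero (v p n : ℕ) (h : p + v = n + 1) (x : (weightFamily k d (v + 1)).sub v) :
    vertPart p v n h x = 0 := by
  rcases v with _ | v
  · rfl
  · rw [vertPart, LinearMap.comp_apply, eq_zero_of_lt (by omega) (vert _ p v x), map_zero]

variable (k d) in
/-- The inclusion of the periodic complex in the total complex. -/
def toTot (v m : ℕ) : ⨂[k]^(v + 1) (mbar k d) →ₗ[k] (weightFamily k d (v + 1)).tot.X (v + m) :=
  (weightFamily k d (v + 1)).incl m v (v + m) (add_comm _ _) ∘ₗ ofBar k d v

theorem totD_toTot (v m : ℕ) (y : ⨂[k]^(v + 1) (mbar k d)) :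
    (weightFamily k d (v + 1)).totD (v + m) (toTot k d v (m + 1) y) =
      toTot k d v m (perD k (mbar k d) (v + 1) m y) := by
  have := totD_incl (F := weightFamily k d (v + 1)) (v + m) (m + 1) v (by omega) (ofBar k d v y)
  refine this.trans ?_
  rw [vertPart_eq_zero, smul_zero, add_zero, horizPart, LinearMap.comp_apply, horiz_ofBar]
  rfl

theorem retr_toTot (v m : ℕ) (y : ⨂[k]^(v + 1) (mbar k d)) :
    retr (v + 1) (v + m) (toTot k d v m y) = thetaBar k d (v + 1) y := by
  have hy := thetaBar_mem (v + 1) y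
  rw [toTot, LinearMap.comp_apply]
  by_cases hm : Even m
  · rw [retr_incl_even hm, wordOf_ofBar, var_of_mem hy, strip_eq_zero (by omega) hy, add_zero]
  · rw [retr_incl_odd hm, wordOf_ofBar, var_of_mem hy]

/-- The cycles of the periodic complex. -/
def perCycles (k : Type u) [CommRing k] (M : Type u) [AddCommGroup M] [Module k M] (w : ℕ) :
    ℕ → Submodule k (⨂[k]^w M)
  | 0 => ⊤
  | m + 1 => LinearMap.ker (perD k M w m)

theorem toTot_mem_totCycles {v m : ℕ} {y : ⨂[k]^(v + 1) (mbar k d)}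
    (hy : y ∈ perCycles k (mbar k d) (v + 1) m) :
    toTot k d v m y ∈ (weightFamily k d (v + 1)).totCycles (v + m) := by
  rcases m with _ | m
  · rcases v with _ | v
    · exact Submodule.mem_top
    · rw [totCycles, LinearMap.mem_ker, toTot, LinearMap.comp_apply]
      refine (totD_incl (F := weightFamily k d (v + 2)) v 0 (v + 1) (by omega) _).trans ?_
      rw [vertPart_eq_zero, smul_zero, add_zero, horizPart]
      rfl
  · have := totD_toTot v m y
    rw [show perD k (mbar k d) (v + 1) m y = 0 from hy, map_zero] at this
    exact this

theorem mem_perCycles_of_mem_totCycles {v m : ℕ} {z : (weightFamily k d (v + 1)).tot.X (v + m)}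
    (hz : z ∈ (weightFamily k d (v + 1)).totCycles (v + m)) {y : ⨂[k]^(v + 1) (mbar k d)}
    (hy : thetaBar k d (v + 1) y = retr (v + 1) (v + m) z) :
    y ∈ perCycles k (mbar k d) (v + 1) m := by
  rcases m with _ | m
  · exact Submodule.mem_top
  · rw [perCycles, LinearMap.mem_ker]
    apply thetaBar_injective
    rw [thetaBar_perD, hy, map_zero]
    refine (retr_totD v m z).symm.trans ?_
    rw [show (weightFamily k d (v + 1)).totD (v + m) z = 0 from hz, map_zero]

/-- The cyclic homology in positive weight is the homology of the periodic complex. -/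
theorem weightHC_iso_of_pos (v m : ℕ) :
    Nonempty (weightHC k d (v + 1) (v + m) ≅ ModuleCat.of k
      (Subquotient (perCycles k (mbar k d) (v + 1) m)
        (LinearMap.range (perD k (mbar k d) (v + 1) m)))) := by
  obtain ⟨e⟩ := (weightFamily k d (v + 1)).HC_iso (v + m)
  have h := subquotient_equiv (Z := perCycles k (mbar k d) (v + 1) m)
    (B := LinearMap.range (perD k (mbar k d) (v + 1) m))
    (Z' := (weightFamily k d (v + 1)).totCycles (v + m))
    (B' := LinearMap.range ((weightFamily k d (v + 1)).totD (v + m)))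
    (toTot k d v m) (fun y hy => toTot_mem_totCycles hy)
    (fun y _ => by
      constructor
      -- If `toTot` sends $y$ to $Dz$, applying `retr` exhibits $y$ as the boundary of the tensor
      -- corresponding to the retraction of $z$.
      · rintro ⟨z, hz⟩
        obtain ⟨u, hu⟩ := exists_thetaBar_eq (retr_mem v _ z)
        refine ⟨u, thetaBar_injective k d _ ?_⟩
        rw [thetaBar_perD, hu, ← retr_toTot v m y, ← hz]
        exact (retr_totD v m z).symm
      · rintro ⟨u, rfl⟩
        exact ⟨toTot k d v (m + 1) u, totD_toTot v m u⟩)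
    (fun z hz => by
      obtain ⟨y, hy⟩ := exists_thetaBar_eq (retr_mem v _ z)
      have hyc := mem_perCycles_of_mem_totCycles hz hy
      -- Subtracting from $z$ the image of its own retraction leaves a cycle in the acyclic kernel.
      obtain ⟨u, hu⟩ := exists_totD_eq_of_retr_eq_zero (z := z - toTot k d v m y)
        (by rw [map_sub, retr_toTot, hy, sub_self])
        (Submodule.sub_mem _ hz (toTot_mem_totCycles hyc))
      exact ⟨y, hyc, u, hu⟩)
  obtain ⟨e'⟩ := h
  exact ⟨e ≪≫ e'.symm.toModuleIso⟩

theorem isZero_weightHC (n : ℕ) (h : n + 2 ≤ w) : Limits.IsZero (weightHC k d w n) := by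
  obtain ⟨e⟩ := (weightFamily k d w).HC_iso n
  refine Limits.IsZero.of_iso ?_ e
  have hs : ∀ z : (weightFamily k d w).tot.X n, z = 0 := by
    intro z
    have : (LinearMap.id : (weightFamily k d w).tot.X n →ₗ[k] _) = 0 := by
      apply tot_ext
      intro p q hn x
      rw [eq_zero_of_lt (by omega) x, map_zero]
      simp
    exact LinearMap.congr_fun this z
  have : Subsingleton ((weightFamily k d w).tot.X n) := ⟨fun a b => by rw [hs a, hs b]⟩
  exact ModuleCat.isZero_of_subsingleton _

end PositiveWeight

end

end CyclicHomology

namespace CyclicHomology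

noncomputable section

open scoped TensorProduct

/-! ### Weight zero -/

section WeightZero

variable {k : Type u} [CommRing k] {d : ℕ}

open StableFamily

variable (k) in
/-- The coefficient of the word consisting of one unit. -/
def unitCoeff (X : Type*) : WordMod k X →ₗ[k] k := Finsupp.lapply [none]

theorem unitCoeff_eq_zero {X : Type*} {w n : ℕ} (hn : n ≠ 1) {v : WordMod k X}
    (hv : v ∈ wordSub k X w n) : unitCoeff k X v = 0 :=
  eq_of_mem_wordSub _ 0 (fun l h1 _ => by
    classical
    rw [unitCoeff, Finsupp.lapply_apply, wd, Finsupp.single_apply, if_neg]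
    · rfl
    · rintro rfl
      exact hn h1.symm) hv

theorem eq_unitCoeff_smul {X : Type*} {v : WordMod k X} (hv : v ∈ wordSub k X 0 1) :
    v = unitCoeff k X v • wd k [none] :=
  eq_of_mem_wordSub LinearMap.id ((unitCoeff k X).smulRight (wd k [none])) (fun l h1 h2 => by
    obtain ⟨_ | a, rfl⟩ := List.length_eq_one_iff.1 h1
    · simp [unitCoeff, wd]
    · simp at h2) hv

theorem unitCoeff_cycL {X : Type*} {v : WordMod k X} (hv : v ∈ wordSub k X 0 1) :
    unitCoeff k X (cycL k v) = unitCoeff k X v := by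
  rw [eq_unitCoeff_smul hv, map_smul, cycL_wd]
  simp [rotWord]

/-- The two faces of $1\otimes 1$ cancel, so in even columns nothing of weight $0$ in row $0$ is a
vertical boundary. -/
theorem hoch_eq_zero_of_weight_zero {X : Type*} {v : WordMod k X} (hv : v ∈ wordSub k X 0 2) :
    wlin k (hochWord k) v = 0 :=
  eq_of_mem_wordSub _ 0 (fun l h1 h2 => by
    obtain ⟨_ | a, _ | b, rfl⟩ := List.length_eq_two.1 h1
    · simp [hochWord, barWord, headMulWord, rotWord, mulWord_none_cons]
    · simp at h2
    · simp at h2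
    · simp at h2) hv

/-! ### The coefficient of the unit on the total complex -/

variable (k d) in
/-- The coefficient of the unit in row zero and even columns. -/
def totCoeff (n : ℕ) : (weightFamily k d 0).tot.X n →ₗ[k] k :=
  (weightFamily k d 0).desc fun p q _ =>
    if Even p then unitCoeff k (Fin d) ∘ₗ wordOf 0 q else 0

theorem totCoeff_incl_even {p : ℕ} (hp : Even p) (q n : ℕ) (h : p + q = n)
    (x : (weightFamily k d 0).sub q) :
    totCoeff k d n ((weightFamily k d 0).incl p q n h x) =
      unitCoeff k (Fin d) (wordOf 0 q x) := by
  rw [totCoeff, desc_incl, if_pos hp]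
  rfl

theorem totCoeff_incl_odd {p : ℕ} (hp : ¬ Even p) (q n : ℕ) (h : p + q = n)
    (x : (weightFamily k d 0).sub q) :
    totCoeff k d n ((weightFamily k d 0).incl p q n h x) = 0 := by
  rw [totCoeff, desc_incl, if_neg hp]
  rfl

theorem totCoeff_incl_of_pos {q : ℕ} (hq : q ≠ 0) (p n : ℕ) (h : p + q = n)
    (x : (weightFamily k d 0).sub q) :
    totCoeff k d n ((weightFamily k d 0).incl p q n h x) = 0 := by
  by_cases hp : Even p
  · rw [totCoeff_incl_even hp, unitCoeff_eq_zero (by omega) (wordOf_mem q x)]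
  · exact totCoeff_incl_odd hp q n h x

/-- Only row $0$ matters. There $1-t$ vanishes, and $N$ maps into an odd column, where the
coefficient is zero by definition. -/
theorem totCoeff_horizPart (p q n : ℕ) (h : p + q = n + 1) (x : (weightFamily k d 0).sub q) :
    totCoeff k d n (horizPart p q n h x) = 0 := by
  rcases p with _ | p
  · exact map_zero _
  rw [horizPart, LinearMap.comp_apply]
  by_cases hq : q = 0
  · subst hq
    by_cases hp : Even p
    · rw [totCoeff_incl_even hp, wordOf_horiz_even hp, map_sub, unitCoeff_cycL (wordOf_mem 0 x),
        sub_self]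
    · exact totCoeff_incl_odd hp _ _ _ _
  · exact totCoeff_incl_of_pos hq _ _ _ _

theorem totCoeff_vertPart (p q n : ℕ) (h : p + q = n + 1) (x : (weightFamily k d 0).sub q) :
    totCoeff k d n (vertPart p q n h x) = 0 := by
  rcases q with _ | _ | q
  · exact map_zero _
  · rw [vertPart, LinearMap.comp_apply]
    by_cases hp : Even p
    · rw [totCoeff_incl_even hp, wordOf_vert_even hp,
        hoch_eq_zero_of_weight_zero (wordOf_mem 1 x), map_zero]
    · exact totCoeff_incl_odd hp _ _ _ _
  · exact totCoeff_incl_of_pos (by omega) _ _ _ _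

theorem totCoeff_totD (n : ℕ) (z : (weightFamily k d 0).tot.X (n + 1)) :
    totCoeff k d n ((weightFamily k d 0).totD n z) = 0 := by
  have h : totCoeff k d n ∘ₗ (weightFamily k d 0).totD n = 0 := by
    apply tot_ext
    intro p q hn x
    rw [LinearMap.comp_apply, totD_incl, map_add, map_smul, totCoeff_horizPart,
      totCoeff_vertPart, smul_zero, add_zero]
    rfl
  exact LinearMap.congr_fun h z

theorem totCoeff_of_odd {n : ℕ} (hn : ¬ Even n) (z : (weightFamily k d 0).tot.X n) :
    totCoeff k d n z = 0 := by
  have h : totCoeff k d n = 0 := by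
    apply tot_ext
    intro p q hpq x
    by_cases hq : q = 0
    · obtain rfl : p = n := by omega
      exact totCoeff_incl_odd hn _ _ _ _
    · exact totCoeff_incl_of_pos hq _ _ _ _
  rw [h, LinearMap.zero_apply]

theorem totCoeff_of_mem_fil {n : ℕ} {z : (weightFamily k d 0).tot.X n}
    (hz : z ∈ (weightFamily k d 0).fil n n) : totCoeff k d n z = 0 := by
  have : (weightFamily k d 0).fil n n ≤ LinearMap.ker (totCoeff k d n) :=
    fil_le fun p q hn hp x => totCoeff_incl_of_pos (by omega) _ _ _ _
  exact this hz

/-- The only nondegenerate word of weight $0$ available is the single unit. It lies in row $0$,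
hence in column $n$, which the other columns cannot affect. -/
theorem π_eq_zero_of_totCoeff_eq_zero {n : ℕ} {z : (weightFamily k d 0).tot.X n}
    (hz : totCoeff k d n z = 0) (p q : ℕ) (hn : p + q = n) (x : (weightFamily k d 0).sub q)
    (h : z - (weightFamily k d 0).incl p q n hn x ∈ (weightFamily k d 0).fil n p) :
    (colHtpy k d 0).π p q x = 0 := by
  by_cases hp : Even p
  · rw [colHtpy_π_even hp]
    have hx := wordOf_mem q x
    by_cases hq : q = 0
    · subst hq
      obtain rfl : p = n := hn
      have h0 := totCoeff_of_mem_fil h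
      rw [map_sub, hz, zero_sub, neg_eq_zero, totCoeff_incl_even hp] at h0
      rw [eq_unitCoeff_smul hx, h0, zero_smul, map_zero]
    · exact nondeg_eq_zero (by omega) (by omega) hx
  · exact colHtpy_π_odd hp q x

theorem exists_totD_eq_of_totCoeff_eq_zero {n p : ℕ} {z : (weightFamily k d 0).tot.X n}
    (hz : totCoeff k d n z = 0) (hc : z ∈ (weightFamily k d 0).totCycles n)
    (hp : z ∈ (weightFamily k d 0).fil n p) :
    ∃ y ∈ (weightFamily k d 0).fil (n + 1) p, (weightFamily k d 0).totD n y = z :=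
  (colHtpy k d 0).exists_totD_eq (LinearMap.ker (totCoeff k d n))
    (fun _ => totCoeff_totD n _)
    (fun _ hz p q hn x h => π_eq_zero_of_totCoeff_eq_zero hz p q hn x h) hz hc hp

theorem mem_range_totD_of_totCoeff_eq_zero {n : ℕ} {z : (weightFamily k d 0).tot.X n}
    (hz : totCoeff k d n z = 0) (hc : z ∈ (weightFamily k d 0).totCycles n) :
    z ∈ LinearMap.range ((weightFamily k d 0).totD n) := by
  obtain ⟨y, -, hy⟩ := exists_totD_eq_of_totCoeff_eq_zero (p := n + 1) hz hc
    (by rw [fil_top]; trivial)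
  exact ⟨y, hy⟩

/-- The unit in column $n$, row $0$, need not be a cycle, but it can be corrected to one by a chain
in smaller columns, hence in positive rows, without changing its coefficient. -/
theorem exists_totCoeff_eq_one {n : ℕ} (hn : Even n) :
    ∃ z ∈ (weightFamily k d 0).totCycles n, totCoeff k d n z = 1 := by
  obtain ⟨x, hx⟩ : ∃ x : (weightFamily k d 0).sub 0, wordOf 0 0 x = wd k [none] :=
    ⟨(thetaEquiv k d 0 0).symm ⟨wd k [none], wd_mem_wordSub rfl rfl⟩,
      congrArg Subtype.val ((thetaEquiv k d 0 0).apply_symm_apply _)⟩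
  have h1 : totCoeff k d n ((weightFamily k d 0).incl n 0 n rfl x) = 1 := by
    rw [totCoeff_incl_even hn, hx]
    simp [unitCoeff, wd]
  rcases n with _ | n
  · exact ⟨_, Submodule.mem_top, h1⟩
  -- The boundary of the unit is a cycle of coefficient zero in columns at most $n$, so it bounds a
  -- chain $y$ in the same columns.
  · obtain ⟨y, hy, hyd⟩ := exists_totD_eq_of_totCoeff_eq_zero (p := n + 1)
      (totCoeff_totD n ((weightFamily k d 0).incl (n + 1) 0 (n + 1) rfl x))
      (totD_mem_totCycles n _) (by rw [fil_top]; trivial)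
    refine ⟨(weightFamily k d 0).incl (n + 1) 0 (n + 1) rfl x - y, ?_, ?_⟩
    · rw [totCycles, LinearMap.mem_ker, map_sub, hyd, sub_self]
    · rw [map_sub, h1, totCoeff_of_mem_fil hy, sub_zero]

theorem weightHC_zero_iso {n : ℕ} (hn : Even n) :
    Nonempty (weightHC k d 0 n ≅ ModuleCat.of k k) := by
  obtain ⟨e⟩ := (weightFamily k d 0).HC_iso n
  obtain ⟨z, hz, hz1⟩ := exists_totCoeff_eq_one (k := k) (d := d) hn
  obtain ⟨e'⟩ := subquotient_equiv (Z := (weightFamily k d 0).totCycles n)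
    (B := LinearMap.range ((weightFamily k d 0).totD n)) (Z' := (⊤ : Submodule k k)) (B' := ⊥)
    (totCoeff k d n) (fun _ _ => Submodule.mem_top)
    (fun y hy => by
      rw [Submodule.mem_bot]
      constructor
      · exact fun h => mem_range_totD_of_totCoeff_eq_zero h hy
      · rintro ⟨u, rfl⟩
        exact totCoeff_totD n u)
    (fun c _ => ⟨c • z, Submodule.smul_mem _ _ hz, by rw [map_smul, hz1]; simp⟩)
  exact ⟨e ≪≫ (e'.trans ((Submodule.quotEquivOfEqBot _ (by
    rw [Submodule.comap_bot, Submodule.ker_subtype])).trans Submodule.topEquiv)).toModuleIso⟩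

theorem isZero_weightHC_zero {n : ℕ} (hn : ¬ Even n) : Limits.IsZero (weightHC k d 0 n) := by
  obtain ⟨e⟩ := (weightFamily k d 0).HC_iso n
  refine Limits.IsZero.of_iso ?_ e
  have : Subsingleton (Subquotient ((weightFamily k d 0).totCycles n)
      (LinearMap.range ((weightFamily k d 0).totD n))) := by
    rw [Submodule.Quotient.subsingleton_iff, eq_top_iff]
    exact fun z _ => mem_range_totD_of_totCoeff_eq_zero (totCoeff_of_odd hn _) z.2
  exact ModuleCat.isZero_of_subsingleton _

end WeightZero

end

end CyclicHomology

namespace CyclicHomology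

noncomputable section

open scoped TensorProduct

/-! ### Representations as modules over the group ring -/

section GroupRing

variable {k : Type u} [CommRing k] {G : Type u} [CommGroup G]

variable (A : Rep.{u} k G)

instance : (Rep.toModuleMonoidAlgebra.{u} (k := k) (G := G)).Additive where
  map_add := rfl

theorem leftRegular_asAlgebraHom (a x : MonoidAlgebra k G) :
    (Representation.leftRegular k G).asAlgebraHom a x = a * x := by
  induction a using MonoidAlgebra.induction_on with
  | of h =>
    rw [Representation.asAlgebraHom_of]
    induction x using MonoidAlgebra.induction_on with
    | of h' => simp
    | add a b ha hb => rw [map_add, ha, hb, mul_add]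
    | smul c a ha => rw [map_smul, ha, mul_smul_comm]
  | add a b ha hb => rw [map_add, LinearMap.add_apply, ha, hb, add_mul]
  | smul c a ha => rw [map_smul, LinearMap.smul_apply, ha, smul_mul_assoc]

variable (k G) in
/-- The left regular representation as a module over the group ring. -/
abbrev regularModule : ModuleCat.{u} (MonoidAlgebra k G) :=
  Rep.toModuleMonoidAlgebra.obj (Rep.leftRegular k G)

/-- A representation as a module over the group ring. -/
abbrev repModule : ModuleCat.{u} (MonoidAlgebra k G) := Rep.toModuleMonoidAlgebra.obj A

/-- The identity from a representation to the associated module. -/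
def toRepModule : A.V ≃+ repModule A := A.ρ.asModuleEquiv.symm.toAddEquiv

theorem toRepModule_smul (c : k) (y : A.V) :
    toRepModule A (c • y) = algebraMap k (MonoidAlgebra k G) c • toRepModule A y :=
  A.ρ.asModuleEquiv_symm_map_smul c y

variable (k G) in
/-- The module of the left regular representation is free of rank one. -/
def regularEquiv : MonoidAlgebra k G ≃ₗ[MonoidAlgebra k G]
    regularModule k G where
  toFun x := (Representation.leftRegular k G).asModuleEquiv.symm x
  invFun x := (Representation.leftRegular k G).asModuleEquiv x
  left_inv _ := rfl
  right_inv _ := rfl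
  map_add' _ _ := rfl
  map_smul' a x := (leftRegular_asAlgebraHom a x).symm

/-- The isomorphism `k[G] ⊗ A ≅ A` over the group ring. -/
def regularTensorEquiv :
    regularModule k G
      ⊗[MonoidAlgebra k G]
      repModule A
    ≃ₗ[MonoidAlgebra k G]
      repModule A :=
  (TensorProduct.congr (regularEquiv k G).symm (LinearEquiv.refl _ _)).trans
    (TensorProduct.lid _ _)

/-- Moving $a$ across the tensor sign turns multiplication on $k[G]$ into its action on the
representation; this identifies the differentials for Tor. -/
theorem regularEquiv_tmul (a : MonoidAlgebra k G) (y : A.V) :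
    (regularEquiv k G a ⊗ₜ[MonoidAlgebra k G] (toRepModule A y) :
      regularModule k G
        ⊗[MonoidAlgebra k G]
        repModule A) =
    regularEquiv k G 1 ⊗ₜ[MonoidAlgebra k G]
      (toRepModule A (A.ρ.asAlgebraHom a y)) := by
  have h : regularEquiv k G a = a • regularEquiv k G 1 := by
    rw [← map_smul, smul_eq_mul, mul_one]
  rw [h]
  exact TensorProduct.smul_tmul a _ _

end GroupRing

/-! ### Homology of cyclic groups -/

section CyclicGroup

variable {k : Type u} [CommRing k] {G : Type u} [CommGroup G] [Fintype G]

/-- The differentials `ρ(g) - 1` and `N` of the periodic complex of a representation. -/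
def repD {V : Type*} [AddCommGroup V] [Module k V] (ρ : Representation k G V) (g : G) (m : ℕ) :
    Module.End k V :=
  if Even m then ρ g - 1 else ρ.norm

/-- The cycles of the periodic complex of a representation. -/
def repCycles {V : Type*} [AddCommGroup V] [Module k V] (ρ : Representation k G V) (g : G) :
    ℕ → Submodule k V
  | 0 => ⊤
  | m + 1 => LinearMap.ker (repD ρ g m)

variable (A : Rep.{u} k G) (g : G)

theorem moduleCatChainComplex_d (m : ℕ) :
    ((Rep.FiniteCyclicGroup.moduleCatChainComplex A g).d (m + 1) m).hom = repD A.ρ g m := by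
  have : (ComplexShape.down ℕ).Rel (m + 1) m := rfl
  rw [repD]
  dsimp only [Rep.FiniteCyclicGroup.moduleCatChainComplex, HomologicalComplex.alternatingConst]
  rw [dif_pos this]
  by_cases hm : Even m
  -- The library complex branches on the parity of the source degree $m+1$, `repD` on that of the
  -- target degree $m$.
  · rw [dif_neg (by rwa [Nat.even_add_one, not_not]), if_pos hm]
    rfl
  · rw [dif_pos (by rwa [Nat.even_add_one]), if_neg hm]
    rfl

theorem groupHomology_iso (hg : ∀ x, x ∈ Subgroup.zpowers g) (m : ℕ) :
    Nonempty (groupHomology A m ≅ ModuleCat.of k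
      (Subquotient (repCycles A.ρ g m) (LinearMap.range (repD A.ρ g m)))) := by
  classical
  obtain ⟨e⟩ := homology_iso_subquotient (Rep.FiniteCyclicGroup.moduleCatChainComplex A g) m
    (Z := repCycles A.ρ g m) (B := LinearMap.range (repD A.ρ g m)) (by
      rcases m with _ | m
      · rw [HomologicalComplex.shape _ _ _ (by simp)]
        exact LinearMap.ker_zero
      · exact congrArg LinearMap.ker (moduleCatChainComplex_d A g m))
    (congrArg LinearMap.range (moduleCatChainComplex_d A g m))
  -- In the coinvariants of $A\otimes k[G]$ one has $a\otimes g^{-1}=ga\otimes 1$, so the resolution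
  -- for $g^{-1}$ yields the action of $g$ on $A$.
  exact ⟨groupHomologyIso A m (Rep.FiniteCyclicGroup.resolution k g⁻¹ <|
    (@Subgroup.zpowers_inv G ..).symm ▸ hg) ≪≫
    HomologicalComplex.homologyMapIso
      (Rep.FiniteCyclicGroup.coinvariantsTensorResolutionIso A g hg) m ≪≫ e⟩

/-! #### Tor over the group ring -/

/-- The complex of `k[G]`-modules computing `Tor(k, A)`. -/
abbrev torComplex : ChainComplex (ModuleCat.{u} (MonoidAlgebra k G)) ℕ :=
  (((MonoidalCategory.tensoringRight (ModuleCat.{u} (MonoidAlgebra k G))).obj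
    (Rep.toModuleMonoidAlgebra.obj A)).mapHomologicalComplex _).obj
      ((Rep.toModuleMonoidAlgebra.mapHomologicalComplex _).obj
        ((Rep.FiniteCyclicGroup.chainComplexFunctor k g).obj (Rep.leftRegular k G)))

/-- The complex of `k`-modules computing `Tor(k, A)`. -/
abbrev torComplexRestrict : ChainComplex (ModuleCat.{u} k) ℕ :=
  ((ModuleCat.restrictScalars (algebraMap k (MonoidAlgebra k G))).mapHomologicalComplex _).obj
    (torComplex A g)

/-- `Tor` over the group ring of a cyclic group in terms of the periodic resolution. -/
def torIso (hg : ∀ x, x ∈ Subgroup.zpowers g) (m : ℕ) :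
    (ModuleCat.restrictScalars (algebraMap k (MonoidAlgebra k G))).obj
      (((Tor' (ModuleCat.{u} (MonoidAlgebra k G)) m).obj
        (Rep.toModuleMonoidAlgebra.obj (Rep.trivial k G k))).obj
          (Rep.toModuleMonoidAlgebra.obj A)) ≅ (torComplexRestrict A g).homology m :=
  (ModuleCat.restrictScalars (algebraMap k (MonoidAlgebra k G))).mapIso
    ((Rep.toModuleMonoidAlgebra.mapProjectiveResolution
      (Rep.FiniteCyclicGroup.resolution k g hg)).isoLeftDerivedObj
        ((MonoidalCategory.tensoringRight (ModuleCat.{u} (MonoidAlgebra k G))).obj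
          (Rep.toModuleMonoidAlgebra.obj A)) m) ≪≫
    -- Restriction of scalars preserves homology, so it may be applied to the complex itself.
    (((torComplex A g).sc m).mapHomologyIso
      (ModuleCat.restrictScalars (algebraMap k (MonoidAlgebra k G)))).symm

/-- The embedding `y ↦ 1 ⊗ y`. -/
def oneTmul (m : ℕ) : A.V →ₗ[k] (torComplexRestrict A g).X m where
  toFun y := (regularEquiv k G 1 ⊗ₜ[MonoidAlgebra k G] (toRepModule A y) :
    regularModule k G
      ⊗[MonoidAlgebra k G]
      repModule A)
  map_add' x y := by
    rw [map_add]
    exact TensorProduct.tmul_add _ _ _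
  map_smul' c y := by
    rw [toRepModule_smul]
    exact TensorProduct.tmul_smul (algebraMap k (MonoidAlgebra k G) c) (regularEquiv k G 1)
      (toRepModule A y)

theorem oneTmul_eq (m : ℕ) (y : A.V) :
    oneTmul A g m y = (regularTensorEquiv A).symm (toRepModule A y) := by
  refine ((regularTensorEquiv A).eq_symm_apply).2 ?_
  refine (TensorProduct.lid_tmul (R := MonoidAlgebra k G) (toRepModule A y)
    ((regularEquiv k G).symm (regularEquiv k G 1))).trans ?_
  rw [LinearEquiv.symm_apply_apply, one_smul]

theorem oneTmul_bijective (m : ℕ) : Function.Bijective (oneTmul A g m) := by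
  have : (oneTmul A g m : A.V → _) = (regularTensorEquiv A).symm ∘ toRepModule A :=
    funext (oneTmul_eq A g m)
  rw [this]
  exact (regularTensorEquiv A).symm.bijective.comp (toRepModule A).bijective

/-- Each differential of the resolution is $k[G]$-linear on a free module of rank one, hence
determined by the image $a$ of $1$. -/
theorem torComplexRestrict_d_apply (m : ℕ) (y : A.V) (a : MonoidAlgebra k G)
    (ha : (((Rep.FiniteCyclicGroup.chainComplexFunctor k g).obj (Rep.leftRegular k G)).d
      (m + 1) m).hom (1 : MonoidAlgebra k G) = a) :
    ((torComplexRestrict A g).d (m + 1) m).hom (oneTmul A g (m + 1) y) =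
      oneTmul A g m (A.ρ.asAlgebraHom a y) := by
  subst ha
  exact regularEquiv_tmul A _ y

theorem torComplexRestrict_d (m : ℕ) (y : A.V) :
    ((torComplexRestrict A g).d (m + 1) m).hom (oneTmul A g (m + 1) y) =
      oneTmul A g m (repD A.ρ g m y) := by
  have hr : (ComplexShape.down ℕ).Rel (m + 1) m := rfl
  by_cases hm : Even m
  · rw [torComplexRestrict_d_apply A g m y (MonoidAlgebra.single g 1 - 1), repD, if_pos hm,
      map_sub, map_one]
    · congr 2
      rw [Representation.asAlgebraHom_single_one]
    · dsimp only [Rep.FiniteCyclicGroup.chainComplexFunctor, HomologicalComplex.alternatingConst]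
      rw [dif_pos hr, dif_neg (by rwa [Nat.even_add_one, not_not])]
      change Representation.ofMulAction k G G g (MonoidAlgebra.single 1 1) -
        MonoidAlgebra.single 1 1 = _
      simp [MonoidAlgebra.one_def]
  · rw [torComplexRestrict_d_apply A g m y (∑ h, MonoidAlgebra.single h 1), repD, if_neg hm,
      map_sum]
    · congr 2
      simp [Representation.norm]
    · dsimp only [Rep.FiniteCyclicGroup.chainComplexFunctor, HomologicalComplex.alternatingConst]
      rw [dif_pos hr, dif_pos (by rwa [Nat.even_add_one])]
      change (∑ h, Representation.ofMulAction k G G h) (MonoidAlgebra.single 1 1) = _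
      simp

theorem tor_iso (hg : ∀ x, x ∈ Subgroup.zpowers g) (m : ℕ) :
    Nonempty ((ModuleCat.restrictScalars (algebraMap k (MonoidAlgebra k G))).obj
      (((Tor' (ModuleCat.{u} (MonoidAlgebra k G)) m).obj
        (Rep.toModuleMonoidAlgebra.obj (Rep.trivial k G k))).obj
          (Rep.toModuleMonoidAlgebra.obj A)) ≅ ModuleCat.of k
      (Subquotient (repCycles A.ρ g m) (LinearMap.range (repD A.ρ g m)))) := by
  obtain ⟨e⟩ := homology_iso_subquotient (torComplexRestrict A g) m rfl rfl
  obtain ⟨e'⟩ := subquotient_equiv (Z := repCycles A.ρ g m)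
    (B := LinearMap.range (repD A.ρ g m))
    (Z' := LinearMap.ker ((torComplexRestrict A g).d m (m - 1)).hom)
    (B' := LinearMap.range ((torComplexRestrict A g).d (m + 1) m).hom) (oneTmul A g m)
    (fun z hz => by
      rcases m with _ | m
      · rw [HomologicalComplex.shape _ _ _ (by simp)]
        rfl
      · refine (torComplexRestrict_d A g m z).trans ?_
        rw [show repD A.ρ g m z = 0 from hz, map_zero])
    (fun z _ => by
      constructor
      · rintro ⟨x, hx⟩
        obtain ⟨y, rfl⟩ := (oneTmul_bijective A g (m + 1)).2 x
        exact ⟨y, (oneTmul_bijective A g m).1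
          ((torComplexRestrict_d A g m y).symm.trans hx)⟩
      · rintro ⟨y, rfl⟩
        exact ⟨oneTmul A g (m + 1) y, torComplexRestrict_d A g m y⟩)
    (fun z hz => by
      obtain ⟨y, rfl⟩ := (oneTmul_bijective A g m).2 z
      refine ⟨y, ?_, by rw [sub_self]; exact Submodule.zero_mem _⟩
      rcases m with _ | m
      · exact Submodule.mem_top
      · refine (oneTmul_bijective A g m).1 ((torComplexRestrict_d A g m y).symm.trans ?_)
        rw [map_zero]
        exact hz)
  exact ⟨torIso A g hg m ≪≫ e ≪≫ e'.symm.toModuleIso⟩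

end CyclicGroup

/-! ### The cyclic action on tensor powers -/

section CycRep

variable {k : Type u} [CommRing k] {d : ℕ}

theorem mem_zpowers_generator (w : ℕ) [NeZero w] (x : Cyc.{u} w) :
    x ∈ Subgroup.zpowers (⟨Multiplicative.ofAdd 1⟩ : Cyc.{u} w) := by
  refine ⟨(x.down.toAdd.val : ℤ), ?_⟩
  apply ULift.ext
  apply Multiplicative.toAdd.injective
  simp

theorem cycRep_norm (v : ℕ) :
    (cycRep k d (v + 1)).norm = norm k (mbar k d) (v + 1) := by
  rw [Representation.norm, norm, ← Fin.sum_univ_eq_sum_range]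
  -- `ZMod (v + 1)` is `Fin (v + 1)` by definition, so the summands agree by `rfl`.
  exact Fintype.sum_equiv (Equiv.ulift.trans Multiplicative.toAdd) _
    (fun i : Fin (v + 1) => cyc k (mbar k d) (v + 1) ^ (i : ℕ)) fun _ => rfl

/-- The resolution uses $\alpha-1$ and the bicomplex $1-t$. Agreement up to sign is enough, as only
kernels and ranges are compared. -/
theorem repD_cycRep (v m : ℕ) :
    repD (cycRep k d (v + 1)) ⟨Multiplicative.ofAdd 1⟩ m = perD k (mbar k d) (v + 1) m ∨
      repD (cycRep k d (v + 1)) ⟨Multiplicative.ofAdd 1⟩ m = - perD k (mbar k d) (v + 1) m := by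
  rw [repD, perD]
  split_ifs
  · rw [cycRep_generator, neg_sub]
    exact Or.inr rfl
  · exact Or.inl (cycRep_norm v)

theorem range_repD_cycRep (v m : ℕ) :
    LinearMap.range (repD (cycRep k d (v + 1)) ⟨Multiplicative.ofAdd 1⟩ m) =
      LinearMap.range (perD k (mbar k d) (v + 1) m) := by
  rcases repD_cycRep (k := k) (d := d) v m with h | h
  · rw [h]
  · rw [h, LinearMap.range_neg]

theorem repCycles_cycRep (v m : ℕ) :
    repCycles (cycRep k d (v + 1)) ⟨Multiplicative.ofAdd 1⟩ m =
      perCycles k (mbar k d) (v + 1) m := by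
  rcases m with _ | m
  · rfl
  · rw [repCycles, perCycles]
    rcases repD_cycRep (k := k) (d := d) v m with h | h
    · rw [h]
    · rw [h, LinearMap.ker_neg]

theorem torCyc_iso (v m : ℕ) :
    Nonempty (torCyc k d (v + 1) m ≅ ModuleCat.of k
      (Subquotient (perCycles k (mbar k d) (v + 1) m)
        (LinearMap.range (perD k (mbar k d) (v + 1) m)))) := by
  rw [← repCycles_cycRep, ← range_repD_cycRep]
  exact tor_iso (mbarRep k d (v + 1)) _ (mem_zpowers_generator (v + 1)) m

theorem groupHomology_mbarRep_iso (v m : ℕ) :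
    Nonempty (groupHomology (mbarRep k d (v + 1)) m ≅ ModuleCat.of k
      (Subquotient (perCycles k (mbar k d) (v + 1) m)
        (LinearMap.range (perD k (mbar k d) (v + 1) m)))) := by
  rw [← repCycles_cycRep, ← range_repD_cycRep]
  exact groupHomology_iso (mbarRep k d (v + 1)) _ (mem_zpowers_generator (v + 1)) m

end CycRep

end

end CyclicHomology

theorem mainTheorem1 (k : Type u) [CommRing k] (d : ℕ) :
    (∀ n : ℕ, Even n → Nonempty (CyclicHomology.weightHC k d 0 n ≅ ModuleCat.of k k)) ∧
    (∀ n : ℕ, ¬ Even n → Limits.IsZero (CyclicHomology.weightHC k d 0 n)) ∧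
    ∀ (w : ℕ) [NeZero w],
      (∀ n : ℕ, n + 2 ≤ w → Limits.IsZero (CyclicHomology.weightHC k d w n)) ∧
      (∀ n : ℕ, w ≤ n + 1 →
        Nonempty (CyclicHomology.weightHC k d w n ≅ CyclicHomology.torCyc k d w (n + 1 - w)) ∧
        Nonempty (CyclicHomology.weightHC k d w n ≅
          groupHomology (CyclicHomology.mbarRep k d w) (n + 1 - w))) := by
  refine ⟨fun n hn => CyclicHomology.weightHC_zero_iso hn,
    fun n hn => CyclicHomology.isZero_weightHC_zero hn, ?_⟩
  intro w _
  refine ⟨fun n hn => CyclicHomology.isZero_weightHC n hn, fun n hn => ?_⟩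
  -- With $w=v+1$ and $n=v+m$ the homological degree $n+1-w$ is $m$, free of truncated subtraction.
  obtain ⟨v, rfl⟩ := Nat.exists_eq_succ_of_ne_zero (NeZero.ne w)
  obtain ⟨m, rfl⟩ := Nat.exists_eq_add_of_le (Nat.le_of_succ_le_succ hn)
  have hm : v + m + 1 - v.succ = m := by omega
  rw [hm]
  obtain ⟨e⟩ := CyclicHomology.weightHC_iso_of_pos (k := k) (d := d) v m
  obtain ⟨e'⟩ := CyclicHomology.torCyc_iso (k := k) (d := d) v m
  obtain ⟨e''⟩ := CyclicHomology.groupHomology_mbarRep_iso (k := k) (d := d) v m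
  exact ⟨⟨e ≪≫ e'.symm⟩, ⟨e ≪≫ e''.symm⟩⟩
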